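/- **Conventions.** For a polytope $P$ let $V(P)$ be its vertex set and $L(P)$ its face lattice (with $\dim\emptyset=-1$). For a $d$-polytope $P$, $d\ge 2$, let $E(P)$ be the poset consisting of all intervals $[y,z]\subset L(P)$ with $\dim y<d-2<\dim z$ and all one-element intervals $[R,R]$ with $\dim R=d-2$, ordered by reversed inclusion, together with a maximal element. (It is the face poset of the CW sphere obtained from $\partial P$ by stellarly subdividing all facets and merging the facets of the subdivision that share a ridge of $P$.) A point is *beyond* a facet $F$ of $P$ if it violates the inequality defining $F$ and strictly satisfies the inequalities of all other facets. A *vertex-preserving realisation* of $E(P)$ is a polytope $Q=\operatorname{conv}\bigl(V(P)\cup\{p_F : F\text{ a facet of }P\}\bigr)$, with $p_F$ a point beyond $F$, such that $[y,z]\mapsto \operatorname{conv}\bigl(y\cup\{p_F : F\supseteq z \text{ a facet of } P\}\bigr)$ (and the maximal element $\mapsto Q$) is an isomorphism from $E(P)$ onto $L(Q)$. **Theorem.** Let $m,n\ge 3$. The following two statements are equivalent. (i) There are a regular $m$-gon $P_0\subset\mathbb R^2$, a regular $n$-gon $P_1\subset\mathbb R^2$, and a vertex-preserving realisation $Q\subset\mathbb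 R^2\times\mathbb R^2$ of $E_{mn}=E(P_0\times P_1)$, with new vertex $p_F$ beyond each facet $F$ of $P_0\times P_1$, such that, with $\pi_0,\pi_1:\mathbb R^2\times\mathbb R^2\to\mathbb R^2$ the coordinate projections: 1. $\pi_0(Q)$ is a regular $m$-gon and is a vertex-preserving realisation of $E(P_0)$ with new vertex $\pi_0(p_{F_0\times P_1})$ beyond each edge $F_0$ of $P_0$; and $\pi_1(Q)$ is a regular $n$-gon and is a vertex-preserving realisation of $E(P_1)$ with new vertex $\pi_1(p_{P_0\times F_1})$ beyond each edge $F_1$ of $P_1$; 2. all intersection ratios are equal in each factor: there are constants $r_0,r_1$ such that for all edges $F_0$ of $P_0$ and $F_1$ of $P_1$ the segment from $\pi_0(p_{P_0\times F_1})$ to $\pi_0(p_{F_0\times P_1})$ meets the boundary of $P_0$ in a point that divides off the fraction $r_0$ of its length, measured from $\pi_0(p_{P_0\times F_1})$, and the segment from $\pi_1(p_{F_0\times P_1})$ to $\pi_1(p_{P_0\times F_1})$ meets the boundary of $P_1$ in a point that divides off the fraction $r_1$ of its length, measured from $\pi_1(p_{F_0\times P_1})$. (ii) $\dfrac1m+\dfrac1n\ge\dfrac12$.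 -/

import Mathlib

namespace EPolytope

section General

variable {E : Type*} [AddCommGroup E] [Module ℝ E] [TopologicalSpace E]

/-- The dimension of the affine hull of `S`, with `dim ∅ = -1`. -/
noncomputable def polyDim (S : Set E) : ℤ :=
  open Classical in if S.Nonempty then (Module.finrank ℝ (vectorSpan ℝ S) : ℤ) else -1

/-- The face lattice of a polytope `P`, ordered by inclusion: the empty face, `P` itself, and the
sets of points of `P` at which some linear functional attains its maximum over `P`. -/
abbrev Face (P : Set E) : Type _ := {F : Set E // IsExposed ℝ P F}

/-- The facets of a polytope: the faces of codimension one. -/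
def IsFacet (P F : Set E) : Prop :=
  IsExposed ℝ P F ∧ polyDim F = polyDim P - 1

/-- The proper elements of the `E`-construction of a `d`-polytope `P` (`d ≥ 2`): the intervals
`[y, z]` of the face lattice of `P` with `dim y < d - 2 < dim z`, and the one-element intervals
`[R, R]` with `R` a ridge, that is, `dim R = d - 2`. -/
def IsEInterval (P : Set E) (I : NonemptyInterval (Face P)) : Prop :=
  (polyDim I.fst.1 < polyDim P - 2 ∧ polyDim P - 2 < polyDim I.snd.1) ∨
    (I.fst = I.snd ∧ polyDim I.fst.1 = polyDim P - 2)

/-- The face poset of the `E`-sphere `E(P)` (with bottom and top added): the intervals above,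
ordered by reversed inclusion, together with a top element. Its bottom is `[∅, P]`. An interval
`[y, P]` stands for an old face `y`; an interval `[y, F]` with `F` a facet stands for the pyramid
over `y` whose apex is the new vertex that subdivides `F`; an interval `[R, R]` stands for the
facet of `E(P)`, a bipyramid over the ridge `R`, that arises from merging the two facets of the
subdivision that share `R`. -/
abbrev EConstruction (P : Set E) : Type _ :=
  WithTop ({I : NonemptyInterval (Face P) // IsEInterval P I}ᵒᵈ)

/-- The point `x` lies beyond the facet `F` of `P`: it violates the inequality that
defines `F`, and satisfies strictly those that define the other facets. -/
def IsBeyond (P F : Set E) (x : E) : Prop :=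
  ∀ G, IsFacet P G → ∀ l : E →L[ℝ] ℝ, G = l.toExposed P →
    ∀ g ∈ G, (G = F → l g < l x) ∧ (G ≠ F → l x < l g)

/-- `Q` is a vertex-preserving polytopal realisation of `E(P)`, where `p F` is the new vertex
beyond the facet `F` of `P` (values of `p` at other sets play no role): `Q` is the convex
hull of the vertices of `P` and the new vertices, and the face lattice of `Q` is `E(P)`, the
face for the interval `[y, z]` being spanned by `y` and the new vertices beyond the facets
of `P` that contain `z`. -/
structure IsVertexPreservingRealisation (P Q : Set E) (p : Set E → E) : Prop where
  beyond : ∀ F, IsFacet P F → IsBeyond P F (p F)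
  hull : Q = convexHull ℝ (P.extremePoints ℝ ∪ p '' {F | IsFacet P F})
  lattice : ∃ φ : EConstruction P ≃o Face Q,
    ∀ I : {I : NonemptyInterval (Face P) // IsEInterval P I},
      (φ (WithTop.some (OrderDual.toDual I))).1 =
        convexHull ℝ (I.1.fst.1 ∪ p '' {F | IsFacet P F ∧ I.1.snd.1 ⊆ F})

end General

/-- The Euclidean plane. -/
abbrev Plane : Type := EuclideanSpace ℝ (Fin 2)

/-- `P` is a (convex, filled) regular `k`-gon. -/
def IsRegularPolygon (k : ℕ) (P : Set Plane) : Prop :=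
  ∃ (c : Plane) (ρ θ : ℝ), 0 < ρ ∧
    P = convexHull ℝ (Set.range fun j : Fin k =>
      c + ρ • (!₂[Real.cos (θ + 2 * Real.pi * (j : ℝ) / k),
        Real.sin (θ + 2 * Real.pi * (j : ℝ) / k)] : Plane))

/-- The segment from the point `s` of `P` to the point `v` outside of `P` meets the boundary
of `P` at a point `q` with `|s,q| = r |s,v|`. -/
def HasIntersectionRatio (P : Set Plane) (s v : Plane) (r : ℝ) : Prop :=
  ∃ q ∈ segment ℝ s v ∩ frontier P, dist s q = r * dist s v

end EPolytope

/-! Necessity is an averaging argument in each factor, coupled by one type of facet. Compare an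
inner regular k-gon of circumradius ρ with the outer one. Different inner vertices lie on different
outer edges, so, averaging over these edges, the outer inradius is at most ρ and the outer
circumradius at most ρ / cos (π/k). Hence the new vertices rise above the inner edges on average by
at most ρ sin² (π/k) / cos (π/k) (`sum_height_le`). The point from which the ratio r is measured
lies below the edge lines by ρ cos (π/k) on average, wherever it is, because the edge normals sum to
zero. Comparing the two averages gives (1 - r) cos² (π/k) ≤ r sin² (π/k) (`cos_sq_le_of_ratio`).

The coupling comes from the facets of Q over ridges edge × edge. The normal of such a facet is a
combination of the two edge normals, and its hyperplane also contains the two adjacent new vertices;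
`mul_eq_of_ratios` turns this into a relation of heights and depths that amounts to r₀ + r₁ = 1.
Multiplying the inequalities of the two factors yields cos (π/m) cos (π/n) ≤ sin (π/m) sin (π/n),
that is, cos (π/m + π/n) ≤ 0.

For sufficiency, take the inner polygon with circumradius 1 and the origin as center, and outer
edges through its vertices with normals turned by an angle φ, |φ| < π/k (`isNested_rotate`). The
ratio measured from the origin is then κ = cos² (π/k) / cos² φ, so it can be increased from cos²
(π/k) up to any value below 1. The hypothesis says cos² (π/m) + cos² (π/n) ≤ 1, so turning only one
outer polygon achieves κ₀ + κ₁ = 1 (`exists_rotation`). The new vertices are (v, 0) and (0, v'),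
with v and v' the outer vertices. The facets are the lifted outer edges U = 1 of either factor, and
the hyperplanes u₀ + u₁ = 1, where u is an edge normal of the inner polygon scaled to be κ on its
edge and 1 at the new vertex beyond it; κ₀ + κ₁ = 1 is what puts edge × edge on the last kind.

It remains to identify the whole face lattice. A facet system (`IsFacetSystem`) records the
incidences of the candidate hyperplanes and a fan condition: every functional is maximal at a point
of Q, and its face is cut out by candidate hyperplanes. Then every nonempty face is an intersection
of candidates, and these intersections match the intervals as soon as an interval is determined by
its ridges (`isRidgeGenerated_prod`). For the product, the fan condition is proved in
`isVertexPreservingRealisation_prod` by trading multiples of the normals of the two factors against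
each other. -/

namespace EPolytope

/-! ### Dimensions of faces -/

section Dimension

variable {E : Type*} [AddCommGroup E] [Module ℝ E]

theorem polyDim_of_nonempty {S : Set E} (hS : S.Nonempty) :
    polyDim S = (Module.finrank ℝ (vectorSpan ℝ S) : ℤ) := if_pos hS

@[simp]
theorem polyDim_empty : polyDim (∅ : Set E) = -1 := if_neg Set.not_nonempty_empty

theorem neg_one_le_polyDim (S : Set E) : -1 ≤ polyDim S := by
  unfold polyDim
  split_ifs <;> omega

variable [FiniteDimensional ℝ E]

theorem polyDim_mono {S T : Set E} (h : S ⊆ T) : polyDim S ≤ polyDim T := by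
  rcases S.eq_empty_or_nonempty with rfl | hS
  · rw [polyDim_empty]; exact neg_one_le_polyDim T
  · rw [polyDim_of_nonempty hS, polyDim_of_nonempty (hS.mono h)]
    exact_mod_cast Submodule.finrank_mono (vectorSpan_mono ℝ h)

variable [TopologicalSpace E]

/-- The exposing functional is constant on `S` and so vanishes on its direction space. Were the
direction spaces equal, it would be constant on `T` too, and `T` would lie in `S`. -/
theorem polyDim_lt_of_isExposed {P S T : Set E} (hS : IsExposed ℝ P S) (hT : T ⊆ P)
    (h : S ⊂ T) : polyDim S < polyDim T := by
  rcases S.eq_empty_or_nonempty with rfl | hne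
  · rw [polyDim_empty, polyDim_of_nonempty (Set.empty_ssubset.1 h)]
    omega
  · obtain ⟨l, hl⟩ := hS hne
    obtain ⟨x, hx⟩ := hne
    obtain ⟨y, hyT, hyS⟩ := Set.exists_of_ssubset h
    rw [polyDim_of_nonempty ⟨x, hx⟩, polyDim_of_nonempty ⟨y, hyT⟩]
    have hx' := hx
    rw [hl] at hx'
    have hker : vectorSpan ℝ S ≤ LinearMap.ker l.toLinearMap := by
      rw [vectorSpan, Submodule.span_le]
      rintro _ ⟨a, ha, b, hb, rfl⟩
      rw [hl] at ha hb
      have : l a = l b := le_antisymm (hb.2 a ha.1) (ha.2 b hb.1)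
      simp [this]
    have hlt : vectorSpan ℝ S < vectorSpan ℝ T := by
      refine lt_of_le_of_ne (vectorSpan_mono ℝ h.subset) fun he => hyS ?_
      have hm : y - x ∈ vectorSpan ℝ S := by
        rw [he]
        exact vsub_mem_vectorSpan ℝ hyT (h.subset hx)
      have h0 : l y = l x := by
        have := hker hm
        simp only [LinearMap.mem_ker, ContinuousLinearMap.coe_coe, map_sub] at this
        linarith
      rw [hl]
      exact ⟨hT hyT, fun z hz => by rw [h0]; exact hx'.2 z hz⟩
    exact_mod_cast Submodule.finrank_lt_finrank_of_lt hlt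

theorem eq_of_polyDim_le {P S T : Set E} (hS : IsExposed ℝ P S) (hT : T ⊆ P) (h : S ⊆ T)
    (hd : polyDim T ≤ polyDim S) : S = T := by
  by_contra hne
  exact absurd (polyDim_lt_of_isExposed hS hT (h.ssubset_of_ne hne)) (not_lt.2 hd)

end Dimension

/-! ### A criterion for realising the `E`-construction -/

section Realisation

variable {E : Type*} [AddCommGroup E] [Module ℝ E] [TopologicalSpace E]

/-- A point of a convex hull at which linear functionals attain upper bounds for the generators is
a convex combination of generators attaining these bounds. -/
theorem mem_convexHull_of_forall_eq {ι : Type*} {W : Set E} (f : ι → E →L[ℝ] ℝ) (c : ι → ℝ)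
    (h : ∀ i, ∀ w ∈ W, f i w ≤ c i) {x : E} (hx : x ∈ convexHull ℝ W)
    (hfx : ∀ i, f i x = c i) : x ∈ convexHull ℝ {w ∈ W | ∀ i, f i w = c i} := by
  set T : Set E := {x | (∀ i, f i x ≤ c i) ∧
    ((∀ i, f i x = c i) → x ∈ convexHull ℝ {w ∈ W | ∀ i, f i w = c i})} with hT
  have hconv : Convex ℝ T := by
    intro x hx y hy a b ha hb hab
    refine ⟨fun i => ?_, fun he => ?_⟩
    · have h1 := hx.1 i
      have h2 := hy.1 i
      simp only [map_add, map_smul, smul_eq_mul]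
      calc a * f i x + b * f i y ≤ a * c i + b * c i := by gcongr
        _ = c i := by rw [← add_mul, hab, one_mul]
    -- A point that enters with weight zero need not attain the bounds, so the two degenerate
    -- combinations are treated separately.
    · rcases ha.eq_or_lt with rfl | ha'
      · obtain rfl : b = 1 := by linarith
        simp only [zero_smul, one_smul, zero_add] at he ⊢
        exact hy.2 he
      rcases hb.eq_or_lt with rfl | hb'
      · obtain rfl : a = 1 := by linarith
        simp only [zero_smul, one_smul, add_zero] at he ⊢
        exact hx.2 he
      have key : ∀ i, f i x = c i ∧ f i y = c i := by
        intro i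
        have h1 := hx.1 i
        have h2 := hy.1 i
        have h3 := he i
        simp only [map_add, map_smul, smul_eq_mul] at h3
        have h4 : a * (c i - f i x) + b * (c i - f i y) = 0 := by
          have : a * c i + b * c i = c i := by rw [← add_mul, hab, one_mul]
          linarith
        have h5 : 0 ≤ a * (c i - f i x) := mul_nonneg ha (by linarith)
        have h6 : 0 ≤ b * (c i - f i y) := mul_nonneg hb (by linarith)
        have h7 : a * (c i - f i x) = 0 := by linarith
        have h8 : b * (c i - f i y) = 0 := by linarith
        constructor
        · rcases mul_eq_zero.1 h7 with h | h <;> linarith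
        · rcases mul_eq_zero.1 h8 with h | h <;> linarith
      exact (convex_convexHull ℝ _) (hx.2 fun i => (key i).1) (hy.2 fun i => (key i).2) ha hb hab
  have hsub : W ⊆ T := fun w hw =>
    ⟨fun i => h i w hw, fun he => subset_convexHull ℝ _ ⟨hw, he⟩⟩
  exact (convexHull_min hsub hconv hx).2 hfx

theorem le_of_mem_convexHull {W : Set E} (l : E →L[ℝ] ℝ) {c : ℝ} (h : ∀ w ∈ W, l w ≤ c) {x : E}
    (hx : x ∈ convexHull ℝ W) : l x ≤ c :=
  convexHull_min (s := W) (t := {x | l x ≤ c}) h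
    (convex_halfSpace_le l.toLinearMap.isLinear c) hx

theorem eq_of_mem_convexHull {W : Set E} (l : E →L[ℝ] ℝ) {c : ℝ} (h : ∀ w ∈ W, l w = c) {x : E}
    (hx : x ∈ convexHull ℝ W) : l x = c :=
  convexHull_min (s := W) (t := {x | l x = c}) h
    (convex_hyperplane l.toLinearMap.isLinear c) hx

/-- A convex combination attains the maximum of a functional only if it uses generators that attain
it. This makes faces comparable through their vertices. -/
theorem _root_.IsExposed.eq_convexHull {W F : Set E} (hF : IsExposed ℝ (convexHull ℝ W) F) :
    F = convexHull ℝ (W ∩ F) := by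
  apply Set.Subset.antisymm
  · intro x hx
    obtain ⟨l, hl⟩ := hF ⟨x, hx⟩
    have hx' := hx
    rw [hl] at hx'
    have := mem_convexHull_of_forall_eq (ι := Unit) (W := W) (fun _ => l) (fun _ => l x)
      (fun _ w hw => hx'.2 w (subset_convexHull ℝ _ hw)) hx'.1 (fun _ => rfl)
    refine convexHull_mono ?_ this
    rintro w ⟨hw, he⟩
    refine ⟨hw, ?_⟩
    rw [hl]
    exact ⟨subset_convexHull ℝ _ hw, fun y hy => by rw [he ()]; exact hx'.2 y hy⟩
  · exact convexHull_min Set.inter_subset_right (hF.convex (convex_convexHull ℝ W))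

theorem finite_setOf_isExposed {W : Set E} (hW : W.Finite) :
    {F | IsExposed ℝ (convexHull ℝ W) F}.Finite := by
  refine Set.Finite.of_injOn (f := fun F => W ∩ F) (t := 𝒫 W) (fun F _ => Set.inter_subset_left)
    ?_ hW.finite_subsets
  intro F hF G hG h
  rw [IsExposed.eq_convexHull hF, IsExposed.eq_convexHull hG]
  exact congrArg _ h

/-- The ridges of a polytope: the faces of codimension two. -/
def IsRidge (P R : Set E) : Prop :=
  IsExposed ℝ P R ∧ polyDim R = polyDim P - 2

/-- The functional `l` attains its maximum over `Q` at `x`, and the face of `Q` at which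
it does so is cut out by some of the hyperplanes `f R = 1`, `R ∈ 𝓡`. -/
def SupportedBy (Q : Set E) (𝓡 : Set (Set E)) (f : Set E → E →L[ℝ] ℝ) (x : E)
    (l : E →L[ℝ] ℝ) : Prop :=
  ∃ S ⊆ 𝓡, ∀ y ∈ Q, l y ≤ l x ∧ (l y = l x ↔ ∀ R ∈ S, f R y = 1)

namespace SupportedBy

variable {Q : Set E} {𝓡 : Set (Set E)} {f : Set E → E →L[ℝ] ℝ} {x : E} {l l' : E →L[ℝ] ℝ}

theorem zero : SupportedBy Q 𝓡 f x 0 := ⟨∅, Set.empty_subset _, fun y _ => by simp⟩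

theorem of_mem {R : Set E} (hR : R ∈ 𝓡) (hx : f R x = 1) (hQ : ∀ y ∈ Q, f R y ≤ 1) :
    SupportedBy Q 𝓡 f x (f R) :=
  ⟨{R}, by simpa using hR, fun y hy => by rw [hx]; simpa using hQ y hy⟩

/-- Both functionals are maximal at the same `x`, so their sum is maximal exactly where both are.
The common point is essential; it is why the fan condition asks for a single supporting point. -/
theorem add (h : SupportedBy Q 𝓡 f x l) (h' : SupportedBy Q 𝓡 f x l') :
    SupportedBy Q 𝓡 f x (l + l') := by
  obtain ⟨S, hS, h⟩ := h
  obtain ⟨S', hS', h'⟩ := h'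
  refine ⟨S ∪ S', Set.union_subset hS hS', fun y hy => ?_⟩
  have h1 := h y hy
  have h2 := h' y hy
  refine ⟨by simpa using add_le_add h1.1 h2.1, ?_⟩
  have : (l + l') y = (l + l') x ↔ l y = l x ∧ l' y = l' x := by
    simp only [add_apply]
    constructor
    · intro h; constructor <;> linarith [h1.1, h2.1]
    · rintro ⟨h, h'⟩; rw [h, h']
  rw [this, h1.2, h2.2]
  simp only [Set.mem_union, or_imp, forall_and]

theorem smul {a : ℝ} (ha : 0 ≤ a) (h : SupportedBy Q 𝓡 f x l) :
    SupportedBy Q 𝓡 f x (a • l) := by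
  rcases ha.eq_or_lt with rfl | ha'
  · rw [zero_smul]; exact zero
  obtain ⟨S, hS, h⟩ := h
  refine ⟨S, hS, fun y hy => ⟨?_, ?_⟩⟩
  · simpa using mul_le_mul_of_nonneg_left (h y hy).1 ha
  · rw [← (h y hy).2]
    simp [ha'.ne']

end SupportedBy

/-- Hyperplanes `f R = 1`, one for each ridge `R` of `P`, that cut out facets with the vertices
required of a vertex-preserving realisation of `E(P)`, such that the normal cones of these facets
cover the dual space. -/
structure IsFacetSystem (P : Set E) (p : Set E → E) (f : Set E → E →L[ℝ] ℝ) : Prop where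
  le_vertex : ∀ R, IsRidge P R → ∀ v ∈ P.extremePoints ℝ, f R v ≤ 1
  eq_vertex : ∀ R, IsRidge P R → ∀ v ∈ P.extremePoints ℝ, (f R v = 1 ↔ v ∈ R)
  le_new : ∀ R, IsRidge P R → ∀ F, IsFacet P F → f R (p F) ≤ 1
  eq_new : ∀ R, IsRidge P R → ∀ F, IsFacet P F → (f R (p F) = 1 ↔ R ⊆ F)
  fan : ∀ l, ∃ x ∈ convexHull ℝ (P.extremePoints ℝ ∪ p '' {F | IsFacet P F}),
    SupportedBy (convexHull ℝ (P.extremePoints ℝ ∪ p '' {F | IsFacet P F})) {R | IsRidge P R} f x l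

/-- An interval of the face lattice of `P` is determined by the ridges that it contains: its least
element is their intersection, and they generate its greatest element. -/
def IsRidgeGenerated (P y z : Set E) : Prop :=
  (∀ x ∈ P, (∀ R, IsRidge P R → y ⊆ R → R ⊆ z → x ∈ R) → x ∈ y) ∧
    ∀ F, IsFacet P F → (∀ R, IsRidge P R → y ⊆ R → R ⊆ z → R ⊆ F) → z ⊆ F

namespace IsFacetSystem

variable {P : Set E} {p : Set E → E} {f : Set E → E →L[ℝ] ℝ}

theorem le_one (hf : IsFacetSystem P p f) {R : Set E} (hR : IsRidge P R) {x : E}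
    (hx : x ∈ convexHull ℝ (P.extremePoints ℝ ∪ p '' {F | IsFacet P F})) : f R x ≤ 1 := by
  refine le_of_mem_convexHull _ ?_ hx
  rintro w (hw | ⟨F, hF, rfl⟩)
  · exact hf.le_vertex R hR w hw
  · exact hf.le_new R hR F hF

/-- The vertices of the faces cut out by some of the hyperplanes of a facet system. -/
theorem setOf_eq_convexHull (hf : IsFacetSystem P p f) {S : Set (Set E)}
    (hS : ∀ R ∈ S, IsRidge P R) :
    {x ∈ convexHull ℝ (P.extremePoints ℝ ∪ p '' {F | IsFacet P F}) | ∀ R ∈ S, f R x = 1} =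
      convexHull ℝ ({v ∈ P.extremePoints ℝ | ∀ R ∈ S, v ∈ R} ∪
        p '' {F | IsFacet P F ∧ ∀ R ∈ S, R ⊆ F}) := by
  apply Set.Subset.antisymm
  · rintro x ⟨hx, hxS⟩
    have := mem_convexHull_of_forall_eq (ι := S) (fun R => f R) (fun _ => 1)
      (fun R w hw => hf.le_one (hS R R.2) (subset_convexHull ℝ _ hw)) hx (fun R => hxS R R.2)
    refine convexHull_mono ?_ this
    rintro w ⟨hw | ⟨F, hF, rfl⟩, hwS⟩
    · exact Or.inl ⟨hw, fun R hR => (hf.eq_vertex R (hS R hR) w hw).1 (hwS ⟨R, hR⟩)⟩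
    · exact Or.inr ⟨F, ⟨hF, fun R hR => (hf.eq_new R (hS R hR) F hF).1 (hwS ⟨R, hR⟩)⟩, rfl⟩
  · intro x hx
    refine ⟨convexHull_mono (Set.union_subset_union (Set.sep_subset _ _)
      (Set.image_mono fun F hF => hF.1)) hx, fun R hR => eq_of_mem_convexHull _ ?_ hx⟩
    rintro w (⟨hw, hwS⟩ | ⟨F, ⟨hF, hFS⟩, rfl⟩)
    · exact (hf.eq_vertex R (hS R hR) w hw).2 (hwS R hR)
    · exact (hf.eq_new R (hS R hR) F hF).2 (hFS R hR)

/-- The sum of the functionals over `S` exposes the set: each summand is at most 1 on the hull, and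
at a point of the set all reach 1 at once. -/
theorem isExposed_setOf (hf : IsFacetSystem P p f) {S : Set (Set E)}
    (hS : ∀ R ∈ S, IsRidge P R) (hfin : S.Finite) :
    IsExposed ℝ (convexHull ℝ (P.extremePoints ℝ ∪ p '' {F | IsFacet P F}))
      {x ∈ convexHull ℝ (P.extremePoints ℝ ∪ p '' {F | IsFacet P F}) | ∀ R ∈ S, f R x = 1} := by
  set Q := convexHull ℝ (P.extremePoints ℝ ∪ p '' {F | IsFacet P F})
  rintro ⟨x, hx, hxS⟩
  refine ⟨∑ R ∈ hfin.toFinset, f R, ?_⟩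
  have hval : ∀ y, (∑ R ∈ hfin.toFinset, f R) y = ∑ R ∈ hfin.toFinset, f R y := fun y => by
    simp
  ext y
  constructor
  · rintro ⟨hy, hyS⟩
    refine ⟨hy, fun z hz => ?_⟩
    rw [hval, hval]
    refine Finset.sum_le_sum fun R hR => ?_
    rw [hfin.mem_toFinset] at hR
    rw [hyS R hR]
    exact hf.le_one (hS R hR) hz
  · rintro ⟨hy, hymax⟩
    refine ⟨hy, fun R hR => ?_⟩
    have h1 := hymax x hx
    rw [hval, hval] at h1
    have h2 : ∀ R ∈ hfin.toFinset, f R y ≤ f R x := fun R hR => by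
      rw [hfin.mem_toFinset] at hR
      rw [hxS R hR]
      exact hf.le_one (hS R hR) hy
    have h3 := (Finset.sum_eq_sum_iff_of_le h2).1 (le_antisymm (Finset.sum_le_sum h2) h1) R
      (hfin.mem_toFinset.2 hR)
    rw [h3, hxS R hR]

variable [FiniteDimensional ℝ E]

/-- A facet system for a polytope whose intervals are generated by ridges yields a
vertex-preserving realisation of the `E`-construction. -/
theorem isVertexPreservingRealisation (hf : IsFacetSystem P p f)
    (hfin : (P.extremePoints ℝ).Finite) (hP : convexHull ℝ (P.extremePoints ℝ) = P)
    (hdim : 2 ≤ polyDim P) (hb : ∀ F, IsFacet P F → IsBeyond P F (p F))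
    (hgen : ∀ y z, IsExposed ℝ P y → IsExposed ℝ P z → y ⊆ z → polyDim y < polyDim P - 2 →
      polyDim P - 2 < polyDim z → (y = ∅ → z ≠ P) → IsRidgeGenerated P y z) :
    IsVertexPreservingRealisation P
      (convexHull ℝ (P.extremePoints ℝ ∪ p '' {F | IsFacet P F})) p := by
  refine ⟨hb, rfl, ?_⟩
  set Q := convexHull ℝ (P.extremePoints ℝ ∪ p '' {F | IsFacet P F}) with hQ
  have hexp : ∀ {F}, IsExposed ℝ P F → F = convexHull ℝ (P.extremePoints ℝ ∩ F) := by
    intro F hF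
    rw [← hP] at hF
    exact hF.eq_convexHull
  have hfaces : {F | IsExposed ℝ P F}.Finite := by
    have := finite_setOf_isExposed hfin
    rwa [hP] at this
  have hPfacet : ∀ F, IsFacet P F → ¬ P ⊆ F := by
    intro F hF h
    have := polyDim_mono h
    have := hF.2
    omega
  -- the ridges in an interval
  let S : {I : NonemptyInterval (Face P) // IsEInterval P I} → Set (Set E) :=
    fun I => {R | IsRidge P R ∧ I.1.fst.1 ⊆ R ∧ R ⊆ I.1.snd.1}
  have hSr : ∀ I, ∀ R ∈ S I, IsRidge P R := fun I R hR => hR.1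
  let H : {I : NonemptyInterval (Face P) // IsEInterval P I} → Set E :=
    fun I => convexHull ℝ (I.1.fst.1 ∪ p '' {F | IsFacet P F ∧ I.1.snd.1 ⊆ F})
  have hygen : ∀ I : {I : NonemptyInterval (Face P) // IsEInterval P I},
      (I.1.fst.1 = ∅ → I.1.snd.1 ≠ P) → IsRidgeGenerated P I.1.fst.1 I.1.snd.1 := by
    rintro ⟨I, hI⟩ h
    rcases hI with ⟨h1, h2⟩ | ⟨h1, h2⟩
    · exact hgen _ _ I.fst.2 I.snd.2 I.fst_le_snd h1 h2 h
    · have hr : IsRidge P I.fst.1 := ⟨I.fst.2, h2⟩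
      simp only [← h1]
      exact ⟨fun x _ hx => hx _ hr subset_rfl subset_rfl,
        fun F _ hF => hF _ hr subset_rfl subset_rfl⟩
  have hdimy : ∀ I : {I : NonemptyInterval (Face P) // IsEInterval P I},
      polyDim I.1.fst.1 < polyDim P := by
    rintro ⟨I, ⟨h1, -⟩ | ⟨-, h1⟩⟩ <;> simp only <;> omega
  have hneP : ∀ I : {I : NonemptyInterval (Face P) // IsEInterval P I}, ¬ P ⊆ I.1.fst.1 := by
    intro I h
    have := polyDim_mono h
    have := hdimy I
    omega
  -- Ridge generation translates the prescribed hull into the intersection of the hyperplanes of the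
  -- ridges in the interval.
  have hH : ∀ I, (I.1.fst.1 = ∅ → I.1.snd.1 ≠ P) →
      H I = {x ∈ Q | ∀ R ∈ S I, f R x = 1} := by
    intro I h
    obtain ⟨g1, g2⟩ := hygen I h
    rw [hQ, hf.setOf_eq_convexHull (hSr I)]
    simp only [H]
    have e1 : P.extremePoints ℝ ∩ I.1.fst.1 = {v ∈ P.extremePoints ℝ | ∀ R ∈ S I, v ∈ R} := by
      ext v
      refine and_congr_right fun hv => ⟨fun hy R hR => hR.2.1 hy, fun hR => ?_⟩
      exact g1 v hv.1 fun R h1 h2 h3 => hR R ⟨h1, h2, h3⟩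
    have e2 : {F | IsFacet P F ∧ I.1.snd.1 ⊆ F} = {F | IsFacet P F ∧ ∀ R ∈ S I, R ⊆ F} := by
      ext F
      refine and_congr_right fun hF => ⟨fun hy R hR => hR.2.2.trans hy, fun hR => ?_⟩
      exact g2 F hF fun R h1 h2 h3 => hR R ⟨h1, h2, h3⟩
    rw [← e1, ← e2]
    conv_lhs => rw [hexp I.1.fst.2]
    rw [convexHull_convexHull_union_left]
  -- The bottom interval, for which ridge generation is not assumed, has neither old vertices nor
  -- apexes, since no facet contains `P`.
  have hHe : ∀ I, I.1.fst.1 = ∅ → I.1.snd.1 = P → H I = ∅ := by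
    intro I h1 h2
    have : {F | IsFacet P F ∧ I.1.snd.1 ⊆ F} = ∅ := by
      ext F
      simp only [Set.mem_ofPred_eq, Set.mem_empty_iff_false, iff_false, not_and, h2]
      exact hPfacet F
    simp only [H, this, h1, Set.image_empty, Set.union_empty, convexHull_empty]
  have hHexp : ∀ I, IsExposed ℝ Q (H I) := by
    intro I
    by_cases h : I.1.fst.1 = ∅ → I.1.snd.1 ≠ P
    · rw [hH I h]
      exact hf.isExposed_setOf (hSr I) (hfaces.subset fun R hR => hR.1.1)
    · push Not at h
      rw [hHe I h.1 h.2]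
      exact isExposed_empty
  -- the vertices of the faces
  have hold : ∀ I, ∀ v ∈ P.extremePoints ℝ, v ∈ H I → v ∈ I.1.fst.1 := by
    intro I v hv hvI
    by_cases h : I.1.fst.1 = ∅ → I.1.snd.1 ≠ P
    · rw [hH I h] at hvI
      exact (hygen I h).1 v hv.1 fun R h1 h2 h3 =>
        (hf.eq_vertex R h1 v hv).1 (hvI.2 R ⟨h1, h2, h3⟩)
    · push Not at h
      rw [hHe I h.1 h.2] at hvI
      exact absurd hvI (Set.notMem_empty _)
  have hnew : ∀ I, ∀ F, IsFacet P F → p F ∈ H I → I.1.snd.1 ⊆ F := by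
    intro I F hF hFI
    by_cases h : I.1.fst.1 = ∅ → I.1.snd.1 ≠ P
    · rw [hH I h] at hFI
      exact (hygen I h).2 F hF fun R h1 h2 h3 =>
        (hf.eq_new R h1 F hF).1 (hFI.2 R ⟨h1, h2, h3⟩)
    · push Not at h
      rw [hHe I h.1 h.2] at hFI
      exact absurd hFI (Set.notMem_empty _)
  have hle : ∀ I J, H I ⊆ H J ↔ J.1 ≤ I.1 := by
    intro I J
    constructor
    · intro h
      have hy : I.1.fst.1 ⊆ J.1.fst.1 := by
        rw [hexp I.1.fst.2]
        refine convexHull_min (fun v hv => hold J v hv.1 (h ?_)) ?_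
        · exact subset_convexHull ℝ _ (Or.inl hv.2)
        · have := convex_convexHull ℝ (P.extremePoints ℝ)
          rw [hP] at this
          exact J.1.fst.2.convex this
      have hF : ∀ F, IsFacet P F → I.1.snd.1 ⊆ F → J.1.snd.1 ⊆ F := fun F hF hIF =>
        hnew J F hF (h (subset_convexHull ℝ _ (Or.inr ⟨F, ⟨hF, hIF⟩, rfl⟩)))
      -- If `I.snd` is a facet, its own apex lies in `H I` and hence in `H J`; if it is `P`, nothing
      -- is to be shown; if `I` is a single ridge, dimensions force `J` to be the same ridge.
      have hz : J.1.snd.1 ⊆ I.1.snd.1 := by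
        rcases I.2 with ⟨-, h2⟩ | ⟨h1, h2⟩
        · have h3 := polyDim_mono I.1.snd.2.subset
          rcases (show polyDim I.1.snd.1 = polyDim P - 1 ∨ polyDim P ≤ polyDim I.1.snd.1 by
            omega) with h4 | h4
          · exact hF _ ⟨I.1.snd.2, h4⟩ subset_rfl
          · rw [eq_of_polyDim_le I.1.snd.2 subset_rfl I.1.snd.2.subset h4]
            exact J.1.snd.2.subset
        · rcases J.2 with ⟨h3, h4⟩ | ⟨h3, h4⟩
          · have := polyDim_mono hy
            omega
          · rw [← h3, ← h1]
            exact (eq_of_polyDim_le I.1.fst.2 J.1.fst.2.subset hy (by omega)).superset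
      exact ⟨hy, hz⟩
    · rintro ⟨h1, h2⟩
      exact convexHull_mono (Set.union_subset_union h1
        (Set.image_mono fun F hF => ⟨hF.1, Set.Subset.trans h2 hF.2⟩))
  have hQH : ∀ I, ¬ Q ⊆ H I := by
    intro I h
    apply hneP I
    conv_lhs => rw [← hP]
    refine convexHull_min (fun v hv => hold I v hv (h (subset_convexHull ℝ _ (Or.inl hv)))) ?_
    have := convex_convexHull ℝ (P.extremePoints ℝ)
    rw [hP] at this
    exact I.1.fst.2.convex this
  let φ : EConstruction P → Face Q := fun x =>
    WithTop.recTopCoe (C := fun _ => Face Q) ⟨Q, IsExposed.refl Q⟩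
      (fun I => ⟨H (OrderDual.ofDual I), hHexp _⟩) x
  have hφle : ∀ a b, φ a ≤ φ b ↔ a ≤ b := by
    intro a b
    induction a using WithTop.recTopCoe with
    | top =>
      induction b using WithTop.recTopCoe with
      | top => exact iff_of_true le_rfl le_rfl
      | coe J => exact iff_of_false (hQH _) (by simp)
    | coe I =>
      induction b using WithTop.recTopCoe with
      | top => exact iff_of_true (hHexp _).subset le_top
      | coe J =>
        rw [WithTop.coe_le_coe]
        exact hle (OrderDual.ofDual I) (OrderDual.ofDual J)
  have hφsurj : Function.Surjective φ := by
    rintro ⟨G, hG⟩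
    have mk : ∀ I, H I = G → ∃ a, φ a = ⟨G, hG⟩ := fun I hI =>
      ⟨WithTop.some (OrderDual.toDual I), Subtype.ext hI⟩
    rcases G.eq_empty_or_nonempty with rfl | hGne
    · have hI : IsEInterval P ⟨(⟨∅, isExposed_empty⟩, ⟨P, IsExposed.refl P⟩),
          Set.empty_subset P⟩ := by
        refine Or.inl ⟨?_, ?_⟩
        · change polyDim (∅ : Set E) < polyDim P - 2
          rw [polyDim_empty]
          omega
        · change polyDim P - 2 < polyDim P
          omega
      exact mk ⟨_, hI⟩ (hHe _ rfl rfl)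
    · obtain ⟨l, hl⟩ := hG hGne
      obtain ⟨x, hx, T, hT, hT'⟩ := hf.fan l
      -- The only use of the fan condition: an arbitrary nonempty face is an intersection of
      -- candidate facets.
      have hGT : G = {y ∈ Q | ∀ R ∈ T, f R y = 1} := by
        rw [hl]
        ext y
        refine and_congr_right fun hy => ?_
        rw [← (hT' y hy).2]
        exact ⟨fun h => le_antisymm (hT' y hy).1 (h x hx),
          fun h z hz => by rw [h]; exact (hT' z hz).1⟩
      rcases T.eq_empty_or_nonempty with rfl | ⟨R, hR⟩
      · refine ⟨⊤, Subtype.ext ?_⟩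
        change Q = G
        rw [hGT]
        simp
      have hTfin : T.Finite := hfaces.subset fun R hR => (hT hR).1
      have hG2 := hGT
      rw [hQ, hf.setOf_eq_convexHull (fun R hR => hT hR)] at hG2
      by_cases hone : ∀ R' ∈ T, R' = R
      · have hI : IsEInterval P ⟨(⟨R, (hT hR).1⟩, ⟨R, (hT hR).1⟩), le_rfl⟩ :=
          Or.inr ⟨rfl, (hT hR).2⟩
        refine mk ⟨_, hI⟩ ?_
        obtain rfl : T = {R} := Set.eq_singleton_iff_unique_mem.2 ⟨hR, hone⟩
        rw [hG2]
        simp only [Set.mem_singleton_iff, forall_eq]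
        have e := congrArg (fun A => convexHull ℝ (A ∪ p '' {F | IsFacet P F ∧ R ⊆ F}))
          (hexp (hT hR).1)
        simp only [convexHull_convexHull_union_left] at e
        exact e
      push Not at hone
      obtain ⟨R', hR', hRR'⟩ := hone
      have hTe : ∀ B ∈ hTfin.toFinset, IsExposed ℝ P B := fun B hB =>
        (hT (hTfin.mem_toFinset.1 hB)).1
      have hy : IsExposed ℝ P (⋂₀ T) := by
        have := IsExposed.sInter ⟨R, hTfin.mem_toFinset.2 hR⟩ hTe
        rwa [hTfin.coe_toFinset] at this
      -- With at least two ridges in `T`, the interval runs from their meet to their join, the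
      -- intersection of the facets above all of them. `P` is adjoined so that the join makes sense
      -- when there is no such facet.
      have hUfin : {F | F = P ∨ (IsFacet P F ∧ ∀ R ∈ T, R ⊆ F)}.Finite := by
        refine hfaces.subset ?_
        rintro F (rfl | hF)
        · exact IsExposed.refl F
        · exact hF.1.1
      have hz : IsExposed ℝ P (⋂₀ {F | F = P ∨ (IsFacet P F ∧ ∀ R ∈ T, R ⊆ F)}) := by
        have := IsExposed.sInter (A := P) (𝕜 := ℝ) (F := hUfin.toFinset)
          ⟨P, hUfin.mem_toFinset.2 (Or.inl rfl)⟩ (by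
            intro B hB
            rcases hUfin.mem_toFinset.1 hB with rfl | hF
            · exact IsExposed.refl B
            · exact hF.1.1)
        rwa [hUfin.coe_toFinset] at this
      set z := ⋂₀ {F | F = P ∨ (IsFacet P F ∧ ∀ R ∈ T, R ⊆ F)} with hzdef
      have hTz : ∀ B ∈ T, B ⊆ z := by
        intro B hB
        refine Set.subset_sInter ?_
        rintro F (rfl | hF)
        · exact (hT hB).1.subset
        · exact hF.2 B hB
      have hyz : ⋂₀ T ⊆ z := (Set.sInter_subset_of_mem hR).trans (hTz R hR)
      have hRd := (hT hR).2
      have hRd' := (hT hR').2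
      -- If the meet or the join had the dimension of a ridge, it would coincide with both `R` and
      -- `R'`, which are distinct.
      have hI : IsEInterval P ⟨(⟨⋂₀ T, hy⟩, ⟨z, hz⟩), hyz⟩ := by
        refine Or.inl ⟨?_, ?_⟩
        · change polyDim (⋂₀ T) < polyDim P - 2
          by_contra hd
          have e1 := eq_of_polyDim_le hy (hT hR).1.subset (Set.sInter_subset_of_mem hR) (by omega)
          have e2 := eq_of_polyDim_le hy (hT hR').1.subset (Set.sInter_subset_of_mem hR')
            (by omega)
          exact hRR' (e2.symm.trans e1)
        · change polyDim P - 2 < polyDim z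
          by_contra hd
          have e1 := eq_of_polyDim_le (hT hR).1 hz.subset (hTz R hR) (by omega)
          have e2 := eq_of_polyDim_le (hT hR').1 hz.subset (hTz R' hR') (by omega)
          exact hRR' (e2.trans e1.symm)
      refine mk ⟨_, hI⟩ ?_
      rw [hG2]
      have e3 : {F | IsFacet P F ∧ z ⊆ F} = {F | IsFacet P F ∧ ∀ R ∈ T, R ⊆ F} := by
        ext F
        refine and_congr_right fun hF => ⟨fun h R hR => (hTz R hR).trans h, fun h => ?_⟩
        exact Set.sInter_subset_of_mem (Or.inr ⟨hF, h⟩)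
      change convexHull ℝ (⋂₀ T ∪ p '' {F | IsFacet P F ∧ z ⊆ F}) = _
      rw [e3]
      conv_lhs => rw [hexp hy]
      rw [convexHull_convexHull_union_left]
      rfl
  exact ⟨RelIso.ofSurjective (OrderEmbedding.ofMapLEIff φ hφle) hφsurj, fun I => rfl⟩

end IsFacetSystem

end Realisation

end EPolytope

namespace EPolytope

/-! ### Equally spaced directions in the plane -/

section Polygon

open Real

/-- The unit vector in direction `t`. -/
noncomputable def dir (t : ℝ) : Plane := !₂[cos t, sin t]

/-- The linear functional with gradient `dir t`. -/
noncomputable def dirL (t : ℝ) : Plane →L[ℝ] ℝ := innerSL ℝ (dir t)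

/-- The angle that arises from `α` by `i` steps of a `k`-th of a full turn. -/
noncomputable def ang (k : ℕ) (α : ℝ) (i : ℤ) : ℝ := α + 2 * π * i / k

theorem dirL_dir (s t : ℝ) : dirL s (dir t) = cos (t - s) := by
  simp [dirL, dir, cos_sub, PiLp.inner_apply, Fin.sum_univ_two]

theorem norm_dir (t : ℝ) : ‖dir t‖ = 1 := by
  rw [EuclideanSpace.norm_eq]
  simp [dir, Fin.sum_univ_two]

variable {k : ℕ}

theorem ang_add_one (α : ℝ) (i : ℤ) : ang k α (i + 1) = ang k α i + 2 * π / k := by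
  simp only [ang]; push_cast; ring

theorem ang_sub (α β : ℝ) (i j : ℤ) :
    ang k α i - ang k β j = 2 * π * ((i - j : ℤ) : ℝ) / k + (α - β) := by
  simp only [ang]; push_cast; ring

theorem ang_of_dvd (hk : 3 ≤ k) (α : ℝ) {i j : ℤ} (h : (k : ℤ) ∣ i - j) :
    ∃ q : ℤ, ang k α i = ang k α j + q * (2 * π) := by
  obtain ⟨q, hq⟩ := h
  refine ⟨q, ?_⟩
  have hk' : (k : ℝ) ≠ 0 := by positivity
  have : (i : ℝ) = j + k * q := by
    have : i = j + k * q := by linarith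
    exact_mod_cast this
  simp only [ang, this]
  field_simp
  ring

theorem dir_ang_of_dvd (hk : 3 ≤ k) (α : ℝ) {i j : ℤ} (h : (k : ℤ) ∣ i - j) :
    dir (ang k α i) = dir (ang k α j) := by
  obtain ⟨q, hq⟩ := ang_of_dvd hk α h
  simp only [dir, hq, cos_add_int_mul_two_pi, sin_add_int_mul_two_pi]

theorem dirL_ang_of_dvd (hk : 3 ≤ k) (α : ℝ) {i j : ℤ} (h : (k : ℤ) ∣ i - j) :
    dirL (ang k α i) = dirL (ang k α j) := by
  rw [dirL, dir_ang_of_dvd hk α h, dirL]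

/-- Vertices and edges are indexed by all integers to keep cyclic neighbors simple; this brings
cosine estimates back to one period. -/
theorem exists_reduced (hk : 3 ≤ k) (d : ℤ) : ∃ r : ℤ, 0 ≤ r ∧ r < k ∧ (k : ℤ) ∣ d - r ∧
    ∀ φ, cos (2 * π * d / k + φ) = cos (2 * π * r / k + φ) := by
  have hk0 : (0 : ℤ) < k := by omega
  have hd : (k : ℤ) ∣ d - d % k := Int.dvd_self_sub_emod
  refine ⟨d % k, Int.emod_nonneg _ hk0.ne', Int.emod_lt_of_pos _ hk0, hd, fun φ => ?_⟩
  obtain ⟨q, hq⟩ := ang_of_dvd hk φ hd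
  simp only [ang] at hq
  rw [add_comm, hq, add_comm φ, cos_add_int_mul_two_pi]

theorem dvd_iff_of_reduced {d r s : ℤ} (h0 : 0 ≤ r) (h1 : r < k) (hd : (k : ℤ) ∣ d - r)
    (hs0 : 0 ≤ s) (hs1 : s < k) : (k : ℤ) ∣ d - s ↔ r = s := by
  constructor
  · intro h
    have h2 : (k : ℤ) ∣ r - s := by
      have := dvd_sub h hd
      rwa [show d - s - (d - r) = r - s by ring] at this
    have := Int.eq_zero_of_abs_lt_dvd h2 (by rw [abs_lt]; omega)
    omega
  · rintro rfl; exact hd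

/-- The comparisons `cos_rotate_le`, `cos_half_step_le` and `cos_step_le` all reduce to the signs of
the two sines in this product. -/
theorem cos_sub_cos_shift (x φ : ℝ) : cos φ - cos (2 * x + φ) = 2 * (sin x * sin (x + φ)) := by
  have h1 := cos_sub (x + φ) x
  have h2 := cos_add (x + φ) x
  rw [show x + φ - x = φ by ring] at h1
  rw [show x + φ + x = 2 * x + φ by ring] at h2
  rw [h1, h2]; ring

theorem pi_div_pos (hk : 3 ≤ k) : 0 < π / k := by positivity

theorem pi_div_le (hk : 3 ≤ k) : π / k ≤ π / 3 := by
  have : (3 : ℝ) ≤ k := by exact_mod_cast hk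
  gcongr

theorem cos_pi_div_pos (hk : 3 ≤ k) : 0 < cos (π / k) := by
  apply cos_pos_of_mem_Ioo
  have := pi_div_pos hk
  have := pi_div_le hk
  constructor <;> linarith [pi_pos]

theorem sin_pi_div_pos (hk : 3 ≤ k) : 0 < sin (π / k) := by
  have := pi_div_pos hk
  have := pi_div_le hk
  exact sin_pos_of_pos_of_lt_pi (by linarith) (by linarith [pi_pos])

theorem mul_div_bounds (hk : 3 ≤ k) {r : ℤ} (h0 : 0 < r) (h1 : r < k) :
    π / k ≤ π * r / k ∧ π * r / k ≤ π - π / k := by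
  have hk' : (0 : ℝ) < k := by positivity
  have h0' : (1 : ℝ) ≤ r := by exact_mod_cast h0
  have h1' : (r : ℝ) ≤ k - 1 := by
    have : r ≤ (k : ℤ) - 1 := by omega
    exact_mod_cast this
  constructor
  · rw [div_le_div_iff_of_pos_right hk']
    nlinarith [pi_pos]
  · rw [show π - π / k = π * (k - 1) / k by field_simp, div_le_div_iff_of_pos_right hk']
    nlinarith [pi_pos]

/-- Rotating a direction close to `0` by a multiple of a `k`-th of a turn decreases the cosine. -/
theorem cos_rotate_le (hk : 3 ≤ k) {φ : ℝ} (hφ : |φ| < π / k) (d : ℤ) :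
    cos (2 * π * d / k + φ) ≤ cos φ ∧ (cos (2 * π * d / k + φ) = cos φ ↔ (k : ℤ) ∣ d) := by
  obtain ⟨r, h0, h1, hd, hc⟩ := exists_reduced hk d
  have hdv := dvd_iff_of_reduced h0 h1 hd le_rfl (by omega)
  rw [sub_zero] at hdv
  rw [hc, hdv]
  rcases h0.eq_or_lt with rfl | hpos
  · simp
  · have key := cos_sub_cos_shift (π * r / k) φ
    rw [show 2 * (π * r / k) = 2 * π * r / k by ring] at key
    obtain ⟨b1, b2⟩ := mul_div_bounds hk hpos h1
    rw [abs_lt] at hφ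
    have hp := pi_div_pos hk
    have s1 : 0 < sin (π * r / k) := sin_pos_of_pos_of_lt_pi (by linarith) (by linarith)
    have s2 : 0 < sin (π * r / k + φ) := sin_pos_of_pos_of_lt_pi (by linarith) (by linarith)
    have := mul_pos s1 s2
    refine ⟨by linarith, ?_⟩
    constructor <;> intro h <;> [linarith; omega]

/-- The boundary case φ = -π/k of the previous estimate: the second sine now also vanishes for
remainder 1. Geometrically, an edge normal is maximal at exactly two vertices. -/
theorem cos_half_step_le (hk : 3 ≤ k) (d : ℤ) :
    cos (2 * π * d / k - π / k) ≤ cos (π / k) ∧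
      (cos (2 * π * d / k - π / k) = cos (π / k) ↔ (k : ℤ) ∣ d ∨ (k : ℤ) ∣ d - 1) := by
  obtain ⟨r, h0, h1, hd, hc⟩ := exists_reduced hk d
  have hdv := dvd_iff_of_reduced h0 h1 hd le_rfl (by omega)
  have hdv' := dvd_iff_of_reduced h0 h1 hd zero_le_one (by omega)
  rw [sub_zero] at hdv
  rw [sub_eq_add_neg, hc, hdv, hdv']
  rcases h0.eq_or_lt with rfl | hpos
  · simp
  · have key := cos_sub_cos_shift (π * r / k) (-(π / k))
    rw [show 2 * (π * r / k) = 2 * π * r / k by ring, cos_neg] at key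
    obtain ⟨b1, b2⟩ := mul_div_bounds hk hpos h1
    have hp := pi_div_pos hk
    have s1 : 0 < sin (π * r / k) := sin_pos_of_pos_of_lt_pi (by linarith) (by linarith)
    rcases (show (1 : ℤ) ≤ r from hpos).eq_or_lt with rfl | hr
    · have : 2 * π * ((1 : ℤ) : ℝ) / k + -(π / k) = π / k := by push_cast; ring
      rw [this]; simp
    · have b3 : π / k < π * r / k := by
        have hk' : (0 : ℝ) < k := by positivity
        have : (1 : ℝ) < r := by exact_mod_cast hr
        rw [div_lt_div_iff_of_pos_right hk']
        nlinarith [pi_pos]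
      have s2 : 0 < sin (π * r / k + -(π / k)) :=
        sin_pos_of_pos_of_lt_pi (by linarith) (by linarith)
      have := mul_pos s1 s2
      refine ⟨by linarith, ?_⟩
      constructor <;> intro h <;> [linarith; omega]

theorem cos_step_le (hk : 3 ≤ k) {d : ℤ} (hd0 : ¬ (k : ℤ) ∣ d) :
    cos (2 * π * d / k) ≤ cos (2 * π / k) := by
  obtain ⟨r, h0, h1, hd, hc⟩ := exists_reduced hk d
  have hdv := dvd_iff_of_reduced h0 h1 hd le_rfl (by omega)
  rw [sub_zero] at hdv
  have hc0 := hc 0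
  rw [add_zero, add_zero] at hc0
  rw [hc0]
  have hpos : 0 < r := lt_of_le_of_ne h0 fun h => hd0 (hdv.2 h.symm)
  have key := cos_sub_cos_shift (π * r / k - π / k) (2 * π / k)
  rw [show 2 * (π * r / k - π / k) + 2 * π / k = 2 * π * r / k by ring] at key
  obtain ⟨b1, b2⟩ := mul_div_bounds hk hpos h1
  have hp := pi_div_pos hk
  have s1 : 0 ≤ sin (π * r / k - π / k) :=
    sin_nonneg_of_nonneg_of_le_pi (by linarith) (by linarith)
  have s2 : 0 ≤ sin (π * r / k - π / k + 2 * π / k) := by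
    rw [show π * r / k - π / k + 2 * π / k = π * r / k + π / k by ring]
    exact sin_nonneg_of_nonneg_of_le_pi (by linarith) (by linarith)
  nlinarith [mul_nonneg s1 s2]

/-- Multiplied by 2 sin (π/k), each coordinate becomes a difference of values half a step to either
side, so the sum telescopes over a full period. -/
theorem sum_dir_ang (hk : 3 ≤ k) (α : ℝ) : ∑ i : Fin k, dir (ang k α (i : ℕ)) = 0 := by
  have hs : 0 < sin (π / k) := sin_pi_div_pos hk
  have tel : ∀ f : ℝ → ℝ, (∀ x, f (x + 2 * π) = f x) →
      ∑ i ∈ Finset.range k, (f (α - π / k + 2 * π * ((i + 1 : ℕ) : ℝ) / k) -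
        f (α - π / k + 2 * π * ((i : ℕ) : ℝ) / k)) = 0 := by
    intro f hf
    rw [Finset.sum_range_sub (fun i : ℕ => f (α - π / k + 2 * π * (i : ℝ) / k))]
    have hk' : (k : ℝ) ≠ 0 := by positivity
    rw [show 2 * π * (k : ℝ) / k = 2 * π by field_simp, hf]
    simp
  rw [Fin.sum_univ_eq_sum_range (fun i => dir (ang k α (i : ℕ))) k]
  have hx : ∀ i : ℕ, α - π / k + 2 * π * ((i + 1 : ℕ) : ℝ) / k = ang k α i + π / k := by
    intro i; simp only [ang]; push_cast; ring
  have hy : ∀ i : ℕ, α - π / k + 2 * π * ((i : ℕ) : ℝ) / k = ang k α i - π / k := by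
    intro i; simp only [ang]; push_cast; ring
  ext j
  fin_cases j
  · have := tel sin sin_add_two_pi
    have h2 : ∀ i : ℕ, sin (ang k α i + π / k) - sin (ang k α i - π / k) =
        2 * sin (π / k) * cos (ang k α i) := by
      intro i; rw [sin_add, sin_sub]; ring
    simp only [hx, hy, h2, ← Finset.mul_sum] at this
    simpa [dir, hs.ne'] using this
  · have := tel cos cos_add_two_pi
    have h2 : ∀ i : ℕ, cos (ang k α i + π / k) - cos (ang k α i - π / k) =
        -(2 * sin (π / k)) * sin (ang k α i) := by
      intro i; rw [cos_add, cos_sub]; ring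
    simp only [hx, hy, h2, ← Finset.mul_sum] at this
    simpa [dir, hs.ne'] using this

/-- A map that is injective modulo `k` permutes the residues. Needed because it is not known in
which order the outer edges pass through the inner vertices. -/
theorem sum_dir_ang_comp (hk : 3 ≤ k) (α : ℝ) (σ : Fin k → ℤ)
    (hσ : ∀ i j, (k : ℤ) ∣ σ i - σ j → i = j) : ∑ i, dir (ang k α (σ i)) = 0 := by
  have hk0 : (0 : ℤ) < k := by omega
  let τ : Fin k → Fin k := fun i => ⟨(σ i % k).toNat, by
    have := Int.emod_lt_of_pos (σ i) hk0
    have := Int.emod_nonneg (σ i) hk0.ne'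
    omega⟩
  have hτ : ∀ i, (k : ℤ) ∣ σ i - ((τ i : ℕ) : ℤ) := by
    intro i
    have := Int.emod_nonneg (σ i) hk0.ne'
    simp only [τ, Int.toNat_of_nonneg this]
    exact Int.dvd_self_sub_emod
  have hinj : Function.Injective τ := by
    intro i j h
    apply hσ
    have := dvd_sub (hτ i) (hτ j)
    rw [h] at this
    rwa [sub_sub_sub_cancel_right] at this
  have hbij := Finite.injective_iff_bijective.1 hinj
  rw [← sum_dir_ang hk α, ← hbij.sum_comp (fun i : Fin k => dir (ang k α ((i : ℕ) : ℤ)))]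
  exact Finset.sum_congr rfl fun i _ => dir_ang_of_dvd hk α (hτ i)

theorem exists_polar (x : Plane) : ∃ r t : ℝ, 0 ≤ r ∧ x = r • dir t := by
  refine ⟨‖(⟨x 0, x 1⟩ : ℂ)‖, Complex.arg ⟨x 0, x 1⟩, norm_nonneg _, ?_⟩
  ext j
  fin_cases j
  · simp [dir, Complex.norm_mul_cos_arg]
  · simp [dir, Complex.norm_mul_sin_arg]

theorem sin_smul_dir_add (τ β δ : ℝ) :
    sin τ • dir (β + δ) = sin (τ - δ) • dir β + sin δ • dir (β + τ) := by
  ext j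
  fin_cases j
  · simp [dir, sin_sub, cos_add]
    ring
  · simp [dir, sin_sub, sin_add]
    ring

/-- The sectors between consecutive directions cover the plane. -/
theorem exists_sector (hk : 3 ≤ k) (α : ℝ) (x : Plane) : ∃ (i : ℤ) (a b : ℝ), 0 ≤ a ∧ 0 ≤ b ∧
    x = a • dir (ang k α i) + b • dir (ang k α (i + 1)) := by
  obtain ⟨r, t, hr, rfl⟩ := exists_polar x
  have hk' : (0 : ℝ) < k := by positivity
  have hp := pi_div_pos hk
  have hp' := pi_div_le hk
  set i := ⌊(t - α) / (2 * π / k)⌋ with hi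
  have hτ : 0 < 2 * π / k := by positivity
  have hτπ : 2 * π / k < π := by
    rw [show 2 * π / k = 2 * (π / k) by ring]; linarith [pi_pos]
  have h1 : ang k α i ≤ t := by
    have := (le_div_iff₀ hτ).1 (Int.floor_le ((t - α) / (2 * π / k)))
    simp only [ang, hi]
    linarith [this, show (⌊(t - α) / (2 * π / k)⌋ : ℝ) * (2 * π / k) =
      2 * π * ⌊(t - α) / (2 * π / k)⌋ / k by ring]
  have h2 : t < ang k α i + 2 * π / k := by
    have := (div_lt_iff₀ hτ).1 (Int.lt_floor_add_one ((t - α) / (2 * π / k)))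
    simp only [ang, hi]
    linarith [this, show ((⌊(t - α) / (2 * π / k)⌋ : ℝ) + 1) * (2 * π / k) =
      2 * π * ⌊(t - α) / (2 * π / k)⌋ / k + 2 * π / k by ring]
  set τ := 2 * π / k
  set β := ang k α i with hβ
  have hs : 0 < sin τ := sin_pos_of_pos_of_lt_pi hτ hτπ
  refine ⟨i, r * (sin (τ - (t - β)) / sin τ), r * (sin (t - β) / sin τ), ?_, ?_, ?_⟩
  · have : 0 ≤ sin (τ - (t - β)) := sin_nonneg_of_nonneg_of_le_pi (by linarith) (by linarith)
    positivity
  · have : 0 ≤ sin (t - β) := sin_nonneg_of_nonneg_of_le_pi (by linarith) (by linarith)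
    positivity
  · rw [ang_add_one, ← hβ]
    have key := sin_smul_dir_add τ β (t - β)
    rw [add_sub_cancel] at key
    rw [← one_smul ℝ (dir t), ← inv_mul_cancel₀ hs.ne', mul_smul, key]
    module

theorem exists_sector_dual (hk : 3 ≤ k) (α : ℝ) (l : Plane →L[ℝ] ℝ) :
    ∃ (i : ℤ) (a b : ℝ), 0 ≤ a ∧ 0 ≤ b ∧
      l = a • dirL (ang k α i) + b • dirL (ang k α (i + 1)) := by
  obtain ⟨x, rfl⟩ := (InnerProductSpace.toDual ℝ Plane).surjective l
  obtain ⟨i, a, b, ha, hb, h⟩ := exists_sector hk α x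
  refine ⟨i, a, b, ha, hb, ?_⟩
  ext y
  rw [h]
  simp [dirL]

end Polygon

end EPolytope

namespace EPolytope

/-! ### The faces of a regular polygon -/

section RegularPolygon

open Real

/-- The vertices of the regular `k`-gon with center `c`, circumradius `ρ`, and a vertex in
direction `θ`, in cyclic order. -/
noncomputable def vert (k : ℕ) (c : Plane) (ρ θ : ℝ) (i : ℤ) : Plane := c + ρ • dir (ang k θ i)

/-- The regular `k`-gon with center `c`, circumradius `ρ`, and a vertex in direction `θ`. -/
noncomputable def poly (k : ℕ) (c : Plane) (ρ θ : ℝ) : Set Plane :=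
  convexHull ℝ (Set.range (vert k c ρ θ))

/-- The outer normal of the edge that joins the vertices `i` and `i + 1` of a regular `k`-gon. -/
noncomputable def nrm (k : ℕ) (θ : ℝ) (i : ℤ) : Plane →L[ℝ] ℝ := dirL (ang k (θ + π / k) i)

/-- The edge that joins the vertices `i` and `i + 1` of a regular `k`-gon. -/
noncomputable def edge (k : ℕ) (c : Plane) (ρ θ : ℝ) (i : ℤ) : Set Plane :=
  {x ∈ poly k c ρ θ | nrm k θ i (x - c) = ρ * cos (π / k)}

variable {k : ℕ} {c : Plane} {ρ θ : ℝ}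

theorem vert_of_dvd (hk : 3 ≤ k) {i j : ℤ} (h : (k : ℤ) ∣ i - j) :
    vert k c ρ θ i = vert k c ρ θ j := by
  rw [vert, vert, dir_ang_of_dvd hk θ h]

theorem exists_fin_dvd (hk : 3 ≤ k) (i : ℤ) : ∃ j : Fin k, (k : ℤ) ∣ i - (j : ℕ) := by
  have hk0 : (0 : ℤ) < k := by omega
  have h1 := Int.emod_lt_of_pos i hk0
  have h2 := Int.emod_nonneg i hk0.ne'
  refine ⟨⟨(i % k).toNat, by omega⟩, ?_⟩
  simp only [Int.toNat_of_nonneg h2]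
  exact Int.dvd_self_sub_emod

theorem range_vert (hk : 3 ≤ k) :
    Set.range (vert k c ρ θ) = Set.range fun j : Fin k => vert k c ρ θ (j : ℕ) := by
  apply Set.Subset.antisymm
  · rintro _ ⟨i, rfl⟩
    obtain ⟨j, hj⟩ := exists_fin_dvd hk i
    exact ⟨j, (vert_of_dvd hk hj).symm⟩
  · rintro _ ⟨j, rfl⟩
    exact ⟨_, rfl⟩

theorem finite_range_vert (hk : 3 ≤ k) : (Set.range (vert k c ρ θ)).Finite := by
  rw [range_vert hk]; exact Set.finite_range _

theorem isRegularPolygon_iff (hk : 3 ≤ k) (P : Set Plane) :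
    IsRegularPolygon k P ↔ ∃ (c : Plane) (ρ θ : ℝ), 0 < ρ ∧ P = poly k c ρ θ := by
  unfold IsRegularPolygon
  have : ∀ c ρ θ, poly k c ρ θ = convexHull ℝ (Set.range fun j : Fin k =>
      c + ρ • (!₂[Real.cos (θ + 2 * Real.pi * (j : ℝ) / k),
        Real.sin (θ + 2 * Real.pi * (j : ℝ) / k)] : Plane)) := by
    intro c ρ θ
    rw [poly, range_vert hk]
    simp [vert, dir, ang]
  simp only [this]

theorem vert_mem_poly (i : ℤ) : vert k c ρ θ i ∈ poly k c ρ θ :=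
  subset_convexHull ℝ _ ⟨i, rfl⟩

theorem convex_poly : Convex ℝ (poly k c ρ θ) := convex_convexHull ℝ _

theorem isClosed_poly (hk : 3 ≤ k) : IsClosed (poly k c ρ θ) :=
  ((finite_range_vert hk).isCompact_convexHull ℝ).isClosed

theorem nrm_of_dvd (hk : 3 ≤ k) {i j : ℤ} (h : (k : ℤ) ∣ i - j) : nrm k θ i = nrm k θ j :=
  dirL_ang_of_dvd hk _ h

theorem edge_of_dvd (hk : 3 ≤ k) {i j : ℤ} (h : (k : ℤ) ∣ i - j) :
    edge k c ρ θ i = edge k c ρ θ j := by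
  rw [edge, edge, nrm_of_dvd hk h]

theorem dirL_vert (s : ℝ) (j : ℤ) : dirL s (vert k c ρ θ j - c) = ρ * cos (ang k θ j - s) := by
  rw [vert, add_sub_cancel_left, map_smul, dirL_dir, smul_eq_mul]

theorem nrm_vert (i j : ℤ) :
    nrm k θ i (vert k c ρ θ j - c) = ρ * cos (2 * π * ((j - i : ℤ) : ℝ) / k - π / k) := by
  rw [nrm, dirL_vert, ang_sub]
  congr 2; ring

theorem nrm_vert_le (hk : 3 ≤ k) (hρ : 0 < ρ) (i j : ℤ) :
    nrm k θ i (vert k c ρ θ j - c) ≤ ρ * cos (π / k) := by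
  rw [nrm_vert]
  exact mul_le_mul_of_nonneg_left (cos_half_step_le hk _).1 hρ.le

theorem nrm_vert_eq_iff (hk : 3 ≤ k) (hρ : 0 < ρ) (i j : ℤ) :
    nrm k θ i (vert k c ρ θ j - c) = ρ * cos (π / k) ↔
      (k : ℤ) ∣ j - i ∨ (k : ℤ) ∣ j - i - 1 := by
  rw [nrm_vert, ← (cos_half_step_le hk _).2]
  exact ⟨fun h => mul_left_cancel₀ hρ.ne' h, fun h => by rw [h]⟩

theorem nrm_le (hk : 3 ≤ k) (hρ : 0 < ρ) (i : ℤ) {x : Plane} (hx : x ∈ poly k c ρ θ) :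
    nrm k θ i (x - c) ≤ ρ * cos (π / k) := by
  have := le_of_mem_convexHull (nrm k θ i) (c := ρ * cos (π / k) + nrm k θ i c) ?_ hx
  · rw [map_sub]; linarith
  · rintro _ ⟨j, rfl⟩
    have := nrm_vert_le (c := c) (θ := θ) hk hρ i j
    rw [map_sub] at this; linarith

theorem vert_mem_edge_iff (hk : 3 ≤ k) (hρ : 0 < ρ) (i j : ℤ) :
    vert k c ρ θ j ∈ edge k c ρ θ i ↔ (k : ℤ) ∣ j - i ∨ (k : ℤ) ∣ j - i - 1 := by
  rw [← nrm_vert_eq_iff (c := c) (θ := θ) hk hρ]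
  exact ⟨fun h => h.2, fun h => ⟨vert_mem_poly j, h⟩⟩

theorem vert_mem_edge (hk : 3 ≤ k) (hρ : 0 < ρ) (i : ℤ) :
    vert k c ρ θ i ∈ edge k c ρ θ i := (vert_mem_edge_iff hk hρ i i).2 (by simp)

theorem vert_mem_edge' (hk : 3 ≤ k) (hρ : 0 < ρ) (i : ℤ) :
    vert k c ρ θ (i + 1) ∈ edge k c ρ θ i := (vert_mem_edge_iff hk hρ i _).2 (by simp)

theorem center_mem_poly (hk : 3 ≤ k) : c ∈ poly k c ρ θ := by
  have hk' : (0 : ℝ) < k := by positivity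
  have h := (convex_poly (k := k) (c := c) (ρ := ρ) (θ := θ)).sum_mem (t := Finset.univ)
    (w := fun _ : Fin k => (1 : ℝ) / k) (z := fun j => vert k c ρ θ (j : ℕ))
    (fun _ _ => by positivity) (by simp [hk'.ne']) (fun j _ => vert_mem_poly _)
  have e : ∑ i : Fin k, ((1 : ℝ) / k) • vert k c ρ θ (i : ℕ) = c := by
    simp only [vert]
    rw [← Finset.smul_sum, Finset.sum_add_distrib, ← Finset.smul_sum, sum_dir_ang hk]
    simp only [Finset.sum_const, Finset.card_univ, Fintype.card_fin, smul_zero, add_zero]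
    rw [← Nat.cast_smul_eq_nsmul ℝ, smul_smul, one_div, inv_mul_cancel₀ hk'.ne', one_smul]
  rwa [e] at h

/-- A regular polygon is the intersection of the half-planes of its edges. -/
theorem mem_poly_iff (hk : 3 ≤ k) (hρ : 0 < ρ) (x : Plane) :
    x ∈ poly k c ρ θ ↔ ∀ i, nrm k θ i (x - c) ≤ ρ * cos (π / k) := by
  refine ⟨fun hx i => nrm_le hk hρ i hx, fun h => ?_⟩
  obtain ⟨i, a, b, ha, hb, he⟩ := exists_sector hk θ (x - c)
  have hc := cos_pi_div_pos hk
  have h1 := h i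
  have e1 : nrm k θ i (dir (ang k θ i)) = cos (π / k) := by
    rw [nrm, dirL_dir, ang_sub, ← cos_neg]
    congr 1; simp
  have e2 : nrm k θ i (dir (ang k θ (i + 1))) = cos (π / k) := by
    rw [nrm, dirL_dir, ang_sub]
    congr 1; push_cast; ring
  rw [he, map_add, map_smul, map_smul, e1, e2, smul_eq_mul, smul_eq_mul, ← add_mul] at h1
  -- The normal of edge `i` takes the same value at both directions bounding the sector, so its
  -- inequality alone bounds `a + b`; the slack then becomes the weight of the center.
  have h2 : a + b ≤ ρ := le_of_mul_le_mul_right h1 hc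
  have h3 := (convex_poly (k := k) (c := c) (ρ := ρ) (θ := θ))
  have hx : x = (a / ρ) • vert k c ρ θ i + (b / ρ) • vert k c ρ θ (i + 1) +
      (1 - a / ρ - b / ρ) • c := by
    rw [show x = (x - c) + c by abel, he, vert, vert]
    match_scalars <;> field_simp
    ring
  have := h3.sum_mem (t := Finset.univ) (w := ![a / ρ, b / ρ, 1 - a / ρ - b / ρ])
    (z := ![vert k c ρ θ i, vert k c ρ θ (i + 1), c]) ?_ ?_ ?_
  · rw [hx]
    simpa [Fin.sum_univ_three] using this
  · intro j _
    fin_cases j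
    · simp; positivity
    · simp; positivity
    · have : a / ρ + b / ρ ≤ 1 := by rw [← add_div, div_le_one hρ]; exact h2
      simp; linarith
  · simp [Fin.sum_univ_three]
  · intro j _
    fin_cases j
    · exact vert_mem_poly _
    · exact vert_mem_poly _
    · exact center_mem_poly hk

/-- If no edge inequality were tight, finitely many open half-planes would intersect in a
neighborhood of the point inside the polygon. -/
theorem exists_of_mem_frontier (hk : 3 ≤ k) (hρ : 0 < ρ) {x : Plane}
    (hx : x ∈ frontier (poly k c ρ θ)) : ∃ i, x ∈ edge k c ρ θ i := by
  have hxP : x ∈ poly k c ρ θ := (isClosed_poly hk).frontier_subset hx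
  by_contra! hne
  have hlt : ∀ i, nrm k θ i (x - c) < ρ * cos (π / k) := fun i =>
    lt_of_le_of_ne (nrm_le hk hρ i hxP) fun h => hne i ⟨hxP, h⟩
  refine hx.2 (mem_interior.2 ⟨⋂ i : Fin k,
    {y | nrm k θ ((i : ℕ) : ℤ) (y - c) < ρ * cos (π / k)}, ?_, ?_, ?_⟩)
  · intro y hy
    rw [mem_poly_iff hk hρ]
    intro i
    obtain ⟨j, hj⟩ := exists_fin_dvd hk i
    rw [nrm_of_dvd hk hj]
    exact (Set.mem_iInter.1 hy j).le
  · exact isOpen_iInter_of_finite fun i => isOpen_lt (by fun_prop) continuous_const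
  · exact Set.mem_iInter.2 fun i => hlt _

theorem norm_sub_center_le (hρ : 0 < ρ) {x : Plane} (hx : x ∈ poly k c ρ θ) :
    ‖x - c‖ ≤ ρ := by
  have : poly k c ρ θ ⊆ Metric.closedBall c ρ := by
    refine convexHull_min ?_ (convex_closedBall c ρ)
    rintro _ ⟨i, rfl⟩
    simp [vert, dist_eq_norm, norm_smul, norm_dir, abs_of_pos hρ]
  simpa [dist_eq_norm] using this hx

theorem dirL_le_norm (s : ℝ) (x : Plane) : dirL s x ≤ ‖x‖ := by
  have := real_inner_le_norm (dir s) x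
  rwa [norm_dir, one_mul] at this

/-- The functional of an edge exposes that edge. -/
theorem toExposed_nrm (hk : 3 ≤ k) (hρ : 0 < ρ) (i : ℤ) :
    (nrm k θ i).toExposed (poly k c ρ θ) = edge k c ρ θ i := by
  ext x
  refine and_congr_right fun hx => ⟨fun h => ?_, fun h y hy => ?_⟩
  · refine le_antisymm (nrm_le hk hρ i hx) ?_
    have h1 := h _ (vert_mem_poly i)
    have h2 := (vert_mem_edge (c := c) (θ := θ) hk hρ i).2
    rw [map_sub] at h2 ⊢
    linarith
  · have h1 := nrm_le hk hρ i hy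
    rw [← h, map_sub, map_sub] at h1
    linarith

theorem isExposed_edge (hk : 3 ≤ k) (hρ : 0 < ρ) (i : ℤ) :
    IsExposed ℝ (poly k c ρ θ) (edge k c ρ θ i) := by
  rw [← toExposed_nrm hk hρ]
  exact ContinuousLinearMap.toExposed.isExposed

theorem not_dvd_of_lt (hk : 3 ≤ k) {d : ℤ} (h0 : d ≠ 0) (h1 : |d| < 3) : ¬ (k : ℤ) ∣ d := fun h =>
  h0 (Int.eq_zero_of_abs_lt_dvd h (by omega))

theorem edge_inter_edge (hk : 3 ≤ k) (hρ : 0 < ρ) (i : ℤ) :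
    edge k c ρ θ i ∩ edge k c ρ θ (i + 1) = {vert k c ρ θ (i + 1)} := by
  ext x
  constructor
  · rintro ⟨h1, h2⟩
    have := mem_convexHull_of_forall_eq (W := Set.range (vert k c ρ θ))
      (fun b : Bool => nrm k θ (cond b i (i + 1)))
      (fun b => ρ * cos (π / k) + nrm k θ (cond b i (i + 1)) c) ?_ h1.1 ?_
    · have hs : {w ∈ Set.range (vert k c ρ θ) | ∀ b : Bool, nrm k θ (cond b i (i + 1)) w =
          ρ * cos (π / k) + nrm k θ (cond b i (i + 1)) c} ⊆ {vert k c ρ θ (i + 1)} := by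
        rintro _ ⟨⟨j, rfl⟩, hj⟩
        have e1 : nrm k θ i (vert k c ρ θ j - c) = ρ * cos (π / k) := by
          rw [map_sub, sub_eq_iff_eq_add]; exact hj true
        have e2 : nrm k θ (i + 1) (vert k c ρ θ j - c) = ρ * cos (π / k) := by
          rw [map_sub, sub_eq_iff_eq_add]; exact hj false
        rw [nrm_vert_eq_iff hk hρ] at e1 e2
        refine vert_of_dvd hk ?_
        rcases e2 with e2 | e2
        · exact e2
        rcases e1 with e1 | e1
        · exfalso
          have := dvd_sub e1 e2
          rw [show j - i - (j - (i + 1) - 1) = 2 by ring] at this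
          exact not_dvd_of_lt hk (by norm_num) (by norm_num) this
        · rwa [show j - (i + 1) = j - i - 1 by ring]
      have := convexHull_mono hs this
      rwa [convexHull_singleton] at this
    · rintro b _ ⟨j, rfl⟩
      have := nrm_vert_le (c := c) (θ := θ) hk hρ (cond b i (i + 1)) j
      rw [map_sub] at this; linarith
    · rintro (_ | _)
      · have := h2.2
        rw [map_sub] at this; change nrm k θ (i + 1) x = _ + nrm k θ (i + 1) c; linarith
      · have := h1.2
        rw [map_sub] at this; change nrm k θ i x = _ + nrm k θ i c; linarith
  · rintro rfl
    exact ⟨vert_mem_edge' hk hρ i, vert_mem_edge hk hρ (i + 1)⟩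

theorem isExposed_vert (hk : 3 ≤ k) (hρ : 0 < ρ) (i : ℤ) :
    IsExposed ℝ (poly k c ρ θ) {vert k c ρ θ i} := by
  obtain ⟨j, rfl⟩ : ∃ j, i = j + 1 := ⟨i - 1, by ring⟩
  rw [← edge_inter_edge hk hρ]
  exact (isExposed_edge hk hρ _).inter (isExposed_edge hk hρ _)

theorem toExposed_smul {E : Type*} [AddCommGroup E] [Module ℝ E] [TopologicalSpace E]
    (l : E →L[ℝ] ℝ) {a : ℝ} (ha : 0 < a) (P : Set E) : (a • l).toExposed P = l.toExposed P := by
  ext x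
  simp [ContinuousLinearMap.toExposed, ha]

/-- Applied to the normals of two consecutive edges, this shows that functionals inside a cone of
the normal fan expose a vertex. -/
theorem toExposed_add {E : Type*} [AddCommGroup E] [Module ℝ E] [TopologicalSpace E]
    (l l' : E →L[ℝ] ℝ) {P : Set E} (h : (l.toExposed P ∩ l'.toExposed P).Nonempty) :
    (l + l').toExposed P = l.toExposed P ∩ l'.toExposed P := by
  obtain ⟨w, hw, hw'⟩ := h
  ext x
  constructor
  · rintro ⟨hx, h⟩
    have h1 := h w hw.1
    have h2 := hw.2 x hx
    have h3 := hw'.2 x hx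
    simp only [add_apply] at h1
    exact ⟨⟨hx, fun y hy => by linarith [hw.2 y hy]⟩, hx, fun y hy => by linarith [hw'.2 y hy]⟩
  · rintro ⟨h1, h2⟩
    exact ⟨h1.1, fun y hy => add_le_add (h1.2 y hy) (h2.2 y hy)⟩

/-- The nonempty proper faces of a regular polygon, by the functionals exposing them. -/
theorem toExposed_cases (hk : 3 ≤ k) (hρ : 0 < ρ) (l : Plane →L[ℝ] ℝ) :
    l = 0 ∨ (∃ i, l.toExposed (poly k c ρ θ) = {vert k c ρ θ i}) ∨
      ∃ (i : ℤ) (a : ℝ), 0 < a ∧ l = a • nrm k θ i := by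
  obtain ⟨i, a, b, ha, hb, h⟩ := exists_sector_dual hk (θ + π / k) l
  change l = a • nrm k θ i + b • nrm k θ (i + 1) at h
  rcases ha.eq_or_lt with rfl | ha'
  · rcases hb.eq_or_lt with rfl | hb'
    · left; simpa using h
    · right; right; exact ⟨i + 1, b, hb', by simpa using h⟩
  · rcases hb.eq_or_lt with rfl | hb'
    · right; right; exact ⟨i, a, ha', by simpa using h⟩
    · right; left
      refine ⟨i + 1, ?_⟩
      have h1 := toExposed_smul (nrm k θ i) ha' (poly k c ρ θ)
      have h2 := toExposed_smul (nrm k θ (i + 1)) hb' (poly k c ρ θ)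
      rw [toExposed_nrm hk hρ] at h1 h2
      rw [h, toExposed_add, h1, h2, edge_inter_edge hk hρ]
      rw [h1, h2, edge_inter_edge hk hρ]
      exact Set.singleton_nonempty _

theorem face_cases (hk : 3 ≤ k) (hρ : 0 < ρ) {F : Set Plane}
    (hF : IsExposed ℝ (poly k c ρ θ) F) : F = ∅ ∨ (∃ i, F = {vert k c ρ θ i}) ∨
      (∃ i, F = edge k c ρ θ i) ∨ F = poly k c ρ θ := by
  rcases F.eq_empty_or_nonempty with rfl | hne
  · exact Or.inl rfl
  right
  obtain ⟨l, hl⟩ := hF hne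
  change F = l.toExposed (poly k c ρ θ) at hl
  rcases toExposed_cases (c := c) (θ := θ) hk hρ l with rfl | ⟨i, hi⟩ | ⟨i, a, ha, rfl⟩
  · right; right
    rw [hl]
    ext x
    simp [ContinuousLinearMap.toExposed]
  · left
    exact ⟨i, hl.trans hi⟩
  · right; left
    refine ⟨i, ?_⟩
    rw [hl, toExposed_smul _ ha, toExposed_nrm hk hρ]

/-- A vertex is determined by the two edges that contain it; `k ≥ 3` excludes the coincidence of
indices differing by 2. -/
theorem vert_eq_iff (hk : 3 ≤ k) (hρ : 0 < ρ) {i j : ℤ} :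
    vert k c ρ θ i = vert k c ρ θ j ↔ (k : ℤ) ∣ i - j := by
  refine ⟨fun h => ?_, vert_of_dvd hk⟩
  have h1 := vert_mem_edge (c := c) (θ := θ) hk hρ i
  have h2 := vert_mem_edge' (c := c) (θ := θ) hk hρ (i - 1)
  rw [sub_add_cancel] at h2
  rw [h, vert_mem_edge_iff hk hρ] at h1 h2
  rcases h1 with h1 | h1
  · rw [dvd_sub_comm]; exact h1
  · rcases h2 with h2 | h2
    · exfalso
      have := dvd_sub h2 h1
      rw [show j - (i - 1) - (j - i - 1) = 2 by ring] at this
      exact not_dvd_of_lt hk (by norm_num) (by norm_num) this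
    · rw [dvd_sub_comm]
      rwa [show j - (i - 1) - 1 = j - i by ring] at h2

theorem vert_ssubset_edge (hk : 3 ≤ k) (hρ : 0 < ρ) (i : ℤ) :
    {vert k c ρ θ i} ⊂ edge k c ρ θ i := by
  refine ⟨by simpa using vert_mem_edge hk hρ i, fun h => ?_⟩
  have := h (vert_mem_edge' hk hρ i)
  rw [Set.mem_singleton_iff, vert_eq_iff hk hρ] at this
  exact not_dvd_of_lt hk (by simp) (by norm_num [abs_lt]) this

theorem edge_ssubset_poly (hk : 3 ≤ k) (hρ : 0 < ρ) (i : ℤ) :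
    edge k c ρ θ i ⊂ poly k c ρ θ := by
  refine ⟨Set.sep_subset _ _, fun h => ?_⟩
  have := (h (center_mem_poly hk)).2
  rw [sub_self, map_zero] at this
  have := mul_pos hρ (cos_pi_div_pos hk)
  linarith

theorem polyDim_plane_le (S : Set Plane) : polyDim S ≤ 2 := by
  unfold polyDim
  split_ifs
  · have := Submodule.finrank_le (vectorSpan ℝ S)
    rw [finrank_euclideanSpace, Fintype.card_fin] at this
    exact_mod_cast this
  · norm_num

/-- The dimension increases strictly along vertex, edge, polygon, and there is room only for 0, 1,
2. -/
theorem polyDim_faces (hk : 3 ≤ k) (hρ : 0 < ρ) (i : ℤ) : polyDim {vert k c ρ θ i} = 0 ∧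
    polyDim (edge k c ρ θ i) = 1 ∧ polyDim (poly k c ρ θ) = 2 := by
  have h0 : polyDim ({vert k c ρ θ i} : Set Plane) = 0 := by
    rw [polyDim_of_nonempty (Set.singleton_nonempty _)]
    simp
  have h1 := polyDim_lt_of_isExposed (isExposed_vert hk hρ i) (Set.sep_subset _ _)
    (vert_ssubset_edge (c := c) (θ := θ) hk hρ i)
  have h2 := polyDim_lt_of_isExposed (isExposed_edge hk hρ i) subset_rfl
    (edge_ssubset_poly (c := c) (θ := θ) hk hρ i)
  have h3 := polyDim_plane_le (poly k c ρ θ)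
  change polyDim (edge k c ρ θ i) < _ at h2
  change _ < polyDim (edge k c ρ θ i) at h1
  omega

theorem polyDim_vert (i : ℤ) : polyDim {vert k c ρ θ i} = 0 := by
  rw [polyDim_of_nonempty (Set.singleton_nonempty _)]
  simp

theorem polyDim_edge (hk : 3 ≤ k) (hρ : 0 < ρ) (i : ℤ) : polyDim (edge k c ρ θ i) = 1 :=
  (polyDim_faces hk hρ i).2.1

theorem polyDim_poly (hk : 3 ≤ k) (hρ : 0 < ρ) : polyDim (poly k c ρ θ) = 2 :=
  (polyDim_faces hk hρ 0).2.2

theorem isFacet_poly_iff (hk : 3 ≤ k) (hρ : 0 < ρ) {F : Set Plane} :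
    IsFacet (poly k c ρ θ) F ↔ ∃ i, F = edge k c ρ θ i := by
  constructor
  · rintro ⟨hF, hd⟩
    rw [polyDim_poly hk hρ] at hd
    rcases face_cases hk hρ hF with rfl | ⟨i, rfl⟩ | h | rfl
    · simp at hd
    · rw [polyDim_vert] at hd; omega
    · exact h
    · rw [polyDim_poly hk hρ] at hd; omega
  · rintro ⟨i, rfl⟩
    exact ⟨isExposed_edge hk hρ i, by rw [polyDim_poly hk hρ, polyDim_edge hk hρ]; norm_num⟩

theorem isRidge_poly_iff (hk : 3 ≤ k) (hρ : 0 < ρ) {F : Set Plane} :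
    IsRidge (poly k c ρ θ) F ↔ ∃ i, F = {vert k c ρ θ i} := by
  constructor
  · rintro ⟨hF, hd⟩
    rw [polyDim_poly hk hρ] at hd
    rcases face_cases hk hρ hF with rfl | h | ⟨i, rfl⟩ | rfl
    · simp at hd
    · exact h
    · rw [polyDim_edge hk hρ] at hd; omega
    · rw [polyDim_poly hk hρ] at hd; omega
  · rintro ⟨i, rfl⟩
    exact ⟨isExposed_vert hk hρ i, by rw [polyDim_poly hk hρ, polyDim_vert]; norm_num⟩

theorem extremePoints_poly (hk : 3 ≤ k) (hρ : 0 < ρ) :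
    (poly k c ρ θ).extremePoints ℝ = Set.range (vert k c ρ θ) := by
  apply Set.Subset.antisymm
  · exact extremePoints_convexHull_subset
  · rintro _ ⟨i, rfl⟩
    exact exposedPoints_subset_extremePoints
      (mem_exposedPoints_iff_exposed_singleton.2 (isExposed_vert hk hρ i))

theorem edge_eq_iff (hk : 3 ≤ k) (hρ : 0 < ρ) {i j : ℤ} :
    edge k c ρ θ i = edge k c ρ θ j ↔ (k : ℤ) ∣ i - j := by
  refine ⟨fun h => ?_, edge_of_dvd hk⟩
  have h1 := vert_mem_edge (c := c) (θ := θ) hk hρ i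
  have h2 := vert_mem_edge' (c := c) (θ := θ) hk hρ i
  rw [h, vert_mem_edge_iff hk hρ] at h1 h2
  rcases h1 with h1 | h1
  · exact h1
  rcases h2 with h2 | h2
  · exfalso
    have := dvd_sub h2 h1
    rw [show i + 1 - j - (i - j - 1) = 2 by ring] at this
    exact not_dvd_of_lt hk (by norm_num) (by norm_num) this
  · rwa [show i + 1 - j - 1 = i - j by ring] at h2

theorem edge_eq_convexHull (hk : 3 ≤ k) (hρ : 0 < ρ) (i : ℤ) :
    edge k c ρ θ i = convexHull ℝ {vert k c ρ θ i, vert k c ρ θ (i + 1)} := by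
  have h := IsExposed.eq_convexHull (W := Set.range (vert k c ρ θ))
    (isExposed_edge (c := c) (θ := θ) hk hρ i)
  rw [h]
  congr 1
  ext x
  constructor
  · rintro ⟨⟨j, rfl⟩, hj⟩
    rw [vert_mem_edge_iff hk hρ] at hj
    rcases hj with hj | hj
    · exact Or.inl (vert_of_dvd hk hj)
    · refine Or.inr (vert_of_dvd hk ?_)
      rwa [show j - (i + 1) = j - i - 1 by ring]
  · rintro (rfl | rfl)
    · exact ⟨⟨_, rfl⟩, vert_mem_edge hk hρ i⟩
    · exact ⟨⟨_, rfl⟩, vert_mem_edge' hk hρ i⟩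

end RegularPolygon

end EPolytope

namespace EPolytope

/-! ### Faces of products -/

section Products

variable {E₀ E₁ : Type*} [AddCommGroup E₀] [Module ℝ E₀] [AddCommGroup E₁] [Module ℝ E₁]

theorem polyDim_prod [FiniteDimensional ℝ E₀] [FiniteDimensional ℝ E₁] {S : Set E₀} {T : Set E₁}
    (hS : S.Nonempty) (hT : T.Nonempty) : polyDim (S ×ˢ T) = polyDim S + polyDim T := by
  rw [polyDim_of_nonempty hS, polyDim_of_nonempty hT, polyDim_of_nonempty (hS.prod hT),
    vectorSpan_prod_eq hS hT]
  have h : (vectorSpan ℝ S).prod (vectorSpan ℝ T) =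
      LinearMap.range ((vectorSpan ℝ S).subtype.prodMap (vectorSpan ℝ T).subtype) := by
    rw [LinearMap.range_prodMap, Submodule.range_subtype, Submodule.range_subtype]
  rw [h, LinearMap.finrank_range_of_inj, Module.finrank_prod]
  · push_cast; rfl
  · exact Prod.map_injective.2 ⟨Subtype.val_injective, Subtype.val_injective⟩

variable [TopologicalSpace E₀] [TopologicalSpace E₁] {P₀ : Set E₀} {P₁ : Set E₁}

/-- A functional on a product is a sum of functionals of the two coordinates, which can be maximised
independently. -/
theorem toExposed_prod (l : E₀ × E₁ →L[ℝ] ℝ) : l.toExposed (P₀ ×ˢ P₁) =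
    (l.comp (.inl ℝ E₀ E₁)).toExposed P₀ ×ˢ (l.comp (.inr ℝ E₀ E₁)).toExposed P₁ := by
  have hl : ∀ x y, l (x, y) = l (x, 0) + l (0, y) := fun x y => by
    rw [← map_add]; simp
  ext ⟨x, y⟩
  simp only [ContinuousLinearMap.toExposed, Set.mem_prod, Set.mem_ofPred_eq,
    ContinuousLinearMap.comp_apply, ContinuousLinearMap.inl_apply, ContinuousLinearMap.inr_apply,
    Prod.forall]
  constructor
  · rintro ⟨⟨hx, hy⟩, h⟩
    refine ⟨⟨hx, fun z hz => ?_⟩, hy, fun z hz => ?_⟩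
    · have := h z y ⟨hz, hy⟩
      rw [hl, hl x] at this
      linarith
    · have := h x z ⟨hx, hz⟩
      rw [hl, hl x y] at this
      linarith
  · rintro ⟨⟨hx, h1⟩, hy, h2⟩
    refine ⟨⟨hx, hy⟩, fun z w hzw => ?_⟩
    rw [hl, hl x y]
    exact add_le_add (h1 z hzw.1) (h2 w hzw.2)

theorem isExposed_prod {F₀ : Set E₀} {F₁ : Set E₁} (h₀ : IsExposed ℝ P₀ F₀)
    (h₁ : IsExposed ℝ P₁ F₁) : IsExposed ℝ (P₀ ×ˢ P₁) (F₀ ×ˢ F₁) := by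
  intro hne
  obtain ⟨l₀, hl₀⟩ := h₀ hne.fst
  obtain ⟨l₁, hl₁⟩ := h₁ hne.snd
  refine ⟨l₀.comp (.fst ℝ E₀ E₁) + l₁.comp (.snd ℝ E₀ E₁), ?_⟩
  change _ = ContinuousLinearMap.toExposed _ _
  rw [toExposed_prod, hl₀, hl₁]
  simp [ContinuousLinearMap.toExposed]

/-- The nonempty faces of a product are the products of nonempty faces. -/
theorem exists_prod_of_isExposed {F : Set (E₀ × E₁)} (hF : IsExposed ℝ (P₀ ×ˢ P₁) F)
    (hne : F.Nonempty) : ∃ F₀ F₁, IsExposed ℝ P₀ F₀ ∧ IsExposed ℝ P₁ F₁ ∧ F₀.Nonempty ∧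
      F₁.Nonempty ∧ F = F₀ ×ˢ F₁ := by
  obtain ⟨l, hl⟩ := hF hne
  change F = l.toExposed _ at hl
  rw [toExposed_prod] at hl
  have hne' := hne
  rw [hl] at hne'
  exact ⟨_, _, ContinuousLinearMap.toExposed.isExposed, ContinuousLinearMap.toExposed.isExposed,
    hne'.fst, hne'.snd, hl⟩

end Products

/-! ### Facets, ridges and intervals of a product of two polygons -/

section PolygonProduct

variable {m n : ℕ} {c₀ c₁ : Plane} {ρ₀ ρ₁ θ₀ θ₁ : ℝ}

theorem nonempty_poly {k : ℕ} {c : Plane} {ρ θ : ℝ} : (poly k c ρ θ).Nonempty :=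
  ⟨_, vert_mem_poly 0⟩

theorem nonempty_edge {k : ℕ} {c : Plane} {ρ θ : ℝ} (hk : 3 ≤ k) (hρ : 0 < ρ) (i : ℤ) :
    (edge k c ρ θ i).Nonempty := ⟨_, vert_mem_edge hk hρ i⟩

theorem eq_poly_of_edges_subset {k : ℕ} {c : Plane} {ρ θ : ℝ} (hk : 3 ≤ k) (hρ : 0 < ρ)
    {F : Set Plane} (hF : IsExposed ℝ (poly k c ρ θ) F) {i : ℤ} (h1 : edge k c ρ θ i ⊆ F)
    (h2 : edge k c ρ θ (i + 1) ⊆ F) : F = poly k c ρ θ := by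
  have m1 := h1 (vert_mem_edge hk hρ i)
  have m2 := h1 (vert_mem_edge' hk hρ i)
  rcases face_cases hk hρ hF with rfl | ⟨j, rfl⟩ | ⟨j, rfl⟩ | rfl
  · exact absurd m1 (Set.notMem_empty _)
  · exact absurd (h1.antisymm (by simpa using (by
      rw [← Set.mem_singleton_iff.1 m1]; exact vert_mem_edge hk hρ i)))
      (fun h => by
        have := polyDim_edge (c := c) (θ := θ) hk hρ i
        rw [h, polyDim_vert] at this
        omega)
  · have e1 := eq_of_polyDim_le (isExposed_edge hk hρ i) (Set.sep_subset _ _) h1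
      (by change polyDim (edge k c ρ θ j) ≤ _; rw [polyDim_edge hk hρ, polyDim_edge hk hρ])
    have e2 := eq_of_polyDim_le (isExposed_edge hk hρ (i + 1)) (Set.sep_subset _ _) h2
      (by change polyDim (edge k c ρ θ j) ≤ _; rw [polyDim_edge hk hρ, polyDim_edge hk hρ])
    have e3 := e1.trans e2.symm
    rw [edge_eq_iff hk hρ] at e3
    exact absurd e3 (not_dvd_of_lt hk (by simp) (by norm_num [abs_lt]))
  · rfl

theorem edge_subset_of_mem {k : ℕ} {c : Plane} {ρ θ : ℝ} (hk : 3 ≤ k) (hρ : 0 < ρ)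
    {F : Set Plane} (hF : IsExposed ℝ (poly k c ρ θ) F) {i : ℤ} (h1 : vert k c ρ θ i ∈ F)
    (h2 : vert k c ρ θ (i + 1) ∈ F) : edge k c ρ θ i ⊆ F := by
  rw [edge_eq_convexHull hk hρ]
  refine convexHull_min ?_ (hF.convex convex_poly)
  rintro x (rfl | rfl) <;> assumption

theorem polyDim_poly_prod (hm : 3 ≤ m) (hn : 3 ≤ n) (hρ₀ : 0 < ρ₀) (hρ₁ : 0 < ρ₁) :
    polyDim (poly m c₀ ρ₀ θ₀ ×ˢ poly n c₁ ρ₁ θ₁) = 4 := by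
  rw [polyDim_prod nonempty_poly nonempty_poly, polyDim_poly hm hρ₀, polyDim_poly hn hρ₁]
  norm_num

theorem isFacet_prod_iff (hm : 3 ≤ m) (hn : 3 ≤ n) (hρ₀ : 0 < ρ₀) (hρ₁ : 0 < ρ₁)
    {F : Set (Plane × Plane)} :
    IsFacet (poly m c₀ ρ₀ θ₀ ×ˢ poly n c₁ ρ₁ θ₁) F ↔
      (∃ i, F = edge m c₀ ρ₀ θ₀ i ×ˢ poly n c₁ ρ₁ θ₁) ∨
        ∃ k, F = poly m c₀ ρ₀ θ₀ ×ˢ edge n c₁ ρ₁ θ₁ k := by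
  unfold IsFacet
  rw [polyDim_poly_prod hm hn hρ₀ hρ₁]
  constructor
  · rintro ⟨hF, hd⟩
    rcases F.eq_empty_or_nonempty with rfl | hne
    · simp at hd
    obtain ⟨F₀, F₁, h0, h1, n0, n1, rfl⟩ := exists_prod_of_isExposed hF hne
    rw [polyDim_prod n0 n1] at hd
    rcases face_cases hm hρ₀ h0 with rfl | ⟨i, rfl⟩ | ⟨i, rfl⟩ | rfl
    · exact absurd n0 Set.not_nonempty_empty
    · rw [polyDim_vert] at hd
      have := polyDim_plane_le F₁
      omega
    · rw [polyDim_edge hm hρ₀] at hd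
      rcases face_cases hn hρ₁ h1 with rfl | ⟨k, rfl⟩ | ⟨k, rfl⟩ | rfl
      · simp at hd
      · rw [polyDim_vert] at hd; omega
      · rw [polyDim_edge hn hρ₁] at hd; omega
      · exact Or.inl ⟨i, rfl⟩
    · rw [polyDim_poly hm hρ₀] at hd
      rcases face_cases hn hρ₁ h1 with rfl | ⟨k, rfl⟩ | ⟨k, rfl⟩ | rfl
      · simp at hd
      · rw [polyDim_vert] at hd; omega
      · exact Or.inr ⟨k, rfl⟩
      · rw [polyDim_poly hn hρ₁] at hd; omega
  · rintro (⟨i, rfl⟩ | ⟨k, rfl⟩)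
    · refine ⟨isExposed_prod (isExposed_edge hm hρ₀ i) (IsExposed.refl _), ?_⟩
      rw [polyDim_prod (nonempty_edge hm hρ₀ i) nonempty_poly, polyDim_edge hm hρ₀,
        polyDim_poly hn hρ₁]
      norm_num
    · refine ⟨isExposed_prod (IsExposed.refl _) (isExposed_edge hn hρ₁ k), ?_⟩
      rw [polyDim_prod nonempty_poly (nonempty_edge hn hρ₁ k), polyDim_edge hn hρ₁,
        polyDim_poly hm hρ₀]
      norm_num

theorem isRidge_prod_iff (hm : 3 ≤ m) (hn : 3 ≤ n) (hρ₀ : 0 < ρ₀) (hρ₁ : 0 < ρ₁)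
    {R : Set (Plane × Plane)} :
    IsRidge (poly m c₀ ρ₀ θ₀ ×ˢ poly n c₁ ρ₁ θ₁) R ↔
      (∃ i, R = {vert m c₀ ρ₀ θ₀ i} ×ˢ poly n c₁ ρ₁ θ₁) ∨
        (∃ k, R = poly m c₀ ρ₀ θ₀ ×ˢ {vert n c₁ ρ₁ θ₁ k}) ∨
          ∃ i k, R = edge m c₀ ρ₀ θ₀ i ×ˢ edge n c₁ ρ₁ θ₁ k := by
  unfold IsRidge
  rw [polyDim_poly_prod hm hn hρ₀ hρ₁]
  constructor
  · rintro ⟨hF, hd⟩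
    rcases R.eq_empty_or_nonempty with rfl | hne
    · simp at hd
    obtain ⟨F₀, F₁, h0, h1, n0, n1, rfl⟩ := exists_prod_of_isExposed hF hne
    rw [polyDim_prod n0 n1] at hd
    rcases face_cases hm hρ₀ h0 with rfl | ⟨i, rfl⟩ | ⟨i, rfl⟩ | rfl
    · exact absurd n0 Set.not_nonempty_empty
    · rw [polyDim_vert] at hd
      rcases face_cases hn hρ₁ h1 with rfl | ⟨k, rfl⟩ | ⟨k, rfl⟩ | rfl
      · simp at hd
      · rw [polyDim_vert] at hd; omega
      · rw [polyDim_edge hn hρ₁] at hd; omega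
      · exact Or.inl ⟨i, rfl⟩
    · rw [polyDim_edge hm hρ₀] at hd
      rcases face_cases hn hρ₁ h1 with rfl | ⟨k, rfl⟩ | ⟨k, rfl⟩ | rfl
      · simp at hd
      · rw [polyDim_vert] at hd; omega
      · exact Or.inr (Or.inr ⟨i, k, rfl⟩)
      · rw [polyDim_poly hn hρ₁] at hd; omega
    · rw [polyDim_poly hm hρ₀] at hd
      rcases face_cases hn hρ₁ h1 with rfl | ⟨k, rfl⟩ | ⟨k, rfl⟩ | rfl
      · exact absurd n1 Set.not_nonempty_empty
      · exact Or.inr (Or.inl ⟨k, rfl⟩)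
      · rw [polyDim_edge hn hρ₁] at hd; omega
      · rw [polyDim_poly hn hρ₁] at hd; omega
  · rintro (⟨i, rfl⟩ | ⟨k, rfl⟩ | ⟨i, k, rfl⟩)
    · refine ⟨isExposed_prod (isExposed_vert hm hρ₀ i) (IsExposed.refl _), ?_⟩
      rw [polyDim_prod (Set.singleton_nonempty _) nonempty_poly, polyDim_vert,
        polyDim_poly hn hρ₁]
      norm_num
    · refine ⟨isExposed_prod (IsExposed.refl _) (isExposed_vert hn hρ₁ k), ?_⟩
      rw [polyDim_prod nonempty_poly (Set.singleton_nonempty _), polyDim_vert,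
        polyDim_poly hm hρ₀]
      norm_num
    · refine ⟨isExposed_prod (isExposed_edge hm hρ₀ i) (isExposed_edge hn hρ₁ k), ?_⟩
      rw [polyDim_prod (nonempty_edge hm hρ₀ i) (nonempty_edge hn hρ₁ k), polyDim_edge hm hρ₀,
        polyDim_edge hn hρ₁]
      norm_num

/-- The intervals of the face lattice of a product of polygons that are not single ridges
are determined by the ridges that they contain. -/
theorem isRidgeGenerated_prod (hm : 3 ≤ m) (hn : 3 ≤ n) (hρ₀ : 0 < ρ₀) (hρ₁ : 0 < ρ₁)
    {y z : Set (Plane × Plane)} (hy : IsExposed ℝ (poly m c₀ ρ₀ θ₀ ×ˢ poly n c₁ ρ₁ θ₁) y)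
    (hz : IsExposed ℝ (poly m c₀ ρ₀ θ₀ ×ˢ poly n c₁ ρ₁ θ₁) z) (hyz : y ⊆ z)
    (hyd : polyDim y < 2) (hzd : 2 < polyDim z)
    (hne : y = ∅ → z ≠ poly m c₀ ρ₀ θ₀ ×ˢ poly n c₁ ρ₁ θ₁) :
    IsRidgeGenerated (poly m c₀ ρ₀ θ₀ ×ˢ poly n c₁ ρ₁ θ₁) y z := by
  have hr1 : ∀ i, IsRidge (poly m c₀ ρ₀ θ₀ ×ˢ poly n c₁ ρ₁ θ₁)
    ({vert m c₀ ρ₀ θ₀ i} ×ˢ poly n c₁ ρ₁ θ₁) :=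
    fun i => (isRidge_prod_iff hm hn hρ₀ hρ₁).2 (Or.inl ⟨i, rfl⟩)
  have hr2 : ∀ k, IsRidge (poly m c₀ ρ₀ θ₀ ×ˢ poly n c₁ ρ₁ θ₁)
    (poly m c₀ ρ₀ θ₀ ×ˢ {vert n c₁ ρ₁ θ₁ k}) :=
    fun i => (isRidge_prod_iff hm hn hρ₀ hρ₁).2 (Or.inr (Or.inl ⟨i, rfl⟩))
  have hr3 : ∀ i k, IsRidge (poly m c₀ ρ₀ θ₀ ×ˢ poly n c₁ ρ₁ θ₁)
    (edge m c₀ ρ₀ θ₀ i ×ˢ edge n c₁ ρ₁ θ₁ k) :=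
    fun i k => (isRidge_prod_iff hm hn hρ₀ hρ₁).2 (Or.inr (Or.inr ⟨i, k, rfl⟩))
  have hle0 : ∀ i, edge m c₀ ρ₀ θ₀ i ⊆ poly m c₀ ρ₀ θ₀ := fun i => Set.sep_subset _ _
  have hle1 : ∀ i, edge n c₁ ρ₁ θ₁ i ⊆ poly n c₁ ρ₁ θ₁ := fun i => Set.sep_subset _ _
  have hv0 : ∀ i, {vert m c₀ ρ₀ θ₀ i} ⊆ poly m c₀ ρ₀ θ₀ := fun i => by
    simpa using vert_mem_poly i
  have hv1 : ∀ i, {vert n c₁ ρ₁ θ₁ i} ⊆ poly n c₁ ρ₁ θ₁ := fun i => by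
    simpa using vert_mem_poly i
  have hfac : ∀ F, IsFacet (poly m c₀ ρ₀ θ₀ ×ˢ poly n c₁ ρ₁ θ₁) F → ∃ F₀ F₁,
      IsExposed ℝ (poly m c₀ ρ₀ θ₀) F₀ ∧ IsExposed ℝ (poly n c₁ ρ₁ θ₁) F₁ ∧ F = F₀ ×ˢ F₁ := by
    intro F hF
    rcases (isFacet_prod_iff hm hn hρ₀ hρ₁).1 hF with ⟨i, rfl⟩ | ⟨i, rfl⟩
    · exact ⟨_, _, isExposed_edge hm hρ₀ i, IsExposed.refl _, rfl⟩
    · exact ⟨_, _, IsExposed.refl _, isExposed_edge hn hρ₁ i, rfl⟩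
  -- components of contained products
  have comp : ∀ {A₀ A₁ B₀ B₁ : Set Plane}, A₀.Nonempty → A₁.Nonempty →
      A₀ ×ˢ A₁ ⊆ B₀ ×ˢ B₁ → A₀ ⊆ B₀ ∧ A₁ ⊆ B₁ := by
    intro A₀ A₁ B₀ B₁ h0 h1 h
    rcases Set.prod_subset_prod_iff.1 h with h | rfl | rfl
    · exact h
    · exact absurd h0 Set.not_nonempty_empty
    · exact absurd h1 Set.not_nonempty_empty
  have hne0 : ∀ i, (edge m c₀ ρ₀ θ₀ i).Nonempty := nonempty_edge hm hρ₀
  have hne1 : ∀ i, (edge n c₁ ρ₁ θ₁ i).Nonempty := nonempty_edge hn hρ₁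
  have hp0 : (poly m c₀ ρ₀ θ₀).Nonempty := nonempty_poly
  have hp1 : (poly n c₁ ρ₁ θ₁).Nonempty := nonempty_poly
  have hs : ∀ x : Plane, ({x} : Set Plane).Nonempty := Set.singleton_nonempty
  have hsub0 : ∀ i j, edge m c₀ ρ₀ θ₀ i ⊆ edge m c₀ ρ₀ θ₀ j →
      edge m c₀ ρ₀ θ₀ i = edge m c₀ ρ₀ θ₀ j := fun i j h =>
    eq_of_polyDim_le (isExposed_edge hm hρ₀ i) (hle0 j) h
      (by rw [polyDim_edge hm hρ₀, polyDim_edge hm hρ₀])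
  have hsub1 : ∀ i j, edge n c₁ ρ₁ θ₁ i ⊆ edge n c₁ ρ₁ θ₁ j →
      edge n c₁ ρ₁ θ₁ i = edge n c₁ ρ₁ θ₁ j := fun i j h =>
    eq_of_polyDim_le (isExposed_edge hn hρ₁ i) (hle1 j) h
      (by rw [polyDim_edge hn hρ₁, polyDim_edge hn hρ₁])
  -- the possible shapes of the bounds
  have hzc : (∃ a, z = edge m c₀ ρ₀ θ₀ a ×ˢ poly n c₁ ρ₁ θ₁) ∨
      (∃ b, z = poly m c₀ ρ₀ θ₀ ×ˢ edge n c₁ ρ₁ θ₁ b) ∨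
        z = poly m c₀ ρ₀ θ₀ ×ˢ poly n c₁ ρ₁ θ₁ := by
    have h4 := polyDim_mono hz.subset
    rw [polyDim_poly_prod hm hn hρ₀ hρ₁] at h4
    rcases (show polyDim z = 3 ∨ 4 ≤ polyDim z by omega) with h | h
    · have : IsFacet (poly m c₀ ρ₀ θ₀ ×ˢ poly n c₁ ρ₁ θ₁) z :=
        ⟨hz, by rw [polyDim_poly_prod hm hn hρ₀ hρ₁, h]; norm_num⟩
      rcases (isFacet_prod_iff hm hn hρ₀ hρ₁).1 this with h | h
      · exact Or.inl h
      · exact Or.inr (Or.inl h)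
    · exact Or.inr (Or.inr (eq_of_polyDim_le hz subset_rfl hz.subset
        (by rwa [polyDim_poly_prod hm hn hρ₀ hρ₁])))
  have hyc : y = ∅ ∨
      (∃ i k, y = {vert m c₀ ρ₀ θ₀ (i + 1)} ×ˢ {vert n c₁ ρ₁ θ₁ (k + 1)}) ∨
      (∃ i k, y = {vert m c₀ ρ₀ θ₀ (i + 1)} ×ˢ edge n c₁ ρ₁ θ₁ k) ∨
      (∃ i k, y = edge m c₀ ρ₀ θ₀ i ×ˢ {vert n c₁ ρ₁ θ₁ (k + 1)}) := by
    rcases y.eq_empty_or_nonempty with rfl | hne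
    · exact Or.inl rfl
    right
    obtain ⟨F₀, F₁, h0, h1, n0, n1, rfl⟩ := exists_prod_of_isExposed hy hne
    rw [polyDim_prod n0 n1] at hyd
    rcases face_cases hm hρ₀ h0 with rfl | ⟨i, rfl⟩ | ⟨i, rfl⟩ | rfl
    · exact absurd n0 Set.not_nonempty_empty
    · rw [polyDim_vert] at hyd
      rcases face_cases hn hρ₁ h1 with rfl | ⟨k, rfl⟩ | ⟨k, rfl⟩ | rfl
      · exact absurd n1 Set.not_nonempty_empty
      · exact Or.inl ⟨i - 1, k - 1, by rw [sub_add_cancel, sub_add_cancel]⟩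
      · exact Or.inr (Or.inl ⟨i - 1, k, by rw [sub_add_cancel]⟩)
      · rw [polyDim_poly hn hρ₁] at hyd; omega
    · rw [polyDim_edge hm hρ₀] at hyd
      rcases face_cases hn hρ₁ h1 with rfl | ⟨k, rfl⟩ | ⟨k, rfl⟩ | rfl
      · exact absurd n1 Set.not_nonempty_empty
      · exact Or.inr (Or.inr ⟨i, k - 1, by rw [sub_add_cancel]⟩)
      · rw [polyDim_edge hn hρ₁] at hyd; omega
      · rw [polyDim_poly hn hρ₁] at hyd; omega
    · rw [polyDim_poly hm hρ₀] at hyd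
      rcases face_cases hn hρ₁ h1 with rfl | ⟨k, rfl⟩ | ⟨k, rfl⟩ | rfl
      · exact absurd n1 Set.not_nonempty_empty
      · rw [polyDim_vert] at hyd; omega
      · rw [polyDim_edge hn hρ₁] at hyd; omega
      · rw [polyDim_poly hn hρ₁] at hyd; omega
  have hm0 : ∀ i, {vert m c₀ ρ₀ θ₀ (i + 1)} ⊆ edge m c₀ ρ₀ θ₀ i := fun i => by
    simpa using vert_mem_edge' hm hρ₀ i
  have hm0' : ∀ i, {vert m c₀ ρ₀ θ₀ (i + 1)} ⊆ edge m c₀ ρ₀ θ₀ (i + 1) := fun i => by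
    simpa using vert_mem_edge hm hρ₀ (i + 1)
  have hm1 : ∀ i, {vert n c₁ ρ₁ θ₁ (i + 1)} ⊆ edge n c₁ ρ₁ θ₁ i := fun i => by
    simpa using vert_mem_edge' hn hρ₁ i
  have hm1' : ∀ i, {vert n c₁ ρ₁ θ₁ (i + 1)} ⊆ edge n c₁ ρ₁ θ₁ (i + 1) := fun i => by
    simpa using vert_mem_edge hn hρ₁ (i + 1)
  have hi0 := edge_inter_edge (c := c₀) (θ := θ₀) hm hρ₀
  have hi1 := edge_inter_edge (c := c₁) (θ := θ₁) hn hρ₁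
  have hvne0 : ∀ i, vert m c₀ ρ₀ θ₀ i ≠ vert m c₀ ρ₀ θ₀ (i + 1) := fun i h => by
    rw [vert_eq_iff hm hρ₀] at h
    exact not_dvd_of_lt hm (by simp) (by norm_num [abs_lt]) h
  have hvne1 : ∀ i, vert n c₁ ρ₁ θ₁ i ≠ vert n c₁ ρ₁ θ₁ (i + 1) := fun i h => by
    rw [vert_eq_iff hn hρ₁] at h
    exact not_dvd_of_lt hn (by simp) (by norm_num [abs_lt]) h
  have hmv0 := vert_mem_edge (c := c₀) (θ := θ₀) hm hρ₀
  have hmv1 := vert_mem_edge (c := c₁) (θ := θ₁) hn hρ₁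
  have hmv0' := vert_mem_edge' (c := c₀) (θ := θ₀) hm hρ₀
  have hmv1' := vert_mem_edge' (c := c₁) (θ := θ₁) hn hρ₁
  -- Every case names a few ridges of the interval that meet in `y` and generate `z`. Where such
  -- inclusions need proof, `t1`, `t2`, `t3` place the ridges above `y`, and `s1`, `s2`, `s3` place
  -- them below `z`.
  rcases hzc with ⟨a, rfl⟩ | ⟨b, rfl⟩ | rfl
  · rcases hyc with rfl | ⟨i, k, rfl⟩ | ⟨i, k, rfl⟩ | ⟨i, k, rfl⟩
    · have s1 : {vert m c₀ ρ₀ θ₀ a} ×ˢ poly n c₁ ρ₁ θ₁ ⊆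
        edge m c₀ ρ₀ θ₀ a ×ˢ poly n c₁ ρ₁ θ₁ :=
        Set.prod_mono (by simpa using hmv0 a) subset_rfl
      have s2 : {vert m c₀ ρ₀ θ₀ (a + 1)} ×ˢ poly n c₁ ρ₁ θ₁ ⊆
        edge m c₀ ρ₀ θ₀ a ×ˢ poly n c₁ ρ₁ θ₁ := Set.prod_mono (hm0 a) subset_rfl
      refine ⟨fun x _ hx => ?_, fun F hF hR => ?_⟩
      -- The ridges over the two ends of an edge are disjoint, so they already have the empty face
      -- as their meet.
      · have h1 := (hx _ (hr1 _) (Set.empty_subset _) s1).1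
        have h2 := (hx _ (hr1 _) (Set.empty_subset _) s2).1
        exact absurd (h1.symm.trans h2) (hvne0 a)
      · obtain ⟨F₀, F₁, e0, e1, rfl⟩ := hfac F hF
        have h1 := comp (hs _) hp1 (hR _ (hr1 _) (Set.empty_subset _) s1)
        have h2 := comp (hs _) hp1 (hR _ (hr1 _) (Set.empty_subset _) s2)
        exact Set.prod_mono (edge_subset_of_mem hm hρ₀ e0 (h1.1 rfl) (h2.1 rfl)) h1.2
    · obtain ⟨y0, -⟩ := comp (hs _) (hs _) hyz
      have s1 := Set.prod_mono y0 (subset_refl (poly n c₁ ρ₁ θ₁))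
      have s2 := Set.prod_mono (subset_refl (edge m c₀ ρ₀ θ₀ a)) (hle1 k)
      have s3 := Set.prod_mono (subset_refl (edge m c₀ ρ₀ θ₀ a)) (hle1 (k + 1))
      have t1 := Set.prod_mono (subset_refl {vert m c₀ ρ₀ θ₀ (i + 1)}) (hv1 (k + 1))
      have t2 := Set.prod_mono y0 (hm1 k)
      have t3 := Set.prod_mono y0 (hm1' k)
      refine ⟨fun x _ hx => ?_, fun F hF hR => ?_⟩
      · refine ⟨(hx _ (hr1 _) t1 s1).1, ?_⟩
        rw [← hi1]
        exact ⟨(hx _ (hr3 _ _) t2 s2).2, (hx _ (hr3 _ _) t3 s3).2⟩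
      · obtain ⟨F₀, F₁, e0, e1, rfl⟩ := hfac F hF
        exact Set.prod_mono (comp (hne0 _) (hne1 _) (hR _ (hr3 _ _) t2 s2)).1
          (comp (hs _) hp1 (hR _ (hr1 _) t1 s1)).2
    · obtain ⟨y0, -⟩ := comp (hs _) (hne1 _) hyz
      have s1 := Set.prod_mono y0 (subset_refl (poly n c₁ ρ₁ θ₁))
      have s2 := Set.prod_mono (subset_refl (edge m c₀ ρ₀ θ₀ a)) (hle1 k)
      have t1 := Set.prod_mono (subset_refl {vert m c₀ ρ₀ θ₀ (i + 1)}) (hle1 k)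
      have t2 := Set.prod_mono y0 (subset_refl (edge n c₁ ρ₁ θ₁ k))
      refine ⟨fun x _ hx => ⟨(hx _ (hr1 _) t1 s1).1, (hx _ (hr3 _ _) t2 s2).2⟩,
        fun F hF hR => ?_⟩
      obtain ⟨F₀, F₁, e0, e1, rfl⟩ := hfac F hF
      exact Set.prod_mono (comp (hne0 _) (hne1 _) (hR _ (hr3 _ _) t2 s2)).1
        (comp (hs _) hp1 (hR _ (hr1 _) t1 s1)).2
    · obtain ⟨y0, -⟩ := comp (hne0 _) (hs _) hyz
      rw [← hsub0 _ _ y0]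
      have s1 := Set.prod_mono (subset_refl (edge m c₀ ρ₀ θ₀ i)) (hle1 k)
      have s2 := Set.prod_mono (subset_refl (edge m c₀ ρ₀ θ₀ i)) (hle1 (k + 1))
      have t1 := Set.prod_mono (subset_refl (edge m c₀ ρ₀ θ₀ i)) (hm1 k)
      have t2 := Set.prod_mono (subset_refl (edge m c₀ ρ₀ θ₀ i)) (hm1' k)
      refine ⟨fun x _ hx => ?_, fun F hF hR => ?_⟩
      · have h1 := hx _ (hr3 _ _) t1 s1
        refine ⟨h1.1, ?_⟩
        rw [← hi1]
        exact ⟨h1.2, (hx _ (hr3 _ _) t2 s2).2⟩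
      · obtain ⟨F₀, F₁, e0, e1, rfl⟩ := hfac F hF
        have h1 := comp (hne0 _) (hne1 _) (hR _ (hr3 _ _) t1 s1)
        have h2 := comp (hne0 _) (hne1 _) (hR _ (hr3 _ _) t2 s2)
        exact Set.prod_mono h1.1 (eq_poly_of_edges_subset hn hρ₁ e1 h1.2 h2.2).superset
  · rcases hyc with rfl | ⟨i, k, rfl⟩ | ⟨i, k, rfl⟩ | ⟨i, k, rfl⟩
    · have s1 : poly m c₀ ρ₀ θ₀ ×ˢ {vert n c₁ ρ₁ θ₁ b} ⊆
        poly m c₀ ρ₀ θ₀ ×ˢ edge n c₁ ρ₁ θ₁ b :=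
        Set.prod_mono subset_rfl (by simpa using hmv1 b)
      have s2 : poly m c₀ ρ₀ θ₀ ×ˢ {vert n c₁ ρ₁ θ₁ (b + 1)} ⊆
        poly m c₀ ρ₀ θ₀ ×ˢ edge n c₁ ρ₁ θ₁ b := Set.prod_mono subset_rfl (hm1 b)
      refine ⟨fun x _ hx => ?_, fun F hF hR => ?_⟩
      · have h1 := (hx _ (hr2 _) (Set.empty_subset _) s1).2
        have h2 := (hx _ (hr2 _) (Set.empty_subset _) s2).2
        exact absurd (h1.symm.trans h2) (hvne1 b)
      · obtain ⟨F₀, F₁, e0, e1, rfl⟩ := hfac F hF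
        have h1 := comp hp0 (hs _) (hR _ (hr2 _) (Set.empty_subset _) s1)
        have h2 := comp hp0 (hs _) (hR _ (hr2 _) (Set.empty_subset _) s2)
        exact Set.prod_mono h1.1 (edge_subset_of_mem hn hρ₁ e1 (h1.2 rfl) (h2.2 rfl))
    · obtain ⟨-, y1⟩ := comp (hs _) (hs _) hyz
      have s1 := Set.prod_mono (subset_refl (poly m c₀ ρ₀ θ₀)) y1
      have s2 := Set.prod_mono (hle0 i) (subset_refl (edge n c₁ ρ₁ θ₁ b))
      have s3 := Set.prod_mono (hle0 (i + 1)) (subset_refl (edge n c₁ ρ₁ θ₁ b))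
      have t1 := Set.prod_mono (hv0 (i + 1)) (subset_refl {vert n c₁ ρ₁ θ₁ (k + 1)})
      have t2 := Set.prod_mono (hm0 i) y1
      have t3 := Set.prod_mono (hm0' i) y1
      refine ⟨fun x _ hx => ?_, fun F hF hR => ?_⟩
      · refine ⟨?_, (hx _ (hr2 _) t1 s1).2⟩
        rw [← hi0]
        exact ⟨(hx _ (hr3 _ _) t2 s2).1, (hx _ (hr3 _ _) t3 s3).1⟩
      · obtain ⟨F₀, F₁, e0, e1, rfl⟩ := hfac F hF
        exact Set.prod_mono (comp hp0 (hs _) (hR _ (hr2 _) t1 s1)).1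
          (comp (hne0 _) (hne1 _) (hR _ (hr3 _ _) t2 s2)).2
    · obtain ⟨-, y1⟩ := comp (hs _) (hne1 _) hyz
      rw [← hsub1 _ _ y1]
      have s1 := Set.prod_mono (hle0 i) (subset_refl (edge n c₁ ρ₁ θ₁ k))
      have s2 := Set.prod_mono (hle0 (i + 1)) (subset_refl (edge n c₁ ρ₁ θ₁ k))
      have t1 := Set.prod_mono (hm0 i) (subset_refl (edge n c₁ ρ₁ θ₁ k))
      have t2 := Set.prod_mono (hm0' i) (subset_refl (edge n c₁ ρ₁ θ₁ k))
      refine ⟨fun x _ hx => ?_, fun F hF hR => ?_⟩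
      · have h1 := hx _ (hr3 _ _) t1 s1
        refine ⟨?_, h1.2⟩
        rw [← hi0]
        exact ⟨h1.1, (hx _ (hr3 _ _) t2 s2).1⟩
      · obtain ⟨F₀, F₁, e0, e1, rfl⟩ := hfac F hF
        have h1 := comp (hne0 _) (hne1 _) (hR _ (hr3 _ _) t1 s1)
        have h2 := comp (hne0 _) (hne1 _) (hR _ (hr3 _ _) t2 s2)
        exact Set.prod_mono (eq_poly_of_edges_subset hm hρ₀ e0 h1.1 h2.1).superset h1.2
    · obtain ⟨-, y1⟩ := comp (hne0 _) (hs _) hyz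
      have s1 := Set.prod_mono (subset_refl (poly m c₀ ρ₀ θ₀)) y1
      have s2 := Set.prod_mono (hle0 i) (subset_refl (edge n c₁ ρ₁ θ₁ b))
      have t1 := Set.prod_mono (hle0 i) (subset_refl {vert n c₁ ρ₁ θ₁ (k + 1)})
      have t2 := Set.prod_mono (subset_refl (edge m c₀ ρ₀ θ₀ i)) y1
      refine ⟨fun x _ hx => ⟨(hx _ (hr3 _ _) t2 s2).1, (hx _ (hr2 _) t1 s1).2⟩,
        fun F hF hR => ?_⟩
      obtain ⟨F₀, F₁, e0, e1, rfl⟩ := hfac F hF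
      exact Set.prod_mono (comp hp0 (hs _) (hR _ (hr2 _) t1 s1)).1
        (comp (hne0 _) (hne1 _) (hR _ (hr3 _ _) t2 s2)).2
  · rcases hyc with rfl | ⟨i, k, rfl⟩ | ⟨i, k, rfl⟩ | ⟨i, k, rfl⟩
    · exact absurd rfl (hne rfl)
    · have t1 := Set.prod_mono (subset_refl {vert m c₀ ρ₀ θ₀ (i + 1)}) (hv1 (k + 1))
      have t2 := Set.prod_mono (hv0 (i + 1)) (subset_refl {vert n c₁ ρ₁ θ₁ (k + 1)})
      refine ⟨fun x _ hx => ⟨(hx _ (hr1 _) t1 (hr1 _).1.subset).1,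
        (hx _ (hr2 _) t2 (hr2 _).1.subset).2⟩, fun F hF hR => ?_⟩
      obtain ⟨F₀, F₁, e0, e1, rfl⟩ := hfac F hF
      exact Set.prod_mono (comp hp0 (hs _) (hR _ (hr2 _) t2 (hr2 _).1.subset)).1
        (comp (hs _) hp1 (hR _ (hr1 _) t1 (hr1 _).1.subset)).2
    · have t1 := Set.prod_mono (subset_refl {vert m c₀ ρ₀ θ₀ (i + 1)}) (hle1 k)
      have t2 := Set.prod_mono (hm0 i) (subset_refl (edge n c₁ ρ₁ θ₁ k))
      have t3 := Set.prod_mono (hm0' i) (subset_refl (edge n c₁ ρ₁ θ₁ k))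
      refine ⟨fun x _ hx => ⟨(hx _ (hr1 _) t1 (hr1 _).1.subset).1,
        (hx _ (hr3 _ _) t2 (hr3 _ _).1.subset).2⟩, fun F hF hR => ?_⟩
      obtain ⟨F₀, F₁, e0, e1, rfl⟩ := hfac F hF
      have h2 := comp (hne0 _) (hne1 _) (hR _ (hr3 _ _) t2 (hr3 _ _).1.subset)
      have h3 := comp (hne0 _) (hne1 _) (hR _ (hr3 _ _) t3 (hr3 _ _).1.subset)
      exact Set.prod_mono (eq_poly_of_edges_subset hm hρ₀ e0 h2.1 h3.1).superset
        (comp (hs _) hp1 (hR _ (hr1 _) t1 (hr1 _).1.subset)).2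
    · have t1 := Set.prod_mono (hle0 i) (subset_refl {vert n c₁ ρ₁ θ₁ (k + 1)})
      have t2 := Set.prod_mono (subset_refl (edge m c₀ ρ₀ θ₀ i)) (hm1 k)
      have t3 := Set.prod_mono (subset_refl (edge m c₀ ρ₀ θ₀ i)) (hm1' k)
      refine ⟨fun x _ hx => ⟨(hx _ (hr3 _ _) t2 (hr3 _ _).1.subset).1,
        (hx _ (hr2 _) t1 (hr2 _).1.subset).2⟩, fun F hF hR => ?_⟩
      obtain ⟨F₀, F₁, e0, e1, rfl⟩ := hfac F hF
      have h2 := comp (hne0 _) (hne1 _) (hR _ (hr3 _ _) t2 (hr3 _ _).1.subset)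
      have h3 := comp (hne0 _) (hne1 _) (hR _ (hr3 _ _) t3 (hr3 _ _).1.subset)
      exact Set.prod_mono (comp hp0 (hs _) (hR _ (hr2 _) t1 (hr2 _).1.subset)).1
        (eq_poly_of_edges_subset hn hρ₁ e1 h2.2 h3.2).superset

/-- The intervals of the face lattice of a polygon that are not single vertices
are determined by the vertices that they contain. -/
theorem isRidgeGenerated_poly {k : ℕ} {c : Plane} {ρ θ : ℝ} (hk : 3 ≤ k) (hρ : 0 < ρ)
    {y z : Set Plane} (hy : IsExposed ℝ (poly k c ρ θ) y) (hz : IsExposed ℝ (poly k c ρ θ) z)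
    (hyd : polyDim y < 0) (hzd : 0 < polyDim z) (hne : y = ∅ → z ≠ poly k c ρ θ) :
    IsRidgeGenerated (poly k c ρ θ) y z := by
  rcases face_cases hk hρ hy with rfl | ⟨i, rfl⟩ | ⟨i, rfl⟩ | rfl
  · rcases face_cases hk hρ hz with rfl | ⟨i, rfl⟩ | ⟨i, rfl⟩ | rfl
    · simp at hzd
    · rw [polyDim_vert] at hzd; omega
    · have hr : ∀ i, IsRidge (poly k c ρ θ) {vert k c ρ θ i} := fun i =>
        (isRidge_poly_iff hk hρ).2 ⟨i, rfl⟩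
      have s1 : {vert k c ρ θ i} ⊆ edge k c ρ θ i := by simpa using vert_mem_edge hk hρ i
      have s2 : {vert k c ρ θ (i + 1)} ⊆ edge k c ρ θ i := by
        simpa using vert_mem_edge' hk hρ i
      refine ⟨fun x _ hx => ?_, fun F hF hR => ?_⟩
      · have h1 := hx _ (hr i) (Set.empty_subset _) s1
        have h2 := hx _ (hr (i + 1)) (Set.empty_subset _) s2
        have h3 := h1.symm.trans h2
        rw [vert_eq_iff hk hρ] at h3
        exact absurd h3 (not_dvd_of_lt hk (by simp) (by norm_num [abs_lt]))
      · exact edge_subset_of_mem hk hρ hF.1 (hR _ (hr i) (Set.empty_subset _) s1 rfl)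
          (hR _ (hr (i + 1)) (Set.empty_subset _) s2 rfl)
    · exact absurd rfl (hne rfl)
  · rw [polyDim_vert] at hyd; omega
  · rw [polyDim_edge hk hρ] at hyd; omega
  · rw [polyDim_poly hk hρ] at hyd; omega

end PolygonProduct

end EPolytope

namespace EPolytope

/-! ### Necessity: averaging and the facets over edge × edge -/

section Necessity

open Real

namespace IsVertexPreservingRealisation

variable {E : Type*} [AddCommGroup E] [Module ℝ E] [TopologicalSpace E] {P Q : Set E}
  {p : Set E → E}

/-- The facets of a vertex-preserving realisation are the hulls of the ridges and of the new
vertices beyond the facets that contain them. -/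
theorem exists_functional (h : IsVertexPreservingRealisation P Q p) {R : Set E} (hR : IsRidge P R)
    (hne : R.Nonempty) : ∃ l : E →L[ℝ] ℝ,
      l.toExposed Q = convexHull ℝ (R ∪ p '' {F | IsFacet P F ∧ R ⊆ F}) ∧
        l.toExposed Q ≠ Q := by
  obtain ⟨φ, hφ⟩ := h.lattice
  let I : {I : NonemptyInterval (Face P) // IsEInterval P I} :=
    ⟨⟨(⟨R, hR.1⟩, ⟨R, hR.1⟩), le_rfl⟩, Or.inr ⟨rfl, hR.2⟩⟩
  have hI := hφ I
  have hexp := (φ (WithTop.some (OrderDual.toDual I))).2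
  rw [hI] at hexp
  obtain ⟨x, hx⟩ := hne
  obtain ⟨l, hl⟩ := hexp ⟨x, subset_convexHull ℝ _ (Or.inl hx)⟩
  refine ⟨l, hl.symm, fun he => ?_⟩
  obtain ⟨t, ht⟩ := φ.surjective ⟨Q, IsExposed.refl Q⟩
  -- If `l` exposed all of `Q`, the face of the ridge would contain every face, and a proper element
  -- would dominate the top.
  have h1 : φ ⊤ ≤ φ (WithTop.some (OrderDual.toDual I)) := by
    change (φ ⊤).1 ⊆ (φ (WithTop.some (OrderDual.toDual I))).1
    rw [hI]
    refine (φ ⊤).2.subset.trans ?_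
    exact (he.symm.trans hl.symm).subset
  rw [φ.le_iff_le] at h1
  exact WithTop.not_top_le_coe _ h1

/-- Needed to know that different inner vertices lie on different outer edges. -/
theorem eq_of_hull_eq (h : IsVertexPreservingRealisation P Q p) {R R' : Set E}
    (hR : IsRidge P R) (hR' : IsRidge P R')
    (he : convexHull ℝ (R ∪ p '' {F | IsFacet P F ∧ R ⊆ F}) =
      convexHull ℝ (R' ∪ p '' {F | IsFacet P F ∧ R' ⊆ F})) : R = R' := by
  obtain ⟨φ, hφ⟩ := h.lattice
  let I : ∀ R, IsRidge P R → {I : NonemptyInterval (Face P) // IsEInterval P I} := fun R hR =>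
    ⟨⟨(⟨R, hR.1⟩, ⟨R, hR.1⟩), le_rfl⟩, Or.inr ⟨rfl, hR.2⟩⟩
  have h1 : φ (WithTop.some (OrderDual.toDual (I R hR))) =
      φ (WithTop.some (OrderDual.toDual (I R' hR'))) :=
    Subtype.ext ((hφ (I R hR)).trans (he.trans (hφ (I R' hR')).symm))
  have h2 := OrderDual.toDual.injective (WithTop.coe_injective (φ.injective h1))
  exact congrArg (fun J : {I : NonemptyInterval (Face P) // IsEInterval P I} => J.1.fst.1) h2

theorem new_mem (h : IsVertexPreservingRealisation P Q p) {F : Set E} (hF : IsFacet P F) :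
    p F ∈ Q := by
  rw [h.hull]
  exact subset_convexHull ℝ _ (Or.inr ⟨F, hF, rfl⟩)

end IsVertexPreservingRealisation

variable {k : ℕ} {c : Plane} {ρ θ : ℝ}

theorem isFacet_edge (hk : 3 ≤ k) (hρ : 0 < ρ) (i : ℤ) :
    IsFacet (poly k c ρ θ) (edge k c ρ θ i) := (isFacet_poly_iff hk hρ).2 ⟨i, rfl⟩

theorem lt_nrm_of_isBeyond (hk : 3 ≤ k) (hρ : 0 < ρ) {i : ℤ} {x : Plane}
    (h : IsBeyond (poly k c ρ θ) (edge k c ρ θ i) x) : ρ * cos (π / k) < nrm k θ i (x - c) := by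
  have h1 := vert_mem_edge (c := c) (θ := θ) hk hρ i
  have := (h _ (isFacet_edge hk hρ i) (nrm k θ i) (toExposed_nrm hk hρ i).symm _ h1).1 rfl
  rw [← h1.2, map_sub, map_sub]
  linarith

theorem nrm_lt_of_isBeyond (hk : 3 ≤ k) (hρ : 0 < ρ) {F : Set Plane} {x : Plane}
    (h : IsBeyond (poly k c ρ θ) F x) {j : ℤ} (hj : edge k c ρ θ j ≠ F) :
    nrm k θ j (x - c) < ρ * cos (π / k) := by
  have h1 := vert_mem_edge (c := c) (θ := θ) hk hρ j
  have := (h _ (isFacet_edge hk hρ j) (nrm k θ j) (toExposed_nrm hk hρ j).symm _ h1).2 hj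
  rw [← h1.2, map_sub, map_sub]
  linarith

theorem edge_succ_ne (hk : 3 ≤ k) (hρ : 0 < ρ) (i : ℤ) :
    edge k c ρ θ (i + 1) ≠ edge k c ρ θ i := fun h => by
  rw [edge_eq_iff hk hρ] at h
  exact not_dvd_of_lt hk (by simp) (by norm_num [abs_lt]) h

theorem sum_dirL_comp (hk : 3 ≤ k) (α : ℝ) (σ : Fin k → ℤ)
    (hσ : ∀ i j, (k : ℤ) ∣ σ i - σ j → i = j) (x : Plane) :
    ∑ i, dirL (ang k α (σ i)) x = 0 := by
  have := sum_dir_ang_comp hk α σ hσ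
  calc ∑ i, dirL (ang k α (σ i)) x = inner ℝ (∑ i, dir (ang k α (σ i))) x := by
        rw [sum_inner]; rfl
    _ = 0 := by rw [this, inner_zero_left]

theorem fin_eq_of_dvd (i j : Fin k) (h : (k : ℤ) ∣ ((i : ℕ) : ℤ) - ((j : ℕ) : ℤ)) : i = j := by
  have := Int.eq_zero_of_abs_lt_dvd h (by rw [abs_lt]; omega)
  exact Fin.ext (by omega)

theorem sum_nrm (hk : 3 ≤ k) (x : Plane) : ∑ i : Fin k, nrm k θ ((i : ℕ) : ℤ) x = 0 :=
  sum_dirL_comp hk _ _ fin_eq_of_dvd x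

/-- The heights of the new vertices over the edges of a regular polygon, when its `E`-construction
is realised by a regular polygon. -/
theorem sum_height_le (hk : 3 ≤ k) (hρ : 0 < ρ) {C : Plane} {r ϑ : ℝ} (hr : 0 < r)
    {p : Set Plane → Plane}
    (h : IsVertexPreservingRealisation (poly k c ρ θ) (poly k C r ϑ) p) :
    (∑ i : Fin k, (nrm k θ ((i : ℕ) : ℤ) (p (edge k c ρ θ ((i : ℕ) : ℤ)) - c) -
      ρ * cos (π / k))) * cos (π / k) ≤ k * (ρ * sin (π / k) ^ 2) := by
  have hridge : ∀ i, IsRidge (poly k c ρ θ) {vert k c ρ θ i} := fun i =>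
    (isRidge_poly_iff hk hρ).2 ⟨i, rfl⟩
  have hcos := cos_pi_div_pos hk
  have hex : ∀ i : ℤ, ∃ j, edge k C r ϑ j = convexHull ℝ ({vert k c ρ θ i} ∪
      p '' {F | IsFacet (poly k c ρ θ) F ∧ {vert k c ρ θ i} ⊆ F}) := by
    intro i
    obtain ⟨l, hl, hlQ⟩ := h.exists_functional (hridge i) (Set.singleton_nonempty _)
    rcases toExposed_cases (c := C) (θ := ϑ) hk hr l with rfl | ⟨j, hj⟩ | ⟨j, a, ha, rfl⟩
    · exact absurd (by ext x; simp [ContinuousLinearMap.toExposed]) hlQ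
    -- A single point would have to be the new vertex of both edges at vertex `i`, but the line of
    -- edge `i` separates these two.
    · exfalso
      have hmem : ∀ j, vert k c ρ θ i ∈ edge k c ρ θ j →
          p (edge k c ρ θ j) ∈ l.toExposed (poly k C r ϑ) := fun j hj => by
        rw [hl]
        exact subset_convexHull ℝ _ (Or.inr ⟨_, ⟨isFacet_edge hk hρ j, by simpa using hj⟩, rfl⟩)
      have h1 := hmem i (vert_mem_edge hk hρ i)
      have h2 := hmem (i - 1) (by
        have := vert_mem_edge' (c := c) (θ := θ) hk hρ (i - 1)
        rwa [sub_add_cancel] at this)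
      rw [hj] at h1 h2
      have h3 : p (edge k c ρ θ i) = p (edge k c ρ θ (i - 1)) := h1.trans h2.symm
      have h4 := lt_nrm_of_isBeyond hk hρ (h.beyond _ (isFacet_edge hk hρ i))
      have h5 := nrm_lt_of_isBeyond hk hρ (h.beyond _ (isFacet_edge hk hρ (i - 1))) (j := i) (by
        have := edge_succ_ne (c := c) (θ := θ) hk hρ (i - 1)
        rwa [sub_add_cancel] at this)
      rw [h3] at h4
      exact lt_asymm h4 h5
    · refine ⟨j, ?_⟩
      rw [← hl, toExposed_smul _ ha, toExposed_nrm hk hr]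
  choose σ hσ using hex
  -- So `σ` permutes the residues, and the outer normals that it selects sum to zero. This cancels
  -- the unknown offset of the two centers.
  have hinj : ∀ i j : Fin k, (k : ℤ) ∣ σ (i : ℕ) - σ (j : ℕ) → i = j := by
    intro i j hd
    have h1 := edge_of_dvd (c := C) (ρ := r) (θ := ϑ) hk hd
    rw [hσ, hσ] at h1
    have h2 := h.eq_of_hull_eq (hridge _) (hridge _) h1
    rw [Set.singleton_eq_singleton_iff, vert_eq_iff hk hρ] at h2
    exact fin_eq_of_dvd i j h2
  -- the inradius of the outer polygon is at most the circumradius of the inner one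
  have hrad : r * cos (π / k) ≤ ρ := by
    have h1 : ∀ i : Fin k, nrm k ϑ (σ (i : ℕ)) (vert k c ρ θ (i : ℕ) - C) = r * cos (π / k) := by
      intro i
      have : vert k c ρ θ (i : ℕ) ∈ edge k C r ϑ (σ (i : ℕ)) := by
        rw [hσ]; exact subset_convexHull ℝ _ (Or.inl rfl)
      exact this.2
    have h2 : ∀ i : Fin k, nrm k ϑ (σ (i : ℕ)) (vert k c ρ θ (i : ℕ) - c) ≤ ρ := by
      intro i
      exact (dirL_le_norm _ _).trans (norm_sub_center_le hρ (vert_mem_poly _))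
    have h3 : ∑ i : Fin k, nrm k ϑ (σ (i : ℕ)) (c - C) = 0 :=
      sum_dirL_comp hk _ (fun i => σ (i : ℕ)) hinj _
    have h4 : ∑ i : Fin k, (r * cos (π / k)) ≤ ∑ i : Fin k, ρ := by
      calc ∑ i : Fin k, (r * cos (π / k))
          = ∑ i : Fin k, nrm k ϑ (σ (i : ℕ)) (vert k c ρ θ (i : ℕ) - c) +
            ∑ i : Fin k, nrm k ϑ (σ (i : ℕ)) (c - C) := by
            rw [← Finset.sum_add_distrib]
            refine Finset.sum_congr rfl fun i _ => ?_
            rw [← h1 i, ← map_add, sub_add_sub_cancel]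
        _ ≤ _ := by rw [h3, add_zero]; exact Finset.sum_le_sum fun i _ => h2 i
    simp only [Finset.sum_const, Finset.card_univ, Fintype.card_fin, nsmul_eq_mul] at h4
    exact le_of_mul_le_mul_left h4 (by positivity)
  -- Each new vertex is within `r` of the outer center; in the sum over the inner normals the offset
  -- of the centers cancels again.
  have hsum : ∑ i : Fin k, (nrm k θ ((i : ℕ) : ℤ) (p (edge k c ρ θ ((i : ℕ) : ℤ)) - c) -
      ρ * cos (π / k)) ≤ k * r - k * (ρ * cos (π / k)) := by
    have h1 : ∀ i : Fin k,
        nrm k θ ((i : ℕ) : ℤ) (p (edge k c ρ θ ((i : ℕ) : ℤ)) - C) ≤ r := fun i =>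
      (dirL_le_norm _ _).trans (norm_sub_center_le hr (h.new_mem (isFacet_edge hk hρ _)))
    calc _ = ∑ i : Fin k, nrm k θ ((i : ℕ) : ℤ) (p (edge k c ρ θ ((i : ℕ) : ℤ)) - C) +
          ∑ i : Fin k, nrm k θ ((i : ℕ) : ℤ) (C - c) - k * (ρ * cos (π / k)) := by
          rw [← Finset.sum_add_distrib, Finset.sum_sub_distrib]
          congr 1
          · refine Finset.sum_congr rfl fun i _ => ?_
            rw [← map_add, sub_add_sub_cancel]
          · simp
      _ ≤ _ := by
          rw [sum_nrm hk, add_zero]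
          gcongr
          refine (Finset.sum_le_sum fun i _ => h1 i).trans ?_
          simp
  have hsc := sin_sq_add_cos_sq (π / k)
  calc _ ≤ (k * r - k * (ρ * cos (π / k))) * cos (π / k) := by gcongr
    _ = k * (r * cos (π / k)) - k * ρ * cos (π / k) ^ 2 := by ring
    _ ≤ k * ρ - k * ρ * cos (π / k) ^ 2 := by gcongr
    _ = _ := by rw [show sin (π / k) ^ 2 = 1 - cos (π / k) ^ 2 by linarith]; ring

/-- The intersection ratio in terms of the distances to the edge that is crossed. -/
theorem intersectionRatio_eq (hk : 3 ≤ k) (hρ : 0 < ρ) {s v : Plane} {r : ℝ} (i : ℤ)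
    (hs : ∀ j, nrm k θ j (s - c) < ρ * cos (π / k))
    (hv : ρ * cos (π / k) < nrm k θ i (v - c))
    (hv' : ∀ j, edge k c ρ θ j ≠ edge k c ρ θ i → nrm k θ j (v - c) < ρ * cos (π / k))
    (h : HasIntersectionRatio (poly k c ρ θ) s v r) : 0 < r ∧ r < 1 ∧
      r * (nrm k θ i (v - c) - ρ * cos (π / k)) =
        (1 - r) * (ρ * cos (π / k) - nrm k θ i (s - c)) := by
  obtain ⟨q, ⟨hq, hqf⟩, hd⟩ := h
  rw [segment_eq_image'] at hq
  obtain ⟨t, ⟨ht0, ht1⟩, rfl⟩ := hq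
  have hsv : s ≠ v := by
    rintro rfl
    exact lt_asymm (hs i) hv
  have htr : t = r := by
    have hd' : 0 < dist s v := dist_pos.2 hsv
    have : dist s (s + t • (v - s)) = t * dist s v := by
      rw [dist_eq_norm, dist_eq_norm, sub_add_cancel_left, norm_neg, norm_smul, norm_sub_rev v s,
        Real.norm_of_nonneg ht0]
    exact mul_right_cancel₀ hd'.ne' (this.symm.trans hd)
  subst htr
  obtain ⟨j, hj⟩ := exists_of_mem_frontier hk hρ hqf
  have hval : ∀ j, nrm k θ j (s + t • (v - s) - c) =
      (1 - t) * nrm k θ j (s - c) + t * nrm k θ j (v - c) := by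
    intro j
    simp only [map_sub, map_add, map_smul, smul_eq_mul]
    ring
  -- `s` is strictly inside every edge line and `v` inside all but that of edge `i`, so the segment
  -- can leave only through edge `i`.
  have hji : edge k c ρ θ j = edge k c ρ θ i := by
    by_contra hne
    have h1 := hj.2
    have h2 := hs j
    have h3 := hv' j hne
    rw [hval] at h1
    rcases ht0.eq_or_lt with rfl | ht0
    · simp only [sub_zero, one_mul, zero_mul, add_zero] at h1; linarith
    · nlinarith [mul_pos ht0 (sub_pos.2 h3), mul_nonneg (sub_nonneg.2 ht1) (sub_pos.2 h2).le]
  rw [hji] at hj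
  have h1 := hj.2
  rw [hval] at h1
  have h2 := hs i
  have h3 : t ≠ 0 := by
    rintro rfl
    simp only [sub_zero, one_mul, zero_mul, add_zero] at h1; linarith
  have h4 : t ≠ 1 := by
    rintro rfl
    simp only [sub_self, one_mul, zero_mul, zero_add] at h1; linarith
  exact ⟨lt_of_le_of_ne ht0 (Ne.symm h3), lt_of_le_of_ne ht1 h4, by linarith⟩

/-- Summing the ratio identities over all edges eliminates `s`, since the normals sum to zero, and
leaves the total height, which `sum_height_le` bounds. -/
theorem cos_sq_le_of_ratio (hk : 3 ≤ k) (hρ : 0 < ρ) {C : Plane} {R ϑ : ℝ} (hR : 0 < R)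
    {p : Set Plane → Plane}
    (h : IsVertexPreservingRealisation (poly k c ρ θ) (poly k C R ϑ) p) {s : Plane} {r : ℝ}
    (hr0 : 0 < r)
    (hs : ∀ i, r * (nrm k θ i (p (edge k c ρ θ i) - c) - ρ * cos (π / k)) =
        (1 - r) * (ρ * cos (π / k) - nrm k θ i (s - c))) :
    (1 - r) * cos (π / k) ^ 2 ≤ r * sin (π / k) ^ 2 := by
  have h1 := sum_height_le hk hρ hR h
  have h2 : r * ∑ i : Fin k, (nrm k θ ((i : ℕ) : ℤ) (p (edge k c ρ θ ((i : ℕ) : ℤ)) - c) -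
      ρ * cos (π / k)) = (1 - r) * (k * (ρ * cos (π / k))) := by
    rw [Finset.mul_sum, Finset.sum_congr rfl fun i _ => hs _, ← Finset.mul_sum,
      Finset.sum_sub_distrib, sum_nrm hk]
    simp
  have hk' : (0 : ℝ) < k * ρ := by positivity
  refine le_of_mul_le_mul_left ?_ hk'
  calc k * ρ * ((1 - r) * cos (π / k) ^ 2) =
        ((1 - r) * (k * (ρ * cos (π / k)))) * cos (π / k) := by ring
    _ = r * ((∑ i : Fin k, (nrm k θ ((i : ℕ) : ℤ) (p (edge k c ρ θ ((i : ℕ) : ℤ)) - c) -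
      ρ * cos (π / k))) * cos (π / k)) := by rw [← h2]; ring
    _ ≤ r * (k * (ρ * sin (π / k) ^ 2)) := by gcongr
    _ = _ := by ring

theorem exists_eq_smul_nrm (hk : 3 ≤ k) (hρ : 0 < ρ) {l : Plane →L[ℝ] ℝ} {i : ℤ}
    (h : edge k c ρ θ i ⊆ l.toExposed (poly k c ρ θ)) : ∃ a : ℝ, l = a • nrm k θ i := by
  rcases toExposed_cases (c := c) (θ := θ) hk hρ l with rfl | ⟨j, hj⟩ | ⟨j, a, ha, rfl⟩
  · exact ⟨0, by simp⟩
  · exfalso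
    rw [hj] at h
    have h1 := (h (vert_mem_edge hk hρ i)).trans (h (vert_mem_edge' hk hρ i)).symm
    rw [vert_eq_iff hk hρ] at h1
    exact not_dvd_of_lt hk (by simp) (by norm_num [abs_lt]) h1
  · rw [toExposed_smul _ ha, toExposed_nrm hk hρ] at h
    have := eq_of_polyDim_le (isExposed_edge hk hρ i) (Set.sep_subset _ _) h
      (by change polyDim (edge k c ρ θ j) ≤ _; rw [polyDim_edge hk hρ, polyDim_edge hk hρ])
    change edge k c ρ θ i = edge k c ρ θ j at this
    rw [edge_eq_iff hk hρ] at this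
    exact ⟨a, by rw [nrm_of_dvd hk this]⟩

theorem half_le_of_cos_mul_cos_le {m n : ℕ} (hm : 3 ≤ m) (hn : 3 ≤ n)
    (h : cos (π / m) * cos (π / n) ≤ sin (π / m) * sin (π / n)) :
    (1 : ℝ) / 2 ≤ 1 / (m : ℝ) + 1 / (n : ℝ) := by
  by_contra! hlt
  have h1 : 0 < cos (π / m + π / n) := by
    have := pi_div_pos hm
    have := pi_div_pos hn
    apply cos_pos_of_mem_Ioo
    constructor
    · linarith [pi_pos]
    · have := mul_lt_mul_of_pos_left hlt pi_pos
      calc π / m + π / n = π * (1 / m + 1 / n) := by ring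
        _ < π * (1 / 2) := this
        _ = π / 2 := by ring
  rw [cos_add] at h1
  linarith

/-- The outer functionals of the edges, evaluated at the components of the new vertices beyond the
facets of a product of regular polygons. -/
theorem nrm_lt_of_isBeyond_prod {m n : ℕ} (hm : 3 ≤ m) (hn : 3 ≤ n) {c₀ c₁ : Plane}
    {ρ₀ ρ₁ θ₀ θ₁ : ℝ} (hρ₀ : 0 < ρ₀) (hρ₁ : 0 < ρ₁) {F : Set (Plane × Plane)} {x : Plane × Plane}
    (h : IsBeyond (poly m c₀ ρ₀ θ₀ ×ˢ poly n c₁ ρ₁ θ₁) F x) {j : ℤ}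
    (hj : edge m c₀ ρ₀ θ₀ j ×ˢ poly n c₁ ρ₁ θ₁ ≠ F) :
    nrm m θ₀ j (x.1 - c₀) < ρ₀ * cos (π / m) := by
  have hF : IsFacet (poly m c₀ ρ₀ θ₀ ×ˢ poly n c₁ ρ₁ θ₁)
      (edge m c₀ ρ₀ θ₀ j ×ˢ poly n c₁ ρ₁ θ₁) :=
    (isFacet_prod_iff hm hn hρ₀ hρ₁).2 (Or.inl ⟨j, rfl⟩)
  have h1 := vert_mem_edge (c := c₀) (θ := θ₀) hm hρ₀ j
  have h2 := (h _ hF ((nrm m θ₀ j).comp (.fst ℝ Plane Plane)) (by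
    rw [toExposed_prod]
    congr 1
    · rw [← toExposed_nrm hm hρ₀]; rfl
    · ext y; simp [ContinuousLinearMap.toExposed]) (vert m c₀ ρ₀ θ₀ j, vert n c₁ ρ₁ θ₁ 0)
    ⟨h1, vert_mem_poly 0⟩).2 hj
  change nrm m θ₀ j x.1 < nrm m θ₀ j (vert m c₀ ρ₀ θ₀ j) at h2
  rw [← h1.2, map_sub, map_sub]
  linarith

theorem nrm_lt_of_isBeyond_prod' {m n : ℕ} (hm : 3 ≤ m) (hn : 3 ≤ n) {c₀ c₁ : Plane}
    {ρ₀ ρ₁ θ₀ θ₁ : ℝ} (hρ₀ : 0 < ρ₀) (hρ₁ : 0 < ρ₁) {F : Set (Plane × Plane)} {x : Plane × Plane}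
    (h : IsBeyond (poly m c₀ ρ₀ θ₀ ×ˢ poly n c₁ ρ₁ θ₁) F x) {j : ℤ}
    (hj : poly m c₀ ρ₀ θ₀ ×ˢ edge n c₁ ρ₁ θ₁ j ≠ F) :
    nrm n θ₁ j (x.2 - c₁) < ρ₁ * cos (π / n) := by
  have hF : IsFacet (poly m c₀ ρ₀ θ₀ ×ˢ poly n c₁ ρ₁ θ₁)
      (poly m c₀ ρ₀ θ₀ ×ˢ edge n c₁ ρ₁ θ₁ j) :=
    (isFacet_prod_iff hm hn hρ₀ hρ₁).2 (Or.inr ⟨j, rfl⟩)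
  have h1 := vert_mem_edge (c := c₁) (θ := θ₁) hn hρ₁ j
  have h2 := (h _ hF ((nrm n θ₁ j).comp (.snd ℝ Plane Plane)) (by
    rw [toExposed_prod]
    congr 1
    · ext y; simp [ContinuousLinearMap.toExposed]
    · rw [← toExposed_nrm hn hρ₁]; rfl) (vert m c₀ ρ₀ θ₀ 0, vert n c₁ ρ₁ θ₁ j)
    ⟨vert_mem_poly 0, h1⟩).2 hj
  change nrm n θ₁ j x.2 < nrm n θ₁ j (vert n c₁ ρ₁ θ₁ j) at h2
  rw [← h1.2, map_sub, map_sub]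
  linarith

theorem edge_prod_ne {m n : ℕ} (hm : 3 ≤ m) {c₀ c₁ : Plane}
    {ρ₀ ρ₁ θ₀ θ₁ : ℝ} (hρ₀ : 0 < ρ₀) (i j : ℤ) :
    edge m c₀ ρ₀ θ₀ i ×ˢ poly n c₁ ρ₁ θ₁ ≠ poly m c₀ ρ₀ θ₀ ×ˢ edge n c₁ ρ₁ θ₁ j := by
  intro h
  refine (edge_ssubset_poly (c := c₀) (θ := θ₀) hm hρ₀ i).ne ?_
  have hne : (edge m c₀ ρ₀ θ₀ i ×ˢ poly n c₁ ρ₁ θ₁).Nonempty :=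
    (nonempty_edge hm hρ₀ i).prod nonempty_poly
  exact ((Set.prod_eq_prod_iff_of_nonempty hne).1 h).1

theorem convexHull_extremePoints_prod {m n : ℕ} (hm : 3 ≤ m) (hn : 3 ≤ n) {c₀ c₁ : Plane}
    {ρ₀ ρ₁ θ₀ θ₁ : ℝ} (hρ₀ : 0 < ρ₀) (hρ₁ : 0 < ρ₁) :
    convexHull ℝ ((poly m c₀ ρ₀ θ₀ ×ˢ poly n c₁ ρ₁ θ₁).extremePoints ℝ) =
      poly m c₀ ρ₀ θ₀ ×ˢ poly n c₁ ρ₁ θ₁ := by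
  rw [extremePoints_prod, extremePoints_poly hm hρ₀, extremePoints_poly hn hρ₁, convexHull_prod]
  rfl

/-- The intersection ratios of a realisation over a product of polygons add up to one. -/
theorem mul_eq_of_ratios {m n : ℕ} (hm : 3 ≤ m) (hn : 3 ≤ n) {c₀ c₁ : Plane}
    {ρ₀ ρ₁ θ₀ θ₁ : ℝ} (hρ₀ : 0 < ρ₀) (hρ₁ : 0 < ρ₁) {Q : Set (Plane × Plane)}
    {p : Set (Plane × Plane) → Plane × Plane}
    (h : IsVertexPreservingRealisation (poly m c₀ ρ₀ θ₀ ×ˢ poly n c₁ ρ₁ θ₁) Q p)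
    {b₀ d₀ b₁ d₁ : ℝ} (hb₁ : 0 < b₁) {i j : ℤ}
    (e1 : nrm m θ₀ i ((p (edge m c₀ ρ₀ θ₀ i ×ˢ poly n c₁ ρ₁ θ₁)).1 - c₀) =
      ρ₀ * cos (π / m) + b₀)
    (e2 : nrm m θ₀ i ((p (poly m c₀ ρ₀ θ₀ ×ˢ edge n c₁ ρ₁ θ₁ j)).1 - c₀) =
      ρ₀ * cos (π / m) - d₀)
    (e3 : nrm n θ₁ j ((p (poly m c₀ ρ₀ θ₀ ×ˢ edge n c₁ ρ₁ θ₁ j)).2 - c₁) =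
      ρ₁ * cos (π / n) + b₁)
    (e4 : nrm n θ₁ j ((p (edge m c₀ ρ₀ θ₀ i ×ˢ poly n c₁ ρ₁ θ₁)).2 - c₁) =
      ρ₁ * cos (π / n) - d₁) : d₀ * d₁ = b₀ * b₁ := by
  have hR : IsRidge (poly m c₀ ρ₀ θ₀ ×ˢ poly n c₁ ρ₁ θ₁)
      (edge m c₀ ρ₀ θ₀ i ×ˢ edge n c₁ ρ₁ θ₁ j) :=
    (isRidge_prod_iff hm hn hρ₀ hρ₁).2 (Or.inr (Or.inr ⟨i, j, rfl⟩))
  have hF0 : IsFacet (poly m c₀ ρ₀ θ₀ ×ˢ poly n c₁ ρ₁ θ₁)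
      (edge m c₀ ρ₀ θ₀ i ×ˢ poly n c₁ ρ₁ θ₁) :=
    (isFacet_prod_iff hm hn hρ₀ hρ₁).2 (Or.inl ⟨i, rfl⟩)
  have hF1 : IsFacet (poly m c₀ ρ₀ θ₀ ×ˢ poly n c₁ ρ₁ θ₁)
      (poly m c₀ ρ₀ θ₀ ×ˢ edge n c₁ ρ₁ θ₁ j) :=
    (isFacet_prod_iff hm hn hρ₀ hρ₁).2 (Or.inr ⟨j, rfl⟩)
  have hx := vert_mem_edge (c := c₀) (θ := θ₀) hm hρ₀ i
  have hy := vert_mem_edge (c := c₁) (θ := θ₁) hn hρ₁ j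
  obtain ⟨l, hl, hlQ⟩ := h.exists_functional hR ⟨(_, _), hx, hy⟩
  have hmR : ∀ x ∈ edge m c₀ ρ₀ θ₀ i ×ˢ edge n c₁ ρ₁ θ₁ j, x ∈ l.toExposed Q := fun x hx => by
    rw [hl]; exact subset_convexHull ℝ _ (Or.inl hx)
  have hm0 : p (edge m c₀ ρ₀ θ₀ i ×ˢ poly n c₁ ρ₁ θ₁) ∈ l.toExposed Q := by
    rw [hl]
    exact subset_convexHull ℝ _
      (Or.inr ⟨_, ⟨hF0, Set.prod_mono subset_rfl (Set.sep_subset _ _)⟩, rfl⟩)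
  have hm1 : p (poly m c₀ ρ₀ θ₀ ×ˢ edge n c₁ ρ₁ θ₁ j) ∈ l.toExposed Q := by
    rw [hl]
    exact subset_convexHull ℝ _
      (Or.inr ⟨_, ⟨hF1, Set.prod_mono (Set.sep_subset _ _) subset_rfl⟩, rfl⟩)
  have hPQ : poly m c₀ ρ₀ θ₀ ×ˢ poly n c₁ ρ₁ θ₁ ⊆ Q := by
    rw [h.hull]
    exact (convexHull_extremePoints_prod hm hn hρ₀ hρ₁).superset.trans
      (convexHull_mono Set.subset_union_left)
  have hPR : edge m c₀ ρ₀ θ₀ i ×ˢ edge n c₁ ρ₁ θ₁ j ⊆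
      l.toExposed (poly m c₀ ρ₀ θ₀ ×ˢ poly n c₁ ρ₁ θ₁) := fun x hx =>
    ⟨hR.1.subset hx, fun y hy => (hmR x hx).2 y (hPQ hy)⟩
  -- On the product, `l` is maximal on edge × edge; each component is therefore maximal on a whole
  -- edge and proportional to its normal.
  rw [toExposed_prod] at hPR
  obtain ⟨a, ha⟩ := exists_eq_smul_nrm hm hρ₀ fun x hx' => (hPR (Set.mk_mem_prod hx' hy)).1
  obtain ⟨b, hb⟩ := exists_eq_smul_nrm hn hρ₁ fun y hy' => (hPR (Set.mk_mem_prod hx hy')).2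
  have hval : ∀ x : Plane × Plane, l x = a * nrm m θ₀ i (x.1 - c₀) +
      b * nrm n θ₁ j (x.2 - c₁) + (a * nrm m θ₀ i c₀ + b * nrm n θ₁ j c₁) := by
    intro x
    have h1 := DFunLike.congr_fun ha x.1
    have h2 := DFunLike.congr_fun hb x.2
    have h3 : l x = l (x.1, 0) + l (0, x.2) := by rw [← map_add]; simp
    simp only [ContinuousLinearMap.comp_apply, ContinuousLinearMap.inl_apply,
      ContinuousLinearMap.inr_apply, smul_apply, smul_eq_mul] at h1 h2
    rw [h3, h1, h2, map_sub, map_sub]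
    ring
  have heq : ∀ x ∈ l.toExposed Q, ∀ y ∈ l.toExposed Q, l x = l y := fun x hx y hy =>
    le_antisymm (hy.2 x hx.1) (hx.2 y hy.1)
  have hv := hmR (vert m c₀ ρ₀ θ₀ i, vert n c₁ ρ₁ θ₁ j) ⟨hx, hy⟩
  have q1 := heq _ hm0 _ hv
  have q2 := heq _ hm1 _ hv
  rw [hval, hval (vert m c₀ ρ₀ θ₀ i, _), e1, e4, hx.2, hy.2] at q1
  rw [hval, hval (vert m c₀ ρ₀ θ₀ i, _), e2, e3, hx.2, hy.2] at q2
  -- The two apexes have the same `l`-value as the ridge; eliminating `a` and `b` from the two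
  -- equations gives the claim.
  have q1' : a * b₀ = b * d₁ := by linarith
  have q2' : b * b₁ = a * d₀ := by linarith
  -- Otherwise `b` vanishes too, and the constant `l` exposes all of `Q`.
  have ha0 : a ≠ 0 := by
    rintro rfl
    have hb0 : b = 0 := by
      rcases mul_eq_zero.1 (show b * b₁ = 0 by linarith) with h | h
      · exact h
      · exact absurd h hb₁.ne'
    refine hlQ (Set.Subset.antisymm (fun x hx => hx.1) fun x hx => ⟨hx, fun y _ => ?_⟩)
    rw [hval, hval x, hb0]
    simp
  refine mul_left_cancel₀ ha0 ?_
  calc a * (d₀ * d₁) = (a * d₀) * d₁ := by ring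
    _ = (b * d₁) * b₁ := by rw [← q2']; ring
    _ = a * (b₀ * b₁) := by rw [← q1']; ring

theorem half_le_of_realisation {m n : ℕ} (hm : 3 ≤ m) (hn : 3 ≤ n) {P₀ P₁ : Set Plane}
    {Q : Set (Plane × Plane)} {p : Set (Plane × Plane) → Plane × Plane}
    (hP₀ : IsRegularPolygon m P₀) (hP₁ : IsRegularPolygon n P₁)
    (h : IsVertexPreservingRealisation (P₀ ×ˢ P₁) Q p)
    (h₀ : IsVertexPreservingRealisation P₀ (Prod.fst '' Q) (fun F₀ => (p (F₀ ×ˢ P₁)).1))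
    (h₁ : IsVertexPreservingRealisation P₁ (Prod.snd '' Q) (fun F₁ => (p (P₀ ×ˢ F₁)).2))
    (hQ₀ : IsRegularPolygon m (Prod.fst '' Q)) (hQ₁ : IsRegularPolygon n (Prod.snd '' Q))
    {r₀ r₁ : ℝ} (hr₀ : ∀ F₀ F₁, IsFacet P₀ F₀ → IsFacet P₁ F₁ →
      HasIntersectionRatio P₀ (p (P₀ ×ˢ F₁)).1 (p (F₀ ×ˢ P₁)).1 r₀)
    (hr₁ : ∀ F₀ F₁, IsFacet P₀ F₀ → IsFacet P₁ F₁ →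
      HasIntersectionRatio P₁ (p (F₀ ×ˢ P₁)).2 (p (P₀ ×ˢ F₁)).2 r₁) :
    (1 : ℝ) / 2 ≤ 1 / (m : ℝ) + 1 / (n : ℝ) := by
  obtain ⟨c₀, ρ₀, θ₀, hρ₀, rfl⟩ := (isRegularPolygon_iff hm _).1 hP₀
  obtain ⟨c₁, ρ₁, θ₁, hρ₁, rfl⟩ := (isRegularPolygon_iff hn _).1 hP₁
  obtain ⟨C₀, R₀, ϑ₀, hR₀, hQ₀⟩ := (isRegularPolygon_iff hm _).1 hQ₀
  obtain ⟨C₁, R₁, ϑ₁, hR₁, hQ₁⟩ := (isRegularPolygon_iff hn _).1 hQ₁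
  rw [hQ₀] at h₀
  rw [hQ₁] at h₁
  have hF0 : ∀ i, IsFacet (poly m c₀ ρ₀ θ₀ ×ˢ poly n c₁ ρ₁ θ₁)
      (edge m c₀ ρ₀ θ₀ i ×ˢ poly n c₁ ρ₁ θ₁) := fun i =>
    (isFacet_prod_iff hm hn hρ₀ hρ₁).2 (Or.inl ⟨i, rfl⟩)
  have hF1 : ∀ j, IsFacet (poly m c₀ ρ₀ θ₀ ×ˢ poly n c₁ ρ₁ θ₁)
      (poly m c₀ ρ₀ θ₀ ×ˢ edge n c₁ ρ₁ θ₁ j) := fun j =>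
    (isFacet_prod_iff hm hn hρ₀ hρ₁).2 (Or.inr ⟨j, rfl⟩)
  have hv0 := fun i => lt_nrm_of_isBeyond hm hρ₀ (h₀.beyond _ (isFacet_edge hm hρ₀ i))
  have hv1 := fun i => lt_nrm_of_isBeyond hn hρ₁ (h₁.beyond _ (isFacet_edge hn hρ₁ i))
  -- A single apex over the other factor serves as starting point for all edges. Its projection is
  -- strictly inside `P₀`, because a point beyond `P₀ × F₁` satisfies strictly the inequalities of
  -- all facets `F₀ × P₁`.
  have k0 := fun i => intersectionRatio_eq hm hρ₀ i
    (fun j => nrm_lt_of_isBeyond_prod hm hn hρ₀ hρ₁ (h.beyond _ (hF1 0))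
      (edge_prod_ne hm hρ₀ j 0)) (hv0 i)
    (fun j hj => nrm_lt_of_isBeyond hm hρ₀ (h₀.beyond _ (isFacet_edge hm hρ₀ i)) hj)
    (hr₀ _ _ (isFacet_edge hm hρ₀ i) (isFacet_edge hn hρ₁ 0))
  have k1 := fun i => intersectionRatio_eq hn hρ₁ i
    (fun j => nrm_lt_of_isBeyond_prod' hm hn hρ₀ hρ₁ (h.beyond _ (hF0 0))
      (edge_prod_ne hm hρ₀ 0 j).symm) (hv1 i)
    (fun j hj => nrm_lt_of_isBeyond hn hρ₁ (h₁.beyond _ (isFacet_edge hn hρ₁ i)) hj)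
    (hr₁ _ _ (isFacet_edge hm hρ₀ 0) (isFacet_edge hn hρ₁ i))
  obtain ⟨r0p, r0l, f0⟩ := k0 0
  obtain ⟨r1p, r1l, f1⟩ := k1 0
  have g0 := cos_sq_le_of_ratio hm hρ₀ hR₀ h₀ r0p fun i => (k0 i).2.2
  have g1 := cos_sq_le_of_ratio hn hρ₁ hR₁ h₁ r1p fun i => (k1 i).2.2
  have w0 := sub_pos.2 (hv0 0)
  have w1 := sub_pos.2 (hv1 0)
  have key := mul_eq_of_ratios hm hn hρ₀ hρ₁ h w1 (i := 0) (j := 0)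
    (b₀ := nrm m θ₀ 0 ((p (edge m c₀ ρ₀ θ₀ 0 ×ˢ poly n c₁ ρ₁ θ₁)).1 - c₀) - ρ₀ * cos (π / m))
    (d₀ := ρ₀ * cos (π / m) - nrm m θ₀ 0 ((p (poly m c₀ ρ₀ θ₀ ×ˢ edge n c₁ ρ₁ θ₁ 0)).1 - c₀))
    (d₁ := ρ₁ * cos (π / n) - nrm n θ₁ 0 ((p (edge m c₀ ρ₀ θ₀ 0 ×ˢ poly n c₁ ρ₁ θ₁)).2 - c₁))
    (by ring) (by ring) (by ring) (by ring)
  set b₀ := nrm m θ₀ 0 ((p (edge m c₀ ρ₀ θ₀ 0 ×ˢ poly n c₁ ρ₁ θ₁)).1 - c₀) - ρ₀ * cos (π / m)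
  set b₁ := nrm n θ₁ 0 ((p (poly m c₀ ρ₀ θ₀ ×ˢ edge n c₁ ρ₁ θ₁ 0)).2 - c₁) - ρ₁ * cos (π / n)
  set d₀ := ρ₀ * cos (π / m) - nrm m θ₀ 0 ((p (poly m c₀ ρ₀ θ₀ ×ˢ edge n c₁ ρ₁ θ₁ 0)).1 - c₀)
  set d₁ := ρ₁ * cos (π / n) - nrm n θ₁ 0 ((p (edge m c₀ ρ₀ θ₀ 0 ×ˢ poly n c₁ ρ₁ θ₁)).2 - c₁)
  -- Equivalent to `r₀ + r₁ = 1`; the product form is what the multiplied inequalities need.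
  have hrr : r₀ * r₁ = (1 - r₀) * (1 - r₁) := by
    refine mul_right_cancel₀ (mul_pos w0 w1).ne' ?_
    calc r₀ * r₁ * (b₀ * b₁) = (r₀ * b₀) * (r₁ * b₁) := by ring
      _ = (1 - r₀) * (1 - r₁) * (d₀ * d₁) := by rw [f0, f1]; ring
      _ = _ := by rw [key]
  apply half_le_of_cos_mul_cos_le hm hn
  have p1 := cos_pi_div_pos hm
  have p2 := cos_pi_div_pos hn
  have p3 := sin_pi_div_pos hm
  have p4 := sin_pi_div_pos hn
  have hsq : (cos (π / m) * cos (π / n)) ^ 2 ≤ (sin (π / m) * sin (π / n)) ^ 2 := by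
    refine le_of_mul_le_mul_left ?_ (mul_pos r0p r1p)
    calc r₀ * r₁ * (cos (π / m) * cos (π / n)) ^ 2
        = ((1 - r₀) * cos (π / m) ^ 2) * ((1 - r₁) * cos (π / n) ^ 2) := by rw [hrr]; ring
      _ ≤ (r₀ * sin (π / m) ^ 2) * (r₁ * sin (π / n) ^ 2) := by
          apply mul_le_mul g0 g1
          · exact mul_nonneg (by linarith) (by positivity)
          · positivity
      _ = _ := by ring
  exact (pow_le_pow_iff_left₀ (by positivity) (by positivity) two_ne_zero).1 hsq

end Necessity

end EPolytope

namespace EPolytope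

/-! ### Nested pairs of regular polygons -/

section Nested

open Real

/-- A polygon with vertices `v` circumscribed about the standard regular `k`-gon, described by
normalized functionals: `n i = κ` is the line of an edge of the inner polygon, and `N i = 1` is the
line of the edge of the outer polygon through a vertex of the inner one. -/
structure IsNested (k : ℕ) (v : ℤ → Plane) (n N : ℤ → Plane →L[ℝ] ℝ) (κ : ℝ) : Prop where
  pos : 0 < κ
  v_congr : ∀ i j, (k : ℤ) ∣ i - j → v i = v j
  n_congr : ∀ i j, (k : ℤ) ∣ i - j → n i = n j
  N_congr : ∀ i j, (k : ℤ) ∣ i - j → N i = N j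
  n_w_le : ∀ i j, n i (vert k 0 1 0 j) ≤ κ
  n_w_eq : ∀ i j, n i (vert k 0 1 0 j) = κ ↔ vert k 0 1 0 j ∈ edge k 0 1 0 i
  n_v_le : ∀ i j, n i (v j) ≤ 1
  n_v_eq : ∀ i j, n i (v j) = 1 ↔ (k : ℤ) ∣ j - i
  N_w_le : ∀ i j, N i (vert k 0 1 0 j) ≤ 1
  N_w_eq : ∀ i j, N i (vert k 0 1 0 j) = 1 ↔ (k : ℤ) ∣ j - i
  N_v_le : ∀ i j, N i (v j) ≤ 1
  N_v_eq : ∀ i j, N i (v j) = 1 ↔ vert k 0 1 0 i ∈ edge k 0 1 0 j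
  w_mem : ∀ i, vert k 0 1 0 i ∈ convexHull ℝ (Set.range v)
  n_comb : ∀ i, ∃ x y : ℝ, 0 ≤ x ∧ 0 ≤ y ∧ n i = x • N i + y • N (i + 1)
  fan_outer : ∀ l : Plane →L[ℝ] ℝ, ∃ (i : ℤ) (a b : ℝ), 0 ≤ a ∧ 0 ≤ b ∧
    l = a • N i + b • N (i + 1)
  fan : ∀ l : Plane →L[ℝ] ℝ, ∃ (i i' j : ℤ) (a b s t : ℝ), 0 ≤ a ∧ 0 ≤ b ∧ 0 ≤ s ∧ 0 ≤ t ∧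
    0 < s + t ∧ l = a • n i + b • N j ∧ N j = s • n i + t • n i' ∧
    vert k 0 1 0 j ∈ edge k 0 1 0 i ∧ vert k 0 1 0 j ∈ edge k 0 1 0 i'
  nrm_eq : ∃ h : ℝ, 0 < h ∧ κ * h = cos (π / k) ∧ ∀ i, nrm k 0 i = h • n i
  lt_nrm : ∀ i j, (k : ℤ) ∣ j - i → cos (π / k) < nrm k 0 i (v j)
  nrm_lt : ∀ i j, ¬ (k : ℤ) ∣ j - i → nrm k 0 i (v j) < cos (π / k)

variable {k : ℕ}

theorem dirL_vert_zero (s ρ θ : ℝ) (j : ℤ) :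
    dirL s (vert k 0 ρ θ j) = ρ * cos (ang k θ j - s) := by
  rw [← dirL_vert (c := 0), sub_zero]

theorem cos_pi_div_lt (hk : 3 ≤ k) {φ : ℝ} (hφ : |φ| < π / k) : cos (π / k) < cos φ := by
  rw [← cos_abs φ]
  have := pi_div_le hk
  exact cos_lt_cos_of_nonneg_of_le_pi (abs_nonneg _) (by linarith [pi_pos]) hφ

theorem sin_smul_dirL_add (τ β δ : ℝ) :
    sin τ • dirL (β + δ) = sin (τ - δ) • dirL β + sin δ • dirL (β + τ) := by
  ext x
  have := congrArg (fun y => inner ℝ y x) (sin_smul_dir_add τ β δ)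
  simp only [inner_add_left, inner_smul_left] at this
  simpa [dirL] using this

/-- The product is the mean of cos (2πd/k + 2φ), which is below 1, and cos (2πd/k), which is at most
cos (2π/k); and cos² (π/k) is the mean of 1 and cos (2π/k). It keeps a new vertex strictly inside
the lines of all edges but its own. -/
theorem cos_mul_cos_rotate_lt (hk : 3 ≤ k) {φ : ℝ} (hφ : |φ| < π / k) {d : ℤ}
    (hd : ¬ (k : ℤ) ∣ d) : cos φ * cos (2 * π * d / k + φ) < cos (π / k) ^ 2 := by
  have h1 := cos_step_le hk hd
  have h2 : cos (2 * π * d / k + 2 * φ) < 1 := by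
    obtain ⟨r, h0, h1, hdr, hc⟩ := exists_reduced hk d
    have hr : 0 < r := lt_of_le_of_ne h0 fun h => hd (by rwa [← h, sub_zero] at hdr)
    obtain ⟨b1, b2⟩ := mul_div_bounds hk hr h1
    rw [abs_lt] at hφ
    have hs : 0 < sin (π * r / k + φ) := sin_pos_of_pos_of_lt_pi (by linarith) (by linarith)
    rw [hc, show 2 * π * r / k + 2 * φ = 2 * (π * r / k + φ) by ring, cos_two_mul, cos_sq']
    nlinarith [mul_pos hs hs]
  have h3 : cos (2 * π / k) = 2 * cos (π / k) ^ 2 - 1 := by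
    rw [← cos_two_mul]; congr 1; ring
  have h4 : cos φ * cos (2 * π * d / k + φ) =
      (cos (2 * π * d / k + 2 * φ) + cos (2 * π * d / k)) / 2 := by
    have e1 := cos_add (2 * π * d / k + φ) φ
    have e2 := cos_sub (2 * π * d / k + φ) φ
    rw [show 2 * π * d / k + φ + φ = 2 * π * d / k + 2 * φ by ring] at e1
    rw [show 2 * π * d / k + φ - φ = 2 * π * d / k by ring] at e2
    rw [e1, e2]; ring
  rw [h4]
  linarith

/-- An outer edge at distance cos φ from the origin, with normal turned by φ, passes through an
inner vertex; the outer vertices are then at distance cos φ / cos (π/k). The normal of an inner edge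
is cos² φ / cos (π/k) at the new vertex beyond it, which explains its scaling. The bound on φ makes
inner and outer normals interlace, so that each is a positive combination of its two neighbors. -/
theorem isNested_rotate (hk : 3 ≤ k) {φ : ℝ} (hφ : |φ| < π / k) :
    IsNested k (vert k 0 (cos φ / cos (π / k)) (π / k + φ))
      (fun i => (cos (π / k) / cos φ ^ 2) • nrm k 0 i)
      (fun i => (cos φ)⁻¹ • dirL (ang k φ i)) (cos (π / k) ^ 2 / cos φ ^ 2) := by
  have hc := cos_pi_div_pos hk
  have hcφ : 0 < cos φ := hc.trans (cos_pi_div_lt hk hφ)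
  have hlt := cos_pi_div_lt hk hφ
  have hφ' : |-φ| < π / k := by rwa [abs_neg]
  have hp := pi_div_pos hk
  have hp3 := pi_div_le hk
  have hab := abs_lt.1 hφ
  have q1 : ∀ A B X : ℝ, 0 < A → 0 < B → (A / B ^ 2 * X = A ^ 2 / B ^ 2 ↔ X = A) :=
    fun A B X hA hB => by
      rw [pow_two A, mul_div_right_comm, mul_right_inj' (by positivity)]
  have q2 : ∀ A B X : ℝ, 0 < A → 0 < B → (A / B ^ 2 * (B / A * X) = 1 ↔ X = B) :=
    fun A B X hA hB => by
      rw [show A / B ^ 2 * (B / A * X) = B⁻¹ * X by field_simp, inv_mul_eq_one₀ hB.ne', eq_comm]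
  have q3 : ∀ A B X : ℝ, 0 < A → 0 < B → (B⁻¹ * (B / A * X) = 1 ↔ X = A) :=
    fun A B X hA hB => by
      rw [show B⁻¹ * (B / A * X) = A⁻¹ * X by field_simp, inv_mul_eq_one₀ hA.ne', eq_comm]
  set A := cos (π / k)
  set B := cos φ
  have hnw : ∀ i j, nrm k 0 i (vert k 0 1 0 j) = nrm k 0 i (vert k 0 1 0 j - 0) := fun i j => by
    rw [sub_zero]
  have hnv : ∀ i j, nrm k 0 i (vert k 0 (B / A) (π / k + φ) j) =
      B / A * cos (2 * π * ((j - i : ℤ) : ℝ) / k + φ) := fun i j => by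
    rw [nrm, dirL_vert_zero, ang_sub]; congr 3; ring
  have hNw : ∀ i j, dirL (ang k φ i) (vert k 0 1 0 j) =
      cos (2 * π * ((j - i : ℤ) : ℝ) / k + -φ) := fun i j => by
    rw [dirL_vert_zero, ang_sub, one_mul]; congr 1; ring
  have hNv : ∀ i j, dirL (ang k φ i) (vert k 0 (B / A) (π / k + φ) j) =
      B / A * cos (2 * π * ((j - i + 1 : ℤ) : ℝ) / k - π / k) := fun i j => by
    rw [dirL_vert_zero, ang_sub]; congr 2; push_cast; ring
  have hsτ : 0 < sin (2 * (π / k)) := sin_pos_of_pos_of_lt_pi (by linarith) (by linarith [pi_pos])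
  have hs1 : 0 < sin (π / k - φ) := sin_pos_of_pos_of_lt_pi (by linarith) (by linarith [pi_pos])
  have hs2 : 0 < sin (π / k + φ) := sin_pos_of_pos_of_lt_pi (by linarith) (by linarith [pi_pos])
  -- the two interlacing systems of normals in terms of each other
  have hcomb : ∀ i, dirL (ang k φ (i + 1)) =
      (sin (π / k - φ) / sin (2 * (π / k))) • nrm k 0 i +
        (sin (π / k + φ) / sin (2 * (π / k))) • nrm k 0 (i + 1) := by
    intro i
    have := sin_smul_dirL_add (2 * (π / k)) (ang k (0 + π / k) i) (π / k + φ)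
    rw [show 2 * (π / k) - (π / k + φ) = π / k - φ by ring,
      show ang k (0 + π / k) i + (π / k + φ) = ang k φ (i + 1) by simp only [ang]; push_cast; ring,
      show ang k (0 + π / k) i + 2 * (π / k) = ang k (0 + π / k) (i + 1) by
        simp only [ang]; push_cast; ring] at this
    rw [nrm, nrm, ← one_smul ℝ (dirL (ang k φ (i + 1))), ← inv_mul_cancel₀ hsτ.ne', mul_smul, this]
    module
  have hcomb' : ∀ i, nrm k 0 i =
      (sin (π / k + φ) / sin (2 * (π / k))) • dirL (ang k φ i) +
        (sin (π / k - φ) / sin (2 * (π / k))) • dirL (ang k φ (i + 1)) := by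
    intro i
    have := sin_smul_dirL_add (2 * (π / k)) (ang k φ i) (π / k - φ)
    rw [show 2 * (π / k) - (π / k - φ) = π / k + φ by ring,
      show ang k φ i + (π / k - φ) = ang k (0 + π / k) i by simp only [ang]; ring,
      show ang k φ i + 2 * (π / k) = ang k φ (i + 1) by
        simp only [ang]; push_cast; ring] at this
    rw [nrm, ← one_smul ℝ (dirL (ang k (0 + π / k) i)), ← inv_mul_cancel₀ hsτ.ne', mul_smul, this]
    module
  set S := sin (π / k - φ) / sin (2 * (π / k))
  set T := sin (π / k + φ) / sin (2 * (π / k))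
  have hS : 0 < S := by positivity
  have hT : 0 < T := by positivity
  refine
    { pos := by positivity
      v_congr := fun i j h => vert_of_dvd hk h
      n_congr := fun i j h => by simp only [nrm_of_dvd hk h]
      N_congr := fun i j h => by simp only [dirL_ang_of_dvd hk φ h]
      n_w_le := fun i j => ?_
      n_w_eq := fun i j => ?_
      n_v_le := fun i j => ?_
      n_v_eq := fun i j => ?_
      N_w_le := fun i j => ?_
      N_w_eq := fun i j => ?_
      N_v_le := fun i j => ?_
      N_v_eq := fun i j => ?_
      w_mem := fun j => ?_
      n_comb := fun i => ?_
      fan_outer := fun l => ?_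
      fan := fun l => ?_
      nrm_eq := ⟨B ^ 2 / A, by positivity, show _ = A by field_simp, fun i => ?_⟩
      lt_nrm := fun i j h => ?_
      nrm_lt := fun i j h => ?_ }
  · have := nrm_vert_le (c := 0) (θ := 0) hk one_pos i j
    rw [one_mul] at this
    rw [smul_apply, smul_eq_mul, hnw, div_mul_eq_mul_div, pow_two A]
    gcongr
  · have := nrm_vert_eq_iff (c := 0) (θ := 0) hk one_pos i j
    rw [vert_mem_edge_iff hk one_pos, ← this, smul_apply, smul_eq_mul, hnw, one_mul]
    exact q1 _ _ _ hc hcφ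
  · have := (cos_rotate_le hk hφ (j - i)).1
    rw [smul_apply, smul_eq_mul, hnv]
    calc _ = B⁻¹ * cos (2 * π * ((j - i : ℤ) : ℝ) / k + φ) := by field_simp
      _ ≤ B⁻¹ * B := by gcongr
      _ = 1 := inv_mul_cancel₀ hcφ.ne'
  · rw [← (cos_rotate_le hk hφ (j - i)).2, smul_apply, smul_eq_mul, hnv]
    exact q2 _ _ _ hc hcφ
  · have := (cos_rotate_le hk hφ' (j - i)).1
    rw [cos_neg] at this
    rw [smul_apply, smul_eq_mul, hNw]
    calc _ ≤ B⁻¹ * B := by gcongr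
      _ = 1 := inv_mul_cancel₀ hcφ.ne'
  · have := (cos_rotate_le hk hφ' (j - i)).2
    rw [← this, smul_apply, smul_eq_mul, hNw, cos_neg, inv_mul_eq_one₀ hcφ.ne', eq_comm]
  · have := (cos_half_step_le hk (j - i + 1)).1
    rw [smul_apply, smul_eq_mul, hNv]
    calc _ ≤ B⁻¹ * (B / A * A) := by gcongr
      _ = 1 := by field_simp
  · have := (cos_half_step_le hk (j - i + 1)).2
    rw [smul_apply, smul_eq_mul, hNv, vert_mem_edge_iff hk one_pos]
    have e : (k : ℤ) ∣ i - j ∨ (k : ℤ) ∣ i - j - 1 ↔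
        (k : ℤ) ∣ j - i + 1 ∨ (k : ℤ) ∣ j - i + 1 - 1 := by
      rw [or_comm, ← dvd_neg, show -(i - j - 1) = j - i + 1 by ring, ← dvd_neg (b := i - j),
        show -(i - j) = j - i + 1 - 1 by ring]
    rw [e, ← this]
    exact q3 _ _ _ hc hcφ
  · change _ ∈ poly k 0 (B / A) (π / k + φ)
    rw [mem_poly_iff hk (by positivity)]
    intro i
    have := (cos_rotate_le hk hφ' (j - i - 1)).1
    rw [cos_neg] at this
    rw [sub_zero, nrm, dirL_vert_zero, ang_sub, one_mul]
    change _ ≤ B / A * A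
    rw [div_mul_cancel₀ _ hc.ne']
    refine le_trans (le_of_eq ?_) this
    congr 1
    push_cast
    ring
  · refine ⟨A / B ^ 2 * T * B, A / B ^ 2 * S * B, by positivity, by positivity, ?_⟩
    simp only [hcomb' i, smul_add, smul_smul]
    congr 2 <;> field_simp
  · obtain ⟨i, a, b, ha, hb, h⟩ := exists_sector_dual hk φ l
    refine ⟨i, a * B, b * B, by positivity, by positivity, ?_⟩
    simp only [smul_smul]
    rw [h]
    congr 2 <;> field_simp
  · obtain ⟨i, a, b, ha, hb, h⟩ := exists_sector_dual hk (0 + π / k) l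
    change l = a • nrm k 0 i + b • nrm k 0 (i + 1) at h
    have hm1 := vert_mem_edge' (c := 0) (θ := 0) hk one_pos i
    have hm2 := vert_mem_edge (c := 0) (θ := 0) hk one_pos (i + 1)
    -- The outer normal `i + 1` divides the cone of the edge normals `i` and `i + 1`; the comparison
    -- tells which half contains `l`.
    rcases le_total (a * T) (b * S) with hle | hle
    · refine ⟨i + 1, i, i + 1, (b - a * T / S) * (B ^ 2 / A), a / S * B, T * B / A, S * B / A, ?_,
        by positivity, by positivity, by positivity, by positivity, ?_, ?_, hm2, hm1⟩
      · have : a * T / S ≤ b := by rwa [div_le_iff₀ hS]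
        exact mul_nonneg (by linarith) (by positivity)
      · rw [h, hcomb]
        match_scalars <;> field_simp
        ring
      · rw [hcomb]
        match_scalars <;> field_simp
    · refine ⟨i, i + 1, i + 1, (a - b * S / T) * (B ^ 2 / A), b / T * B, S * B / A, T * B / A, ?_,
        by positivity, by positivity, by positivity, by positivity, ?_, ?_, hm1, hm2⟩
      · have : b * S / T ≤ a := by rwa [div_le_iff₀ hT]
        exact mul_nonneg (by linarith) (by positivity)
      · rw [h, hcomb]
        match_scalars <;> field_simp
        ring
      · rw [hcomb]
        match_scalars <;> field_simp
  · rw [smul_smul, show B ^ 2 / A * (A / B ^ 2) = 1 by field_simp, one_smul]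
  · rw [hnv, (cos_rotate_le hk hφ (j - i)).2.2 h]
    change A < B / A * B
    rw [div_mul_eq_mul_div, lt_div_iff₀ hc]
    nlinarith
  · have := cos_mul_cos_rotate_lt hk hφ h
    rw [hnv, div_mul_eq_mul_div, div_lt_iff₀ hc, ← pow_two]
    exact this

end Nested

end EPolytope

namespace EPolytope

/-! ### Sufficiency: the realisations in the factors -/

section Sufficiency

open Real

variable {k m n : ℕ} {c : Plane} {ρ θ : ℝ}

theorem edge_subset_edge_iff (hk : 3 ≤ k) (hρ : 0 < ρ) {i j : ℤ} :
    edge k c ρ θ i ⊆ edge k c ρ θ j ↔ (k : ℤ) ∣ i - j := by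
  rw [← edge_eq_iff (c := c) (θ := θ) hk hρ]
  exact ⟨fun h => eq_of_polyDim_le (isExposed_edge hk hρ i) (Set.sep_subset _ _) h
    (by rw [polyDim_edge hk hρ, polyDim_edge hk hρ]),
    fun h => h.subset⟩

theorem not_poly_subset_edge (hk : 3 ≤ k) (hρ : 0 < ρ) (i : ℤ) :
    ¬ poly k c ρ θ ⊆ edge k c ρ θ i := (edge_ssubset_poly hk hρ i).not_subset

theorem exists_pos_smul_nrm (hk : 3 ≤ k) (hρ : 0 < ρ) {l : Plane →L[ℝ] ℝ} {i : ℤ}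
    (h : l.toExposed (poly k c ρ θ) = edge k c ρ θ i) : ∃ a : ℝ, 0 < a ∧ l = a • nrm k θ i := by
  rcases toExposed_cases (c := c) (θ := θ) hk hρ l with rfl | ⟨j, hj⟩ | ⟨j, a, ha, rfl⟩
  · exfalso
    refine not_poly_subset_edge (c := c) (θ := θ) hk hρ i ?_
    rw [← h]
    exact fun x hx => ⟨hx, fun y _ => le_rfl⟩
  · exfalso
    have := polyDim_edge (c := c) (θ := θ) hk hρ i
    rw [← h, hj, polyDim_vert] at this
    exact zero_ne_one this
  · rw [toExposed_smul _ ha, toExposed_nrm hk hρ, edge_eq_iff hk hρ] at h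
    exact ⟨a, ha, by rw [nrm_of_dvd hk h]⟩

theorem eq_zero_of_toExposed_eq (hk : 3 ≤ k) (hρ : 0 < ρ) {l : Plane →L[ℝ] ℝ}
    (h : l.toExposed (poly k c ρ θ) = poly k c ρ θ) : l = 0 := by
  rcases toExposed_cases (c := c) (θ := θ) hk hρ l with h0 | ⟨j, hj⟩ | ⟨j, a, ha, rfl⟩
  · exact h0
  · exfalso
    have := polyDim_poly (c := c) (θ := θ) hk hρ
    rw [← h, hj, polyDim_vert] at this
    exact two_ne_zero this.symm
  · exfalso
    rw [toExposed_smul _ ha, toExposed_nrm hk hρ] at h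
    exact not_poly_subset_edge hk hρ j h.superset

/-- Any small step along the outer normal violates the inequality of the edge. -/
theorem mem_frontier_of_mem_edge {x : Plane} {i : ℤ} (hk : 3 ≤ k) (hρ : 0 < ρ)
    (hx : x ∈ edge k c ρ θ i) : x ∈ frontier (poly k c ρ θ) := by
  refine ⟨subset_closure hx.1, fun hint => ?_⟩
  set d := dir (ang k (θ + π / k) i)
  have hcont : ContinuousAt (fun t : ℝ => x + t • d) 0 := by fun_prop
  have hmem : ∀ᶠ t in nhds (0 : ℝ), x + t • d ∈ poly k c ρ θ := by
    apply hcont.eventually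
    simpa using mem_interior_iff_mem_nhds.1 hint
  obtain ⟨ε, hε, hball⟩ := Metric.eventually_nhds_iff.1 hmem
  have h1 := nrm_le hk hρ i (@hball (ε / 2) (by
    rw [dist_zero_right, Real.norm_of_nonneg (by positivity)]; linarith))
  have h2 : nrm k θ i d = 1 := by rw [nrm, dirL_dir, sub_self, cos_zero]
  rw [add_sub_right_comm, map_add, map_smul, h2, hx.2, smul_eq_mul, mul_one] at h1
  linarith

namespace IsNested

variable {v : ℤ → Plane} {u U : ℤ → Plane →L[ℝ] ℝ} {κ : ℝ}

theorem isBeyond (hN : IsNested k v u U κ) (hk : 3 ≤ k) (i : ℤ) :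
    IsBeyond (poly k 0 1 0) (edge k 0 1 0 i) (v i) := by
  intro G hG l hl g hg
  obtain ⟨j, rfl⟩ := (isFacet_poly_iff hk one_pos).1 hG
  obtain ⟨a, ha, rfl⟩ := exists_pos_smul_nrm hk one_pos hl.symm
  have hg2 := hg.2
  rw [sub_zero, one_mul] at hg2
  rw [Ne, edge_eq_iff hk one_pos, smul_apply, smul_apply, hg2, smul_eq_mul, smul_eq_mul]
  constructor
  · intro h
    exact mul_lt_mul_of_pos_left (hN.lt_nrm j i (by rwa [dvd_sub_comm])) ha
  · intro h
    exact mul_lt_mul_of_pos_left (hN.nrm_lt j i (by rwa [dvd_sub_comm])) ha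

theorem image_facets (hk : 3 ≤ k) {p : Set Plane → Plane}
    (hp : ∀ i, p (edge k 0 1 0 i) = v i) :
    p '' {F | IsFacet (poly k 0 1 0) F} = Set.range v := by
  ext x
  constructor
  · rintro ⟨F, hF, rfl⟩
    obtain ⟨i, rfl⟩ := (isFacet_poly_iff hk one_pos).1 hF
    exact ⟨i, (hp i).symm⟩
  · rintro ⟨i, rfl⟩
    exact ⟨_, isFacet_edge hk one_pos i, hp i⟩

theorem convexHull_union (hN : IsNested k v u U κ) :
    convexHull ℝ (Set.range (vert k 0 1 0) ∪ Set.range v) = convexHull ℝ (Set.range v) := by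
  apply Set.Subset.antisymm
  · refine convexHull_min (Set.union_subset ?_ (subset_convexHull ℝ _)) (convex_convexHull ℝ _)
    rintro _ ⟨i, rfl⟩
    exact hN.w_mem i
  · exact convexHull_mono Set.subset_union_right

/-- The circumscribed polygon realises the `E`-construction of the inner one. -/
theorem isVertexPreservingRealisation (hN : IsNested k v u U κ) (hk : 3 ≤ k)
    {p : Set Plane → Plane} (hp : ∀ i, p (edge k 0 1 0 i) = v i) :
    IsVertexPreservingRealisation (poly k 0 1 0) (convexHull ℝ (Set.range v)) p := by
  have hft : Function.FactorsThrough U fun i => ({vert k 0 1 0 i} : Set Plane) := by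
    intro i j h
    exact hN.N_congr i j ((vert_eq_iff hk one_pos).1 (Set.singleton_eq_singleton_iff.1 h))
  set f : Set Plane → Plane →L[ℝ] ℝ :=
    Function.extend (fun i => ({vert k 0 1 0 i} : Set Plane)) U 0
  have hf : ∀ i, f {vert k 0 1 0 i} = U i := fun i => hft.extend_apply 0 i
  have hext := extremePoints_poly (c := 0) (θ := 0) hk one_pos
  have hQ : convexHull ℝ ((poly k 0 1 0).extremePoints ℝ ∪ p '' {F | IsFacet (poly k 0 1 0) F}) =
      convexHull ℝ (Set.range v) := by
    rw [hext, image_facets hk hp, hN.convexHull_union]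
  have hsys : IsFacetSystem (poly k 0 1 0) p f := by
    refine ⟨?_, ?_, ?_, ?_, ?_⟩
    · intro R hR x hx
      obtain ⟨i, rfl⟩ := (isRidge_poly_iff hk one_pos).1 hR
      rw [hext] at hx
      obtain ⟨j, rfl⟩ := hx
      rw [hf]
      exact hN.N_w_le i j
    · intro R hR x hx
      obtain ⟨i, rfl⟩ := (isRidge_poly_iff hk one_pos).1 hR
      rw [hext] at hx
      obtain ⟨j, rfl⟩ := hx
      rw [hf, hN.N_w_eq, Set.mem_singleton_iff, vert_eq_iff hk one_pos]
    · intro R hR F hF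
      obtain ⟨i, rfl⟩ := (isRidge_poly_iff hk one_pos).1 hR
      obtain ⟨j, rfl⟩ := (isFacet_poly_iff hk one_pos).1 hF
      rw [hf, hp]
      exact hN.N_v_le i j
    · intro R hR F hF
      obtain ⟨i, rfl⟩ := (isRidge_poly_iff hk one_pos).1 hR
      obtain ⟨j, rfl⟩ := (isFacet_poly_iff hk one_pos).1 hF
      rw [hf, hp, hN.N_v_eq, Set.singleton_subset_iff]
    · intro l
      rw [hQ]
      obtain ⟨i, a, b, ha, hb, rfl⟩ := hN.fan_outer l
      have hsup : ∀ i, (U i) (v i) = 1 ∧ (U (i + 1)) (v i) = 1 := fun i => by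
        rw [hN.N_v_eq, hN.N_v_eq]
        exact ⟨vert_mem_edge hk one_pos i, vert_mem_edge' hk one_pos i⟩
      have hle : ∀ i, ∀ y ∈ convexHull ℝ (Set.range v), f {vert k 0 1 0 i} y ≤ 1 := by
        intro i y hy
        refine le_of_mem_convexHull _ ?_ hy
        rintro _ ⟨j, rfl⟩
        rw [hf]
        exact hN.N_v_le i j
      have hr : ∀ i, {vert k 0 1 0 i} ∈ {R | IsRidge (poly k 0 1 0) R} := fun i =>
        (isRidge_poly_iff hk one_pos).2 ⟨i, rfl⟩
      refine ⟨v i, subset_convexHull ℝ _ ⟨i, rfl⟩, SupportedBy.add ?_ ?_⟩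
      · rw [← hf]
        exact .smul ha (.of_mem (hr i) (by rw [hf, (hsup i).1]) (hle i))
      · rw [← hf]
        exact .smul hb (.of_mem (hr (i + 1)) (by rw [hf, (hsup i).2]) (hle (i + 1)))
  have hd : polyDim (poly k 0 1 0) = 2 := polyDim_poly hk one_pos
  have := hsys.isVertexPreservingRealisation (by rw [hext]; exact finite_range_vert hk)
    (by rw [hext]; rfl) hd.ge ?_ ?_
  · rwa [hQ] at this
  · intro F hF
    obtain ⟨i, rfl⟩ := (isFacet_poly_iff hk one_pos).1 hF
    rw [hp]
    exact hN.isBeyond hk i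
  · intro y z hy hz _ hyd hzd hne
    rw [hd] at hyd hzd
    exact isRidgeGenerated_poly hk one_pos hy hz hyd hzd hne

/-- By the normalisation of `u`, the ray from the origin to `v i` meets the edge line `u i = κ` at
`κ • v i`. -/
theorem hasIntersectionRatio (hN : IsNested k v u U κ) (hk : 3 ≤ k) (i : ℤ) :
    HasIntersectionRatio (poly k 0 1 0) 0 (v i) κ := by
  obtain ⟨h, hh, hκ, hn⟩ := hN.nrm_eq
  have h1 : u i (v i) = 1 := (hN.n_v_eq i i).2 (by simp)
  have hκ1 : κ ≤ 1 := by
    have h2 := hN.lt_nrm i i (by simp)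
    rw [hn, smul_apply, h1, smul_eq_mul, mul_one, ← hκ] at h2
    nlinarith
  refine ⟨κ • v i, ⟨?_, mem_frontier_of_mem_edge (i := i) hk one_pos ⟨?_, ?_⟩⟩, ?_⟩
  · rw [segment_eq_image']
    exact ⟨κ, ⟨hN.pos.le, hκ1⟩, by simp⟩
  · rw [mem_poly_iff hk one_pos]
    intro j
    rw [sub_zero, map_smul, hn, smul_apply, smul_eq_mul, smul_eq_mul, one_mul, ← hκ, ← mul_assoc]
    have := hN.n_v_le j i
    have hpos := mul_pos hN.pos hh
    nlinarith
  · rw [sub_zero, map_smul, hn, smul_apply, smul_eq_mul, smul_eq_mul, one_mul, ← hκ, h1, mul_one]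
  · rw [dist_zero_left, dist_zero_left, norm_smul, Real.norm_of_nonneg hN.pos.le]

end IsNested

/-- A function on the facets of a product of polygons, given by its values at the two families. -/
theorem exists_facet_fun {α : Type*} [Inhabited α] (hm : 3 ≤ m) (hn : 3 ≤ n) (a b : ℤ → α)
    (ha : ∀ i j, (m : ℤ) ∣ i - j → a i = a j) (hb : ∀ i j, (n : ℤ) ∣ i - j → b i = b j) :
    ∃ p : Set (Plane × Plane) → α,
      (∀ i, p (edge m 0 1 0 i ×ˢ poly n 0 1 0) = a i) ∧
        ∀ i, p (poly m 0 1 0 ×ˢ edge n 0 1 0 i) = b i := by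
  have hft : Function.FactorsThrough (Sum.elim a b)
      (Sum.elim (fun i => edge m 0 1 0 i ×ˢ poly n 0 1 0)
        (fun i => poly m 0 1 0 ×ˢ edge n 0 1 0 i)) := by
    rintro (i | i) (j | j) h
    · have hne : (edge m 0 1 0 i ×ˢ poly n 0 1 0).Nonempty :=
        (nonempty_edge hm one_pos i).prod nonempty_poly
      exact ha i j ((edge_eq_iff hm one_pos).1 ((Set.prod_eq_prod_iff_of_nonempty hne).1 h).1)
    · exact absurd h (edge_prod_ne hm one_pos i j)
    · exact absurd h.symm (edge_prod_ne hm one_pos j i)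
    · have hne : (poly m 0 1 0 ×ˢ edge n 0 1 0 i).Nonempty :=
        nonempty_poly.prod (nonempty_edge hn one_pos i)
      exact hb i j ((edge_eq_iff hn one_pos).1 ((Set.prod_eq_prod_iff_of_nonempty hne).1 h).2)
  exact ⟨_, fun i => hft.extend_apply default (Sum.inl i),
    fun i => hft.extend_apply default (Sum.inr i)⟩

/-- A function on the ridges of a product of polygons, given by its values at the three
families. -/
theorem exists_ridge_fun {α : Type*} [Inhabited α] (hm : 3 ≤ m) (hn : 3 ≤ n) (a b : ℤ → α)
    (d : ℤ → ℤ → α) (ha : ∀ i j, (m : ℤ) ∣ i - j → a i = a j)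
    (hb : ∀ i j, (n : ℤ) ∣ i - j → b i = b j)
    (hd : ∀ i i' j j', (m : ℤ) ∣ i - i' → (n : ℤ) ∣ j - j' → d i j = d i' j') :
    ∃ f : Set (Plane × Plane) → α,
      (∀ i, f ({vert m 0 1 0 i} ×ˢ poly n 0 1 0) = a i) ∧
        (∀ i, f (poly m 0 1 0 ×ˢ {vert n 0 1 0 i}) = b i) ∧
          ∀ i j, f (edge m 0 1 0 i ×ˢ edge n 0 1 0 j) = d i j := by
  have hft : Function.FactorsThrough (Sum.elim a (Sum.elim b fun ij : ℤ × ℤ => d ij.1 ij.2))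
      (Sum.elim (fun i => ({vert m 0 1 0 i} : Set Plane) ×ˢ poly n 0 1 0)
        (Sum.elim (fun i => poly m 0 1 0 ×ˢ {vert n 0 1 0 i})
          fun ij : ℤ × ℤ => edge m 0 1 0 ij.1 ×ˢ edge n 0 1 0 ij.2)) := by
    have e : ∀ {A B C D : Set Plane}, A.Nonempty → B.Nonempty → A ×ˢ B = C ×ˢ D →
        A = C ∧ B = D := fun hA hB h => (Set.prod_eq_prod_iff_of_nonempty (hA.prod hB)).1 h
    have s : ∀ x : Plane, ({x} : Set Plane).Nonempty := Set.singleton_nonempty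
    have d0 : ∀ (k : ℕ) (i : ℤ), polyDim {vert k 0 1 0 i} = 0 := fun k i => polyDim_vert i
    have d1 := fun i => polyDim_edge (c := 0) (θ := 0) hm one_pos i
    have d1' := fun i => polyDim_edge (c := 0) (θ := 0) hn one_pos i
    have d2 := polyDim_poly (c := 0) (θ := 0) hm one_pos
    have d2' := polyDim_poly (c := 0) (θ := 0) hn one_pos
    have ne := nonempty_edge (c := 0) (θ := 0) hm one_pos
    have ne' := nonempty_edge (c := 0) (θ := 0) hn one_pos
    rintro (i | i | ⟨i, i'⟩) (j | j | ⟨j, j'⟩) h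
    · have := (e (s _) nonempty_poly h).1
      rw [Set.singleton_eq_singleton_iff, vert_eq_iff hm one_pos] at this
      exact ha i j this
    · have := congrArg polyDim (e (s _) nonempty_poly h).1
      rw [d0, d2] at this; omega
    · have := congrArg polyDim (e (s _) nonempty_poly h).1
      rw [d0, d1] at this; omega
    · have := congrArg polyDim (e nonempty_poly (s _) h).1
      rw [d0, d2] at this; omega
    · have := (e nonempty_poly (s _) h).2
      rw [Set.singleton_eq_singleton_iff, vert_eq_iff hn one_pos] at this
      exact hb i j this
    · have := congrArg polyDim (e nonempty_poly (s _) h).1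
      rw [d1, d2] at this; omega
    · have := congrArg polyDim (e (ne _) (ne' _) h).1
      rw [d0, d1] at this; omega
    · have := congrArg polyDim (e (ne _) (ne' _) h).1
      rw [d1, d2] at this; omega
    · have := e (ne _) (ne' _) h
      rw [edge_eq_iff hm one_pos, edge_eq_iff hn one_pos] at this
      exact hd i j i' j' this.1 this.2
  exact ⟨_, fun i => hft.extend_apply default (Sum.inl i),
    fun i => hft.extend_apply default (Sum.inr (Sum.inl i)),
    fun i j => hft.extend_apply default (Sum.inr (Sum.inr (i, j)))⟩

/-! ### The realisation over the product -/

section Product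

variable {v₀ v₁ : ℤ → Plane} {u₀ U₀ u₁ U₁ : ℤ → Plane →L[ℝ] ℝ} {κ₀ κ₁ : ℝ}

/-- A functional exposing a facet is a positive multiple of an edge normal in one factor and zero in
the other. Hence apexes of the same family are compared inside one plane, while those of the other
family project to the center. -/
theorem isBeyond_prod (hm : 3 ≤ m) (hn : 3 ≤ n) (h₀ : IsNested m v₀ u₀ U₀ κ₀)
    (h₁ : IsNested n v₁ u₁ U₁ κ₁) {p : Set (Plane × Plane) → Plane × Plane}
    (hp₀ : ∀ i, p (edge m 0 1 0 i ×ˢ poly n 0 1 0) = (v₀ i, 0))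
    (hp₁ : ∀ i, p (poly m 0 1 0 ×ˢ edge n 0 1 0 i) = (0, v₁ i)) {F : Set (Plane × Plane)}
    (hF : IsFacet (poly m 0 1 0 ×ˢ poly n 0 1 0) F) :
    IsBeyond (poly m 0 1 0 ×ˢ poly n 0 1 0) F (p F) := by
  intro G hG l hl g hg
  have hlg : ∀ x : Plane × Plane, l x =
      l.comp (.inl ℝ Plane Plane) x.1 + l.comp (.inr ℝ Plane Plane) x.2 := fun x => by
    simp only [ContinuousLinearMap.comp_apply, ContinuousLinearMap.inl_apply,
      ContinuousLinearMap.inr_apply, ← map_add]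
    simp
  have c0 := cos_pi_div_pos hm
  have c1 := cos_pi_div_pos hn
  rw [toExposed_prod] at hl
  rcases (isFacet_prod_iff hm hn one_pos one_pos).1 hG with ⟨j, rfl⟩ | ⟨j, rfl⟩
  · have hne : (edge m 0 1 0 j ×ˢ poly n 0 1 0).Nonempty := ⟨g, hg⟩
    obtain ⟨e0, e1⟩ := (Set.prod_eq_prod_iff_of_nonempty hne).1 hl
    obtain ⟨a, ha, hl0⟩ := exists_pos_smul_nrm hm one_pos e0.symm
    have hl1 := eq_zero_of_toExposed_eq hn one_pos e1.symm
    have hval : ∀ x, l x = a * nrm m 0 j x.1 := fun x => by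
      rw [hlg, hl0, hl1]; simp
    have hg2 := hg.1.2
    rw [sub_zero, one_mul] at hg2
    rw [hval, hval, hg2]
    rcases (isFacet_prod_iff hm hn one_pos one_pos).1 hF with ⟨i, rfl⟩ | ⟨i, rfl⟩
    · rw [hp₀]
      refine ⟨fun h => ?_, fun h => ?_⟩
      · have := (edge_eq_iff hm one_pos).1 ((Set.prod_eq_prod_iff_of_nonempty hne).1 h).1
        exact mul_lt_mul_of_pos_left (h₀.lt_nrm j i (by rwa [dvd_sub_comm])) ha
      · refine mul_lt_mul_of_pos_left (h₀.nrm_lt j i fun hd => h ?_) ha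
        rw [edge_of_dvd hm (i := i) (j := j) hd]
    · refine ⟨fun h => absurd h (edge_prod_ne hm one_pos j i), fun _ => ?_⟩
      rw [hp₁, map_zero, mul_zero]
      positivity
  · have hne : (poly m 0 1 0 ×ˢ edge n 0 1 0 j).Nonempty := ⟨g, hg⟩
    obtain ⟨e0, e1⟩ := (Set.prod_eq_prod_iff_of_nonempty hne).1 hl
    obtain ⟨a, ha, hl1⟩ := exists_pos_smul_nrm hn one_pos e1.symm
    have hl0 := eq_zero_of_toExposed_eq hm one_pos e0.symm
    have hval : ∀ x, l x = a * nrm n 0 j x.2 := fun x => by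
      rw [hlg, hl0, hl1]; simp
    have hg2 := hg.2.2
    rw [sub_zero, one_mul] at hg2
    rw [hval, hval, hg2]
    rcases (isFacet_prod_iff hm hn one_pos one_pos).1 hF with ⟨i, rfl⟩ | ⟨i, rfl⟩
    · refine ⟨fun h => absurd h.symm (edge_prod_ne hm one_pos i j), fun _ => ?_⟩
      rw [hp₀, map_zero, mul_zero]
      positivity
    · rw [hp₁]
      refine ⟨fun h => ?_, fun h => ?_⟩
      · have := (edge_eq_iff hn one_pos).1 ((Set.prod_eq_prod_iff_of_nonempty hne).1 h).2
        exact mul_lt_mul_of_pos_left (h₁.lt_nrm j i (by rwa [dvd_sub_comm])) ha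
      · refine mul_lt_mul_of_pos_left (h₁.nrm_lt j i fun hd => h ?_) ha
        rw [edge_of_dvd hn (i := i) (j := j) hd]

theorem image_facets_prod (hm : 3 ≤ m) (hn : 3 ≤ n)
    {p : Set (Plane × Plane) → Plane × Plane}
    (hp₀ : ∀ i, p (edge m 0 1 0 i ×ˢ poly n 0 1 0) = (v₀ i, 0))
    (hp₁ : ∀ i, p (poly m 0 1 0 ×ˢ edge n 0 1 0 i) = (0, v₁ i)) :
    p '' {F | IsFacet (poly m 0 1 0 ×ˢ poly n 0 1 0) F} =
      Set.range (fun i => (v₀ i, (0 : Plane))) ∪ Set.range (fun i => ((0 : Plane), v₁ i)) := by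
  ext x
  constructor
  · rintro ⟨F, hF, rfl⟩
    rcases (isFacet_prod_iff hm hn one_pos one_pos).1 hF with ⟨i, rfl⟩ | ⟨i, rfl⟩
    · exact Or.inl ⟨i, (hp₀ i).symm⟩
    · exact Or.inr ⟨i, (hp₁ i).symm⟩
  · rintro (⟨i, rfl⟩ | ⟨i, rfl⟩)
    · exact ⟨_, (isFacet_prod_iff hm hn one_pos one_pos).2 (Or.inl ⟨i, rfl⟩), hp₀ i⟩
    · exact ⟨_, (isFacet_prod_iff hm hn one_pos one_pos).2 (Or.inr ⟨i, rfl⟩), hp₁ i⟩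

/-- Two nested pairs of polygons with complementary ratios yield a realisation of the
`E`-construction of the product. -/
theorem isVertexPreservingRealisation_prod (hm : 3 ≤ m) (hn : 3 ≤ n)
    (h₀ : IsNested m v₀ u₀ U₀ κ₀) (h₁ : IsNested n v₁ u₁ U₁ κ₁) (hκ : κ₀ + κ₁ = 1)
    {p : Set (Plane × Plane) → Plane × Plane}
    (hp₀ : ∀ i, p (edge m 0 1 0 i ×ˢ poly n 0 1 0) = (v₀ i, 0))
    (hp₁ : ∀ i, p (poly m 0 1 0 ×ˢ edge n 0 1 0 i) = (0, v₁ i)) :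
    IsVertexPreservingRealisation (poly m 0 1 0 ×ˢ poly n 0 1 0)
      (convexHull ℝ ((Set.range (vert m 0 1 0) ×ˢ Set.range (vert n 0 1 0)) ∪
        (Set.range (fun i => (v₀ i, (0 : Plane))) ∪ Set.range (fun i => ((0 : Plane), v₁ i)))))
      p := by
  let g₀ : (Plane →L[ℝ] ℝ) → (Plane × Plane →L[ℝ] ℝ) := fun l => l.comp (.fst ℝ Plane Plane)
  let g₁ : (Plane →L[ℝ] ℝ) → (Plane × Plane →L[ℝ] ℝ) := fun l => l.comp (.snd ℝ Plane Plane)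
  have hg₀ : ∀ l x, g₀ l x = l x.1 := fun _ _ => rfl
  have hg₁ : ∀ l x, g₁ l x = l x.2 := fun _ _ => rfl
  obtain ⟨f, hf1, hf2, hf3⟩ := exists_ridge_fun hm hn (fun i => g₀ (U₀ i)) (fun i => g₁ (U₁ i))
    (fun i j => g₀ (u₀ i) + g₁ (u₁ j)) (fun i j h => by rw [h₀.N_congr i j h])
    (fun i j h => by rw [h₁.N_congr i j h])
    (fun i i' j j' h h' => by rw [h₀.n_congr i i' h, h₁.n_congr j j' h'])
  have hext : (poly m 0 1 0 ×ˢ poly n 0 1 0).extremePoints ℝ =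
      Set.range (vert m 0 1 0) ×ˢ Set.range (vert n 0 1 0) := by
    rw [extremePoints_prod, extremePoints_poly hm one_pos, extremePoints_poly hn one_pos]
  have hQ : convexHull ℝ ((poly m 0 1 0 ×ˢ poly n 0 1 0).extremePoints ℝ ∪
      p '' {F | IsFacet (poly m 0 1 0 ×ˢ poly n 0 1 0) F}) =
      convexHull ℝ ((Set.range (vert m 0 1 0) ×ˢ Set.range (vert n 0 1 0)) ∪
        (Set.range (fun i => (v₀ i, (0 : Plane))) ∪ Set.range (fun i => ((0 : Plane), v₁ i)))) := by
    rw [hext, image_facets_prod hm hn hp₀ hp₁]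
  have hfac : ∀ {F}, IsFacet (poly m 0 1 0 ×ˢ poly n 0 1 0) F → _ :=
    fun {F} hF => (isFacet_prod_iff hm hn one_pos one_pos).1 hF
  have hrid : ∀ {R}, IsRidge (poly m 0 1 0 ×ˢ poly n 0 1 0) R → _ :=
    fun {R} hR => (isRidge_prod_iff hm hn one_pos one_pos).1 hR
  have hsub : ∀ {A B C D : Set Plane}, A.Nonempty → B.Nonempty →
      (A ×ˢ B ⊆ C ×ˢ D ↔ A ⊆ C ∧ B ⊆ D) := by
    intro A B C D hA hB
    rw [Set.prod_subset_prod_iff]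
    simp [hA.ne_empty, hB.ne_empty]
  have ne0 := nonempty_edge (c := 0) (θ := 0) hm one_pos
  have ne1 := nonempty_edge (c := 0) (θ := 0) hn one_pos
  have np0 := not_poly_subset_edge (c := 0) (θ := 0) hm one_pos
  have np1 := not_poly_subset_edge (c := 0) (θ := 0) hn one_pos
  have hs : ∀ x : Plane, ({x} : Set Plane).Nonempty := Set.singleton_nonempty
  have hV : ∀ R, IsRidge (poly m 0 1 0 ×ˢ poly n 0 1 0) R →
      ∀ v ∈ (poly m 0 1 0 ×ˢ poly n 0 1 0).extremePoints ℝ, f R v ≤ 1 ∧ (f R v = 1 ↔ v ∈ R) := by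
    intro R hR x hx
    rw [hext] at hx
    obtain ⟨x, y⟩ := x
    obtain ⟨⟨j, hj⟩, ⟨l, hl⟩⟩ := hx
    dsimp only at hj hl
    subst hj hl
    rcases hrid hR with ⟨i, rfl⟩ | ⟨i, rfl⟩ | ⟨i, i', rfl⟩
    · rw [hf1, hg₀]
      refine ⟨h₀.N_w_le i j, ?_⟩
      rw [h₀.N_w_eq, Set.mem_prod, Set.mem_singleton_iff, vert_eq_iff hm one_pos]
      exact (and_iff_left (vert_mem_poly l)).symm
    · rw [hf2, hg₁]
      refine ⟨h₁.N_w_le i l, ?_⟩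
      rw [h₁.N_w_eq, Set.mem_prod, Set.mem_singleton_iff, vert_eq_iff hn one_pos]
      exact (and_iff_right (vert_mem_poly j)).symm
    · rw [hf3, add_apply, hg₀, hg₁]
      have a1 := h₀.n_w_le i j
      have a2 := h₁.n_w_le i' l
      refine ⟨by dsimp only; linarith, ?_⟩
      rw [Set.mem_prod, ← h₀.n_w_eq, ← h₁.n_w_eq]
      constructor
      · intro h
        dsimp only at h
        constructor <;> linarith
      · rintro ⟨e1, e2⟩
        dsimp only
        rw [e1, e2, hκ]
  have hN : ∀ R, IsRidge (poly m 0 1 0 ×ˢ poly n 0 1 0) R →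
      ∀ F, IsFacet (poly m 0 1 0 ×ˢ poly n 0 1 0) F →
        f R (p F) ≤ 1 ∧ (f R (p F) = 1 ↔ R ⊆ F) := by
    intro R hR F hF
    rcases hfac hF with ⟨j, rfl⟩ | ⟨j, rfl⟩
    · rw [hp₀]
      rcases hrid hR with ⟨i, rfl⟩ | ⟨i, rfl⟩ | ⟨i, i', rfl⟩
      · rw [hf1, hg₀, hsub (hs _) nonempty_poly, Set.singleton_subset_iff, ← h₀.N_v_eq]
        exact ⟨h₀.N_v_le i j, (and_iff_left subset_rfl).symm⟩
      · rw [hf2, hg₁, hsub nonempty_poly (hs _), map_zero]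
        exact ⟨zero_le_one, iff_of_false zero_ne_one fun h => np0 j h.1⟩
      · rw [hf3, add_apply, hg₀, hg₁, hsub (ne0 _) (ne1 _), edge_subset_edge_iff hm one_pos,
          map_zero, add_zero, dvd_sub_comm, ← h₀.n_v_eq]
        exact ⟨h₀.n_v_le i j, (and_iff_left (Set.sep_subset _ _)).symm⟩
    · rw [hp₁]
      rcases hrid hR with ⟨i, rfl⟩ | ⟨i, rfl⟩ | ⟨i, i', rfl⟩
      · rw [hf1, hg₀, hsub (hs _) nonempty_poly, map_zero]
        exact ⟨zero_le_one, iff_of_false zero_ne_one fun h => np1 j h.2⟩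
      · rw [hf2, hg₁, hsub nonempty_poly (hs _), Set.singleton_subset_iff, ← h₁.N_v_eq]
        exact ⟨h₁.N_v_le i j, (and_iff_right subset_rfl).symm⟩
      · rw [hf3, add_apply, hg₀, hg₁, hsub (ne0 _) (ne1 _), edge_subset_edge_iff hn one_pos,
          map_zero, zero_add, dvd_sub_comm, ← h₁.n_v_eq]
        exact ⟨h₁.n_v_le i' j, (and_iff_right (Set.sep_subset _ _)).symm⟩
  have hfan : ∀ l, ∃ x ∈ convexHull ℝ ((poly m 0 1 0 ×ˢ poly n 0 1 0).extremePoints ℝ ∪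
      p '' {F | IsFacet (poly m 0 1 0 ×ˢ poly n 0 1 0) F}),
      SupportedBy (convexHull ℝ ((poly m 0 1 0 ×ˢ poly n 0 1 0).extremePoints ℝ ∪
        p '' {F | IsFacet (poly m 0 1 0 ×ˢ poly n 0 1 0) F}))
        {R | IsRidge (poly m 0 1 0 ×ˢ poly n 0 1 0) R} f x l := by
    intro l
    have hle : ∀ R, IsRidge (poly m 0 1 0 ×ˢ poly n 0 1 0) R →
        ∀ y ∈ convexHull ℝ ((poly m 0 1 0 ×ˢ poly n 0 1 0).extremePoints ℝ ∪
          p '' {F | IsFacet (poly m 0 1 0 ×ˢ poly n 0 1 0) F}), f R y ≤ 1 := by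
      intro R hR y hy
      refine le_of_mem_convexHull _ ?_ hy
      rintro w (hw | ⟨F, hF, rfl⟩)
      · exact (hV R hR w hw).1
      · exact (hN R hR F hF).1
    have hX₀ : ∀ i, (v₀ i, (0 : Plane)) ∈ convexHull ℝ
        ((poly m 0 1 0 ×ˢ poly n 0 1 0).extremePoints ℝ ∪
          p '' {F | IsFacet (poly m 0 1 0 ×ˢ poly n 0 1 0) F}) := fun i => by
      rw [hQ]; exact subset_convexHull ℝ _ (Or.inr (Or.inl ⟨i, rfl⟩))
    have hX₁ : ∀ i, ((0 : Plane), v₁ i) ∈ convexHull ℝ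
        ((poly m 0 1 0 ×ˢ poly n 0 1 0).extremePoints ℝ ∪
          p '' {F | IsFacet (poly m 0 1 0 ×ˢ poly n 0 1 0) F}) := fun i => by
      rw [hQ]; exact subset_convexHull ℝ _ (Or.inr (Or.inr ⟨i, rfl⟩))
    have hY : ∀ i j, (vert m 0 1 0 i, vert n 0 1 0 j) ∈ convexHull ℝ
        ((poly m 0 1 0 ×ˢ poly n 0 1 0).extremePoints ℝ ∪
          p '' {F | IsFacet (poly m 0 1 0 ×ˢ poly n 0 1 0) F}) := fun i j => by
      rw [hQ]; exact subset_convexHull ℝ _ (Or.inl ⟨⟨i, rfl⟩, ⟨j, rfl⟩⟩)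
    set Q := convexHull ℝ ((poly m 0 1 0 ×ˢ poly n 0 1 0).extremePoints ℝ ∪
      p '' {F | IsFacet (poly m 0 1 0 ×ˢ poly n 0 1 0) F})
    set 𝓡 : Set (Set (Plane × Plane)) := {R | IsRidge (poly m 0 1 0 ×ˢ poly n 0 1 0) R}
    have s1 : ∀ x i, U₀ i x.1 = 1 → SupportedBy Q 𝓡 f x (g₀ (U₀ i)) := by
      intro x i hx
      have hr : IsRidge (poly m 0 1 0 ×ˢ poly n 0 1 0) ({vert m 0 1 0 i} ×ˢ poly n 0 1 0) :=
        (isRidge_prod_iff hm hn one_pos one_pos).2 (Or.inl ⟨i, rfl⟩)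
      rw [← hf1]
      exact .of_mem hr (by rw [hf1]; exact hx) (hle _ hr)
    have s2 : ∀ x i, U₁ i x.2 = 1 → SupportedBy Q 𝓡 f x (g₁ (U₁ i)) := by
      intro x i hx
      have hr : IsRidge (poly m 0 1 0 ×ˢ poly n 0 1 0) (poly m 0 1 0 ×ˢ {vert n 0 1 0 i}) :=
        (isRidge_prod_iff hm hn one_pos one_pos).2 (Or.inr (Or.inl ⟨i, rfl⟩))
      rw [← hf2]
      exact .of_mem hr (by rw [hf2]; exact hx) (hle _ hr)
    have s3 : ∀ x i j, u₀ i x.1 + u₁ j x.2 = 1 →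
        SupportedBy Q 𝓡 f x (g₀ (u₀ i) + g₁ (u₁ j)) := by
      intro x i j hx
      have hr : IsRidge (poly m 0 1 0 ×ˢ poly n 0 1 0) (edge m 0 1 0 i ×ˢ edge n 0 1 0 j) :=
        (isRidge_prod_iff hm hn one_pos one_pos).2 (Or.inr (Or.inr ⟨i, j, rfl⟩))
      rw [← hf3]
      exact .of_mem hr (by rw [hf3]; exact hx) (hle _ hr)
    -- Each component of `l` is placed in a cone spanned by an edge normal and an outer normal at
    -- one end of that edge. Outer normals are facet functionals by themselves, but edge normals
    -- occur only in pairs `u₀ + u₁`, so the amounts `a` and `a'` have to be balanced.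
    obtain ⟨i, i', j, a, b, s, t, ha, hb, hs0, ht0, hst, e, eN, ej, ej'⟩ :=
      h₀.fan (l.comp (.inl ℝ Plane Plane))
    obtain ⟨k, k', q, a', b', s', t', ha', hb', hs0', ht0', hst', e', eN', ek, ek'⟩ :=
      h₁.fan (l.comp (.inr ℝ Plane Plane))
    obtain ⟨x, y, hx, hy, exy⟩ := h₀.n_comb i
    obtain ⟨x', y', hx', hy', exy'⟩ := h₁.n_comb k
    have hl : l = g₀ (a • u₀ i + b • U₀ j) + g₁ (a' • u₁ k + b' • U₁ q) := by
      rw [← e, ← e']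
      ext z
      · simp [g₀, g₁]
        exact map_zero l
      · simp [g₀, g₁]
        exact map_zero l
    -- values at the apexes and at the old vertex
    have A1 : u₀ i (v₀ i) = 1 := (h₀.n_v_eq i i).2 (by simp)
    have A2 : U₀ i (v₀ i) = 1 := (h₀.N_v_eq i i).2 (vert_mem_edge hm one_pos i)
    have A3 : U₀ (i + 1) (v₀ i) = 1 := (h₀.N_v_eq _ i).2 (vert_mem_edge' hm one_pos i)
    have A4 : U₀ j (v₀ i) = 1 := (h₀.N_v_eq j i).2 ej
    have B1 : u₁ k (v₁ k) = 1 := (h₁.n_v_eq k k).2 (by simp)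
    have B2 : U₁ k (v₁ k) = 1 := (h₁.N_v_eq k k).2 (vert_mem_edge hn one_pos k)
    have B3 : U₁ (k + 1) (v₁ k) = 1 := (h₁.N_v_eq _ k).2 (vert_mem_edge' hn one_pos k)
    have B4 : U₁ q (v₁ k) = 1 := (h₁.N_v_eq q k).2 ek
    have C1 : u₀ i (vert m 0 1 0 j) = κ₀ := (h₀.n_w_eq i j).2 ej
    have C2 : u₀ i' (vert m 0 1 0 j) = κ₀ := (h₀.n_w_eq i' j).2 ej'
    have C3 : U₀ j (vert m 0 1 0 j) = 1 := (h₀.N_w_eq j j).2 (by simp)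
    have D1 : u₁ k (vert n 0 1 0 q) = κ₁ := (h₁.n_w_eq k q).2 ek
    have D2 : u₁ k' (vert n 0 1 0 q) = κ₁ := (h₁.n_w_eq k' q).2 ek'
    have D3 : U₁ q (vert n 0 1 0 q) = 1 := (h₁.N_w_eq q q).2 (by simp)
    have z0 : ∀ l : Plane →L[ℝ] ℝ, l 0 = 0 := fun l => map_zero l
    have hst0 : s + t ≠ 0 := hst.ne'
    have hst0' : s' + t' ≠ 0 := hst'.ne'
    rcases le_total a' a with hle' | hle'
    · by_cases hbig : b' * (s' + t') ≤ a - a'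
      -- The surplus of `u₀ i` exceeds what `U₁ q` can absorb. All of `U₁ q` is resolved into edge
      -- normals and paired with `u₀ i`; the rest of `u₀ i` is resolved into outer normals by
      -- `n_comb`. All terms are tight at the apex.
      · refine ⟨(v₀ i, 0), hX₀ i, ?_⟩
        have : l = a' • (g₀ (u₀ i) + g₁ (u₁ k)) + ((b' * s') • (g₀ (u₀ i) + g₁ (u₁ k)) +
            (b' * t') • (g₀ (u₀ i) + g₁ (u₁ k'))) + (((a - a' - b' * (s' + t')) * x) • g₀ (U₀ i) +
              ((a - a' - b' * (s' + t')) * y) • g₀ (U₀ (i + 1))) + b • g₀ (U₀ j) := by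
          rw [hl]
          ext z
          · have h1 := DFunLike.congr_fun exy z
            simp only [add_apply, smul_apply, smul_eq_mul] at h1
            simp [g₀, g₁]
            linear_combination (a - a' - b' * (s' + t')) * h1
          · have h1 := DFunLike.congr_fun eN' z
            simp only [add_apply, smul_apply, smul_eq_mul] at h1
            simp [g₀, g₁]
            linear_combination b' * h1
        rw [this]
        have hnn : 0 ≤ a - a' - b' * (s' + t') := by linarith
        exact ((((s3 _ _ _ (by rw [A1, z0, add_zero])).smul ha').add
          (((s3 _ _ _ (by rw [A1, z0, add_zero])).smul (by positivity)).add
            ((s3 _ _ _ (by rw [A1, z0, add_zero])).smul (by positivity)))).add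
          (((s1 _ _ A2).smul (by positivity)).add ((s1 _ _ A3).smul (by positivity)))).add
          ((s1 _ _ A4).smul hb)
      · push Not at hbig
        refine ⟨(vert m 0 1 0 j, vert n 0 1 0 q), hY j q, ?_⟩
        -- The amount of `U₁ q` whose edge normals pair off exactly with the surplus of `u₀ i`. The
        -- rest remains an outer normal, and all terms are tight at an old vertex, by `hκ` for the
        -- pairs.
        obtain ⟨w, hw⟩ : ∃ w, w = (a - a') / (s' + t') := ⟨_, rfl⟩
        have hw0 : 0 ≤ w := by rw [hw]; exact div_nonneg (by linarith) hst'.le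
        have hwb : w ≤ b' := by rw [hw, div_le_iff₀ hst']; exact hbig.le
        have hwm : w * (s' + t') = a - a' := by rw [hw, div_mul_cancel₀ _ hst0']
        have : l = a' • (g₀ (u₀ i) + g₁ (u₁ k)) + ((w * s') • (g₀ (u₀ i) + g₁ (u₁ k)) +
            (w * t') • (g₀ (u₀ i) + g₁ (u₁ k'))) + b • g₀ (U₀ j) + (b' - w) • g₁ (U₁ q) := by
          rw [hl]
          ext z
          · simp [g₀, g₁]
            linear_combination -(u₀ i z) * hwm
          · have h1 := DFunLike.congr_fun eN' z
            simp only [add_apply, smul_apply, smul_eq_mul] at h1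
            simp [g₀, g₁]
            linear_combination w * h1
        rw [this]
        exact ((((s3 _ _ _ (by rw [C1, D1, hκ])).smul ha').add
          (((s3 _ _ _ (by rw [C1, D1, hκ])).smul (by positivity)).add
            ((s3 _ _ _ (by rw [C1, D2, hκ])).smul (by positivity)))).add
          ((s1 _ _ C3).smul hb)).add ((s2 _ _ D3).smul (by linarith))
    -- The same exchange with the roles of the factors reversed.
    · by_cases hbig : b * (s + t) ≤ a' - a
      · refine ⟨(0, v₁ k), hX₁ k, ?_⟩
        have : l = a • (g₀ (u₀ i) + g₁ (u₁ k)) + ((b * s) • (g₀ (u₀ i) + g₁ (u₁ k)) +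
            (b * t) • (g₀ (u₀ i') + g₁ (u₁ k))) + (((a' - a - b * (s + t)) * x') • g₁ (U₁ k) +
              ((a' - a - b * (s + t)) * y') • g₁ (U₁ (k + 1))) + b' • g₁ (U₁ q) := by
          rw [hl]
          ext z
          · have h1 := DFunLike.congr_fun eN z
            simp only [add_apply, smul_apply, smul_eq_mul] at h1
            simp [g₀, g₁]
            linear_combination b * h1
          · have h1 := DFunLike.congr_fun exy' z
            simp only [add_apply, smul_apply, smul_eq_mul] at h1
            simp [g₀, g₁]
            linear_combination (a' - a - b * (s + t)) * h1
        rw [this]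
        have hnn : 0 ≤ a' - a - b * (s + t) := by linarith
        exact ((((s3 _ _ _ (by rw [B1, z0, zero_add])).smul ha).add
          (((s3 _ _ _ (by rw [B1, z0, zero_add])).smul (by positivity)).add
            ((s3 _ _ _ (by rw [B1, z0, zero_add])).smul (by positivity)))).add
          (((s2 _ _ B2).smul (by positivity)).add ((s2 _ _ B3).smul (by positivity)))).add
          ((s2 _ _ B4).smul hb')
      · push Not at hbig
        refine ⟨(vert m 0 1 0 j, vert n 0 1 0 q), hY j q, ?_⟩
        obtain ⟨w, hw⟩ : ∃ w, w = (a' - a) / (s + t) := ⟨_, rfl⟩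
        have hw0 : 0 ≤ w := by rw [hw]; exact div_nonneg (by linarith) hst.le
        have hwb : w ≤ b := by rw [hw, div_le_iff₀ hst]; exact hbig.le
        have hwm : w * (s + t) = a' - a := by rw [hw, div_mul_cancel₀ _ hst0]
        have : l = a • (g₀ (u₀ i) + g₁ (u₁ k)) + ((w * s) • (g₀ (u₀ i) + g₁ (u₁ k)) +
            (w * t) • (g₀ (u₀ i') + g₁ (u₁ k))) + (b - w) • g₀ (U₀ j) + b' • g₁ (U₁ q) := by
          rw [hl]
          ext z
          · have h1 := DFunLike.congr_fun eN z
            simp only [add_apply, smul_apply, smul_eq_mul] at h1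
            simp [g₀, g₁]
            linear_combination w * h1
          · simp [g₀, g₁]
            linear_combination -(u₁ k z) * hwm
        rw [this]
        exact ((((s3 _ _ _ (by rw [C1, D1, hκ])).smul ha).add
          (((s3 _ _ _ (by rw [C1, D1, hκ])).smul (by positivity)).add
            ((s3 _ _ _ (by rw [C2, D1, hκ])).smul (by positivity)))).add
          ((s1 _ _ C3).smul (by linarith))).add ((s2 _ _ D3).smul hb')
  have hsys : IsFacetSystem (poly m 0 1 0 ×ˢ poly n 0 1 0) p f :=
    ⟨fun R hR v hv => (hV R hR v hv).1, fun R hR v hv => (hV R hR v hv).2,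
      fun R hR F hF => (hN R hR F hF).1, fun R hR F hF => (hN R hR F hF).2, hfan⟩
  have hd : polyDim (poly m 0 1 0 ×ˢ poly n 0 1 0) = 4 := polyDim_poly_prod hm hn one_pos one_pos
  rw [← hQ]
  refine hsys.isVertexPreservingRealisation ?_
    (convexHull_extremePoints_prod hm hn one_pos one_pos) (by rw [hd]; norm_num)
    (fun F hF => isBeyond_prod hm hn h₀ h₁ hp₀ hp₁ hF) ?_
  · rw [hext]
    exact (finite_range_vert hm).prod (finite_range_vert hn)
  · intro y z hy hz hyz hyd hzd hne
    rw [hd] at hyd hzd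
    exact isRidgeGenerated_prod hm hn one_pos one_pos hy hz hyz (by linarith) (by linarith) hne

end Product

end Sufficiency

end EPolytope

namespace EPolytope

/-! ### Choice of the rotation and conclusion -/

section Characterisation

open Real

variable {m n : ℕ}

namespace IsNested

variable {v : ℤ → Plane} {u U : ℤ → Plane →L[ℝ] ℝ} {κ : ℝ} {k : ℕ}

/-- The shadow of the realisation for a product in one of the factors is the outer polygon. -/
theorem convexHull_shadow (hN : IsNested k v u U κ) (hk : 3 ≤ k) :
    convexHull ℝ (Set.range (vert k 0 1 0) ∪ (Set.range v ∪ {0})) =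
      convexHull ℝ (Set.range v) := by
  apply Set.Subset.antisymm
  · refine convexHull_min (Set.union_subset ?_ (Set.union_subset (subset_convexHull ℝ _) ?_))
      (convex_convexHull ℝ _)
    · rintro _ ⟨i, rfl⟩
      exact hN.w_mem i
    · rw [Set.singleton_subset_iff, ← hN.convexHull_union]
      exact convexHull_mono Set.subset_union_left
        (center_mem_poly (c := 0) (ρ := 1) (θ := 0) hk)
  · exact convexHull_mono (Set.subset_union_of_subset_right Set.subset_union_left _)

end IsNested

/-- The rotation angle for which the ratios of two nested pairs of polygons are complementary. -/
theorem exists_rotation (hm : 3 ≤ m) (hn : 3 ≤ n) (h : (1 : ℝ) / 2 ≤ 1 / m + 1 / n) :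
    ∃ φ : ℝ, |φ| < π / n ∧
      cos (π / m) ^ 2 / cos 0 ^ 2 + cos (π / n) ^ 2 / cos φ ^ 2 = 1 := by
  have hc := cos_pi_div_pos hn
  have hs := sin_pi_div_pos hm
  have hcm := cos_pi_div_pos hm
  have hsc := sin_sq_add_cos_sq (π / m)
  have hs1 : sin (π / m) < 1 := by nlinarith
  have hle : cos (π / n) ≤ sin (π / m) := by
    rw [← cos_pi_div_two_sub]
    have h1 := pi_div_le hm
    have h2 := pi_div_le hn
    refine cos_le_cos_of_nonneg_of_le_pi (by linarith [pi_pos]) (by linarith [pi_pos]) ?_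
    have h3 : π * (1 / 2) ≤ π * (1 / m + 1 / n) := mul_le_mul_of_nonneg_left h pi_pos.le
    have h4 : π * (1 / m + 1 / n) = π / m + π / n := by ring
    linarith
  have hq1 : cos (π / n) / sin (π / m) ≤ 1 := (div_le_one hs).2 hle
  have hq0 : 0 < cos (π / n) / sin (π / m) := div_pos hc hs
  have hcos : cos (arccos (cos (π / n) / sin (π / m))) = cos (π / n) / sin (π / m) :=
    cos_arccos (by linarith) hq1
  -- With the first outer polygon unrotated, the second ratio must be sin² (π/m), which fixes cos φ.
  -- It is at most 1 by the hypothesis, and exceeds cos (π/n) because sin (π/m) < 1.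
  refine ⟨arccos (cos (π / n) / sin (π / m)), ?_, ?_⟩
  · rw [abs_of_nonneg (arccos_nonneg _)]
    have h2 := pi_div_le hn
    refine lt_of_lt_of_eq (arccos_lt_arccos (by linarith) ?_ hq1)
      (arccos_cos (pi_div_pos hn).le (by linarith [pi_pos]))
    rw [lt_div_iff₀ hs]
    nlinarith
  · rw [hcos, cos_zero, div_pow, div_div_eq_mul_div, mul_div_cancel_left₀ _ (by positivity)]
    linarith

theorem exists_realisation (hm : 3 ≤ m) (hn : 3 ≤ n) (h : (1 : ℝ) / 2 ≤ 1 / m + 1 / n) :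
    ∃ (P₀ P₁ : Set Plane) (Q : Set (Plane × Plane)) (p : Set (Plane × Plane) → Plane × Plane),
      IsRegularPolygon m P₀ ∧ IsRegularPolygon n P₁ ∧
      IsVertexPreservingRealisation (P₀ ×ˢ P₁) Q p ∧
      IsVertexPreservingRealisation P₀ (Prod.fst '' Q) (fun F₀ => (p (F₀ ×ˢ P₁)).1) ∧
      IsVertexPreservingRealisation P₁ (Prod.snd '' Q) (fun F₁ => (p (P₀ ×ˢ F₁)).2) ∧
      IsRegularPolygon m (Prod.fst '' Q) ∧ IsRegularPolygon n (Prod.snd '' Q) ∧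
      (∃ r₀ : ℝ, ∀ F₀ F₁, IsFacet P₀ F₀ → IsFacet P₁ F₁ →
        HasIntersectionRatio P₀ (p (P₀ ×ˢ F₁)).1 (p (F₀ ×ˢ P₁)).1 r₀) ∧
      (∃ r₁ : ℝ, ∀ F₀ F₁, IsFacet P₀ F₀ → IsFacet P₁ F₁ →
        HasIntersectionRatio P₁ (p (F₀ ×ˢ P₁)).2 (p (P₀ ×ˢ F₁)).2 r₁) := by
  obtain ⟨φ, hφ, hκ⟩ := exists_rotation hm hn h
  have h₀ := isNested_rotate hm (φ := 0) (by rw [abs_zero]; exact pi_div_pos hm)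
  have h₁ := isNested_rotate hn hφ
  have hρ₀ : 0 < cos 0 / cos (π / m) := div_pos (by simp) (cos_pi_div_pos hm)
  have hρ₁ : 0 < cos φ / cos (π / n) :=
    div_pos ((cos_pi_div_pos hn).trans (cos_pi_div_lt hn hφ)) (cos_pi_div_pos hn)
  set v₀ := vert m 0 (cos 0 / cos (π / m)) (π / m + 0)
  set v₁ := vert n 0 (cos φ / cos (π / n)) (π / n + φ)
  obtain ⟨p, hp₀, hp₁⟩ := exists_facet_fun hm hn (fun i => (v₀ i, (0 : Plane)))
    (fun i => ((0 : Plane), v₁ i)) (fun i j h => by rw [h₀.v_congr i j h])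
    (fun i j h => by rw [h₁.v_congr i j h])
  have hQ := isVertexPreservingRealisation_prod hm hn h₀ h₁ hκ hp₀ hp₁
  have : NeZero m := ⟨by omega⟩
  have : NeZero n := ⟨by omega⟩
  have e₀ : Prod.fst '' (convexHull ℝ ((Set.range (vert m 0 1 0) ×ˢ Set.range (vert n 0 1 0)) ∪
      (Set.range (fun i => (v₀ i, (0 : Plane))) ∪ Set.range (fun i => ((0 : Plane), v₁ i))))) =
      convexHull ℝ (Set.range v₀) := by
    rw [← h₀.convexHull_shadow hm]
    refine ((LinearMap.fst ℝ Plane Plane).image_convexHull _).trans ?_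
    rw [LinearMap.coe_fst, Set.image_union, Set.image_union,
      Set.fst_image_prod _ (Set.range_nonempty _), ← Set.range_comp, ← Set.range_comp]
    congr 3
    exact Set.range_const
  have e₁ : Prod.snd '' (convexHull ℝ ((Set.range (vert m 0 1 0) ×ˢ Set.range (vert n 0 1 0)) ∪
      (Set.range (fun i => (v₀ i, (0 : Plane))) ∪ Set.range (fun i => ((0 : Plane), v₁ i))))) =
      convexHull ℝ (Set.range v₁) := by
    rw [← h₁.convexHull_shadow hn]
    refine ((LinearMap.snd ℝ Plane Plane).image_convexHull _).trans ?_
    rw [LinearMap.coe_snd, Set.image_union, Set.image_union,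
      Set.snd_image_prod (Set.range_nonempty _), ← Set.range_comp, ← Set.range_comp]
    congr 2
    rw [Set.union_comm]
    congr 1
    exact Set.range_const
  refine ⟨poly m 0 1 0, poly n 0 1 0, _, p, (isRegularPolygon_iff hm _).2 ⟨0, 1, 0, one_pos, rfl⟩,
    (isRegularPolygon_iff hn _).2 ⟨0, 1, 0, one_pos, rfl⟩, hQ, ?_, ?_, ?_, ?_,
    ⟨cos (π / m) ^ 2 / cos 0 ^ 2, ?_⟩, ⟨cos (π / n) ^ 2 / cos φ ^ 2, ?_⟩⟩
  · rw [e₀]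
    exact h₀.isVertexPreservingRealisation hm fun i => by rw [hp₀]
  · rw [e₁]
    exact h₁.isVertexPreservingRealisation hn fun i => by rw [hp₁]
  · rw [e₀]
    exact (isRegularPolygon_iff hm _).2 ⟨_, _, _, hρ₀, rfl⟩
  · rw [e₁]
    exact (isRegularPolygon_iff hn _).2 ⟨_, _, _, hρ₁, rfl⟩
  · intro F₀ F₁ hF₀ hF₁
    obtain ⟨i, rfl⟩ := (isFacet_poly_iff hm one_pos).1 hF₀
    obtain ⟨j, rfl⟩ := (isFacet_poly_iff hn one_pos).1 hF₁
    rw [hp₀, hp₁]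
    exact h₀.hasIntersectionRatio hm i
  · intro F₀ F₁ hF₀ hF₁
    obtain ⟨i, rfl⟩ := (isFacet_poly_iff hm one_pos).1 hF₀
    obtain ⟨j, rfl⟩ := (isFacet_poly_iff hn one_pos).1 hF₁
    rw [hp₀, hp₁]
    exact h₁.hasIntersectionRatio hn j

end Characterisation

end EPolytope

open EPolytope in
theorem theorem4p2 (m n : ℕ) (hm : 3 ≤ m) (hn : 3 ≤ n) :
    (∃ (P₀ P₁ : Set Plane) (Q : Set (Plane × Plane)) (p : Set (Plane × Plane) → Plane × Plane),
      -- the two factors are regular polygons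
      IsRegularPolygon m P₀ ∧ IsRegularPolygon n P₁ ∧
      -- `Q` realises the `E`-construction of their product
      IsVertexPreservingRealisation (P₀ ×ˢ P₁) Q p ∧
      -- the projections of `Q` are the `E`-constructions of the factors
      IsVertexPreservingRealisation P₀ (Prod.fst '' Q) (fun F₀ => (p (F₀ ×ˢ P₁)).1) ∧
      IsVertexPreservingRealisation P₁ (Prod.snd '' Q) (fun F₁ => (p (P₀ ×ˢ F₁)).2) ∧
      -- these are regular polygons too
      IsRegularPolygon m (Prod.fst '' Q) ∧ IsRegularPolygon n (Prod.snd '' Q) ∧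
      -- all intersection ratios are equal in each factor
      (∃ r₀ : ℝ, ∀ F₀ F₁, IsFacet P₀ F₀ → IsFacet P₁ F₁ →
        HasIntersectionRatio P₀ (p (P₀ ×ˢ F₁)).1 (p (F₀ ×ˢ P₁)).1 r₀) ∧
      (∃ r₁ : ℝ, ∀ F₀ F₁, IsFacet P₀ F₀ → IsFacet P₁ F₁ →
        HasIntersectionRatio P₁ (p (F₀ ×ˢ P₁)).2 (p (P₀ ×ˢ F₁)).2 r₁)) ↔
    (1 : ℝ) / 2 ≤ 1 / (m : ℝ) + 1 / (n : ℝ) := by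
  constructor
  · rintro ⟨P₀, P₁, Q, p, hP₀, hP₁, h, h₀, h₁, hQ₀, hQ₁, ⟨r₀, hr₀⟩, ⟨r₁, hr₁⟩⟩
    exact half_le_of_realisation hm hn hP₀ hP₁ h h₀ h₁ hQ₀ hQ₁ hr₀ hr₁
  · exact exists_realisation hm hn
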